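/- Let $(M,d)$ be a locally compact separable metric space and $m$ a positive Radon measure on $M$ with full support. Write $B(x,r)$ for open balls and $V(x,r)=m(B(x,r))$. Assume that $V(x,r)<\infty$ for all $x\in M$, $r>0$, and that there are constants $a_1\in(0,1]$, $a_2\ge 1$, $0<d_1\le d_2$ such that $$a_1\Big(\frac Rr\Big)^{d_1}\le \frac{V(x,R)}{V(x,r)}\le a_2\Big(\frac Rr\Big)^{d_2}\qquad (x\in M,\ 0<r<R).$$ Let ${\bf M}=(\{X_t\}_{t\ge0},\{P_x\})$ be a conservative $m$-symmetric diffusion process on $M$ (a Hunt process, with cemetery $\Delta$ adjoined to $M$, whose paths are a.s. continuous up to the lifetime) whose Dirichlet form $({\cal E},{\cal F})$ is regular on $L^2(M;m)$. Here the Dirichlet form of an $m$-symmetric process with transition semigroup $T_t$ is ${\cal E}(u,u)=\lim_{t\downarrow0}\frac1t\langle u-T_tu,u\rangle_{L^2(M;m)}$, with domain ${\cal F}=\{u\in L^2(M;m): {\cal E}(u,u)<\infty\}$; it is regular if ${\cal F}\cap C_0(M)$ is dense in ${\cal F}$ for the norm $({\cal E}(u,u)+\|u\|_{L^2}^2)^{1/2}$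 and in $C_0(M)$ for the uniform norm, where $C_0(M)$ is the space of continuous functions with compact support. A heat kernel of a process $\{X_t\}$, with exceptional set $N$, consists of a Borel set $N\subset M$ that is properly exceptional ($m(N)=0$ and, for every $x\in M\setminus N$, $P_x$-a.s. neither $X_t$ nor $X_{t-}$ lies in $N$ for any $t>0$) and a nonnegative measurable kernel $p(t,x,y)$ on $(0,\infty)\times(M\setminus N)^2$ that is symmetric in $x,y$ and satisfies $P_x(X_t\in A)=\int_A p(t,x,y)\,m(dy)$ for every Borel set $A\subset M$ and $p(t+s,x,y)=\int_M p(t,x,z)p(s,z,y)\,m(dz)$. Assume that ${\bf M}$ has a heat kernel $p$ with exceptional set $N$ such that, for some $\beta_1,\beta_2\in[2,\infty)$ and positive constants $c_i,C_i$ ($1\le i\le4$), for all $t>0$ and $x,y\in M\setminus N$: if $t\le \max\{1,d(x,y)\}$, then $$\frac{c_1}{V(x,t^{1/\beta_1})}\exp\Big\{-C_1\Big(\frac{d(x,y)^{\beta_1}}t\Big)^{\frac1{\beta_1-1}}\Big\}\le p(t,x,y)\le \frac{c_2}{V(x,t^{1/\beta_1})}\exp\Big\{-C_2\Big(\frac{d(x,y)^{\beta_1}}t\Big)^{\frac1{\beta_1-1}}\Big\},$$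 and if $t\ge\max\{1,d(x,y)\}$, then $$\frac{c_3}{V(x,t^{1/\beta_2})}\exp\Big\{-C_3\Big(\frac{d(x,y)^{\beta_2}}t\Big)^{\frac1{\beta_2-1}}\Big\}\le p(t,x,y)\le \frac{c_4}{V(x,t^{1/\beta_2})}\exp\Big\{-C_4\Big(\frac{d(x,y)^{\beta_2}}t\Big)^{\frac1{\beta_2-1}}\Big\}.$$ Let $\gamma\in(0,1)$ and let $\{\tau_t\}_{t\ge0}$ be a $\gamma$-stable subordinator (an increasing Lévy process on $[0,\infty)$ with $E[e^{-\lambda\tau_t}]=e^{-t\lambda^\gamma}$ for $\lambda,t>0$), defined on the same space as ${\bf M}$ and independent of $\{X_t\}$ under each $P_x$, $x\in M$. Let ${\bf M}^{(1)}$ be the subordinated process $Y_t=X_{\tau_t}$, let $({\cal E}^{(1)},{\cal F}^{(1)})$ be its Dirichlet form, and put $$\phi(r)=r^{\gamma\beta_1}{\bf 1}_{\{r<1\}}+r^{\gamma\beta_2}{\bf 1}_{\{r\ge1\}}\qquad(r\ge0),$$ with inverse function $\phi^{-1}$ on $[0,\infty)$. Then: 1. $({\cal E}^{(1)},{\cal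 F}^{(1)})$ is regular on $L^2(M;m)$. There is a symmetric nonnegative measurable jump kernel $J$ on $M\times M$ such that $${\cal E}^{(1)}(u,u)=\iint_{x\neq y}(u(x)-u(y))^2J(x,y)\,m(dx)\,m(dy)\qquad(u\in{\cal F}^{(1)}\cap C_0(M)),$$ and there are positive constants $a,b$ such that for all $x,y\in M\setminus N$ with $x\ne y$, $$\frac{a}{V(x,d(x,y))\phi(d(x,y))}\le J(x,y)\le\frac{b}{V(x,d(x,y))\phi(d(x,y))}.$$ 2. There are positive constants $a,b$ such that for all $u\in{\cal F}^{(1)}\cap C_0(M)$, $$a\,I(u)\le{\cal E}^{(1)}(u,u)\le b\,I(u),\qquad I(u)=\iint_{x\ne y}\frac{(u(x)-u(y))^2}{V(x,d(x,y))\phi(d(x,y))}\,m(dx)\,m(dy).$$ 3. ${\bf M}^{(1)}$ has a heat kernel $q$ with the same exceptional set $N$, and there are positive constants $a,b$ such that for all $t>0$ and $x,y\in M\setminus N$, $$a\min\Big\{\frac1{V(x,\phi^{-1}(t))},\frac t{V(x,d(x,y))\phi(d(x,y))}\Big\}\le q(t,x,y)\le b\min\Big\{\frac1{V(x,\phi^{-1}(t))},\frac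 t{V(x,d(x,y))\phi(d(x,y))}\Big\},$$ where for $x=y$ the second term of the minimum is $+\infty$. -/

import Mathlib

open Set Filter Topology MeasureTheory ProbabilityTheory
open scoped NNReal ENNReal

/-! ### Volume growth and the scale function -/

/-- `V(x, r) = m(B(x, r))`, as a real number. -/
noncomputable def vol {M : Type*} [MetricSpace M] [MeasurableSpace M] (m : Measure M)
    (x : M) (r : ℝ) : ℝ :=
  m.real (Metric.ball x r)

/-- All balls have finite measure, and the volume ratios of concentric balls are bounded above and
below by powers of the ratio of the radii. -/
def VolumeGrowth {M : Type*} [MetricSpace M] [MeasurableSpace M] (m : Measure M) : Prop :=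
  (∀ (x : M) (r : ℝ), 0 < r → m (Metric.ball x r) < ∞) ∧
  ∃ c₁ c₂ d₁ d₂ : ℝ, 0 < c₁ ∧ c₁ ≤ 1 ∧ 1 ≤ c₂ ∧ 0 < d₁ ∧ d₁ ≤ d₂ ∧
    ∀ (x : M) (r R : ℝ), 0 < r → r < R →
      c₁ * (R / r) ^ d₁ ≤ vol m x R / vol m x r ∧
      vol m x R / vol m x r ≤ c₂ * (R / r) ^ d₂

/-- `φ(r) = r ^ (γ β₁)` for `r < 1` and `φ(r) = r ^ (γ β₂)` for `r ≥ 1`. -/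
noncomputable def scale (γ β₁ β₂ r : ℝ) : ℝ :=
  if r < 1 then r ^ (γ * β₁) else r ^ (γ * β₂)

/-- The inverse function of `scale γ β₁ β₂` on `[0, ∞)`; see `scaleInv_scale`, `scale_scaleInv`. -/
noncomputable def scaleInv (γ β₁ β₂ t : ℝ) : ℝ :=
  if t < 1 then t ^ (1 / (γ * β₁)) else t ^ (1 / (γ * β₂))

theorem scale_scaleInv {γ β₁ β₂ t : ℝ} (hγ : 0 < γ) (h₁ : 0 < β₁) (h₂ : 0 < β₂) (ht : 0 ≤ t) :
    scale γ β₁ β₂ (scaleInv γ β₁ β₂ t) = t := by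
  have k₁ : 0 < γ * β₁ := mul_pos hγ h₁
  have k₂ : 0 < γ * β₂ := mul_pos hγ h₂
  unfold scale scaleInv
  by_cases h : t < 1
  · have : t ^ (1 / (γ * β₁)) < 1 := Real.rpow_lt_one ht h (by positivity)
    rw [if_pos h, if_pos this, ← Real.rpow_mul ht, one_div_mul_cancel k₁.ne', Real.rpow_one]
  · have : ¬ t ^ (1 / (γ * β₂)) < 1 :=
      not_lt.mpr (Real.one_le_rpow (not_lt.mp h) (by positivity))
    rw [if_neg h, if_neg this, ← Real.rpow_mul ht, one_div_mul_cancel k₂.ne', Real.rpow_one]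

theorem scaleInv_scale {γ β₁ β₂ r : ℝ} (hγ : 0 < γ) (h₁ : 0 < β₁) (h₂ : 0 < β₂) (hr : 0 ≤ r) :
    scaleInv γ β₁ β₂ (scale γ β₁ β₂ r) = r := by
  have k₁ : 0 < γ * β₁ := mul_pos hγ h₁
  have k₂ : 0 < γ * β₂ := mul_pos hγ h₂
  unfold scale scaleInv
  by_cases h : r < 1
  · have : r ^ (γ * β₁) < 1 := Real.rpow_lt_one hr h k₁
    rw [if_pos h, if_pos this, ← Real.rpow_mul hr, mul_one_div_cancel k₁.ne', Real.rpow_one]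
  · have : ¬ r ^ (γ * β₂) < 1 := not_lt.mpr (Real.one_le_rpow (not_lt.mp h) k₂.le)
    rw [if_neg h, if_neg this, ← Real.rpow_mul hr, mul_one_div_cancel k₂.ne', Real.rpow_one]

/-! ### Hunt processes -/

/-- The one-point compactification `M ∪ {Δ}` carries its Borel σ-algebra. If `M` is compact, then
`Δ` is an isolated point. -/
instance OnePoint.instMeasurableSpaceBorel {M : Type*} [TopologicalSpace M] :
    MeasurableSpace (OnePoint M) :=
  borel _

instance OnePoint.instBorelSpace {M : Type*} [TopologicalSpace M] : BorelSpace (OnePoint M) :=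
  ⟨rfl⟩

/-- A Hunt process on `M` with cemetery `Δ = ∞`: a normal strong Markov process with values in
`M ∪ {Δ}`, whose paths are right continuous with left limits in `M ∪ {Δ}`, absorbed at `Δ` and
quasi-left-continuous. -/
structure HuntProcess (M : Type*) [MetricSpace M] [MeasurableSpace M] (Ω : Type*)
    [mΩ : MeasurableSpace Ω] where
  /-- the process -/
  X : ℝ≥0 → Ω → OnePoint M
  /-- the law of the process started from a point -/
  P : OnePoint M → Measure Ω
  /-- an admissible filtration -/
  filt : Filtration ℝ≥0 mΩ
  isProbabilityMeasure : ∀ x, IsProbabilityMeasure (P x)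
  filt_rightContinuous : ∀ t : ℝ≥0, (⨅ s > t, (filt s : MeasurableSpace Ω)) = filt t
  adapted : ∀ t, Measurable[filt t] (X t)
  measurable_transition : ∀ (t : ℝ≥0) (E : Set (OnePoint M)), MeasurableSet E →
    Measurable fun x => P x (X t ⁻¹' E)
  normal : ∀ x, ∀ᵐ ω ∂P x, X 0 ω = x
  absorbed : ∀ (ω : Ω) (s t : ℝ≥0), s ≤ t → X s ω = OnePoint.infty → X t ω = OnePoint.infty
  right_continuous : ∀ (ω : Ω) (t : ℝ≥0), ContinuousWithinAt (fun s => X s ω) (Ici t) t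
  left_limits : ∀ (ω : Ω) (t : ℝ≥0), 0 < t → ∃ z, Tendsto (fun s => X s ω) (𝓝[<] t) (𝓝 z)
  /-- `P_x(Λ ∩ {σ < ∞, X_{σ+s} ∈ E}) = E_x[P_{X_σ}(X_s ∈ E) ; Λ ∩ {σ < ∞}]` for every stopping
  time `σ` and every `Λ` in the σ-algebra of events up to `σ` -/
  strong_markov : ∀ (x : OnePoint M) (σ : Ω → WithTop ℝ≥0) (hσ : IsStoppingTime filt σ)
    (s : ℝ≥0) (E : Set (OnePoint M)), MeasurableSet E →
    ∀ Λ : Set Ω, MeasurableSet[hσ.measurableSpace] Λ →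
      P x (Λ ∩ {ω | σ ω ≠ ⊤ ∧ X ((σ ω).untopD 0 + s) ω ∈ E}) =
        ∫⁻ ω in Λ ∩ {ω | σ ω ≠ ⊤}, P (X ((σ ω).untopD 0) ω) (X s ⁻¹' E) ∂P x
  /-- if stopping times `σ n` increase to `T`, then `X_{σ n} → X_T` almost surely on `{T < ∞}` -/
  quasi_left_continuous : ∀ (x : OnePoint M) (σ : ℕ → Ω → WithTop ℝ≥0),
    (∀ n, IsStoppingTime filt (σ n)) → (∀ ω, Monotone fun n => σ n ω) →
    ∀ᵐ ω ∂P x, ∀ T : ℝ≥0, IsLUB (range fun n => σ n ω) (T : WithTop ℝ≥0) →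
      Tendsto (fun n => X ((σ n ω).untopD 0) ω) atTop (𝓝 (X T ω))

/-- A diffusion: almost surely, paths are continuous on `[0, ζ)`, where `ζ` is the lifetime. -/
def HuntProcess.IsDiffusion {M : Type*} [MetricSpace M] [MeasurableSpace M] {Ω : Type*}
    [MeasurableSpace Ω] (H : HuntProcess M Ω) : Prop :=
  ∀ x : M, ∀ᵐ ω ∂H.P (x : OnePoint M), ∀ t : ℝ≥0, H.X t ω ≠ OnePoint.infty →
    ContinuousAt (fun s => H.X s ω) t

/-! ### Symmetric processes and their Dirichlet forms

The notions below only use a family of random variables `X t : Ω → M ∪ {Δ}` and laws `P x`. -/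

section SymmProc

variable {M : Type*} [MetricSpace M] [MeasurableSpace M] {Ω : Type*} [MeasurableSpace Ω]

/-- `m`-symmetry of the transition function `P_x(X_t ∈ dy)` on `M`. -/
def IsSymmetricProcess (m : Measure M) (X : ℝ≥0 → Ω → OnePoint M)
    (P : OnePoint M → Measure Ω) : Prop :=
  ∀ (t : ℝ≥0) (A B : Set M), MeasurableSet A → MeasurableSet B →
    ∫⁻ x in A, P (x : OnePoint M) {ω | X t ω ∈ ((↑) : M → OnePoint M) '' B} ∂m =
      ∫⁻ x in B, P (x : OnePoint M) {ω | X t ω ∈ ((↑) : M → OnePoint M) '' A} ∂m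

/-- Conservativeness: `P_x(X_t ∈ M) = 1` for `m`-almost every `x`, for every `t > 0`. -/
def IsConservative (m : Measure M) (X : ℝ≥0 → Ω → OnePoint M)
    (P : OnePoint M → Measure Ω) : Prop :=
  ∀ t : ℝ≥0, 0 < t → ∀ᵐ x : M ∂m, P (x : OnePoint M) {ω | X t ω ≠ OnePoint.infty} = 1

/-- The transition semigroup `T_t u (x) = E_x[u(X_t)]`, with `u(Δ) = 0`. -/
noncomputable def transitionOp (X : ℝ≥0 → Ω → OnePoint M) (P : OnePoint M → Measure Ω)
    (t : ℝ≥0) (u : M → ℝ) (x : M) : ℝ :=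
  ∫ ω, (X t ω).elim 0 u ∂P (x : OnePoint M)

/-- The quadratic form `ℰ(u, u) = lim_{t → 0} (1/t) ⟨u - T_t u, u⟩` of a symmetric process, for
`u ∈ L²(m)`, with value `∞` off the form domain. The limit is a supremum because the quotient is
nonnegative and nonincreasing in `t`. -/
noncomputable def dirichletEnergy (m : Measure M) (X : ℝ≥0 → Ω → OnePoint M)
    (P : OnePoint M → Measure Ω) (u : M → ℝ) : ℝ≥0∞ :=
  ⨆ (t : ℝ≥0) (_ : 0 < t),
    ENNReal.ofReal ((t : ℝ)⁻¹ * ∫ x, (u x - transitionOp X P t u x) * u x ∂m)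

/-- Membership in the domain `ℱ` of the Dirichlet form. -/
def InFormDomain (m : Measure M) (X : ℝ≥0 → Ω → OnePoint M)
    (P : OnePoint M → Measure Ω) (u : M → ℝ) : Prop :=
  MemLp u 2 m ∧ dirichletEnergy m X P u < ∞

/-- Membership in `ℱ ∩ C₀(M)`, where `C₀(M)` consists of the continuous functions with compact
support. -/
def InCore (m : Measure M) (X : ℝ≥0 → Ω → OnePoint M)
    (P : OnePoint M → Measure Ω) (u : M → ℝ) : Prop :=
  InFormDomain m X P u ∧ Continuous u ∧ HasCompactSupport u

/-- Regularity of the Dirichlet form: `ℱ ∩ C₀(M)` is dense in `ℱ` for the norm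
`(ℰ(u, u) + ‖u‖²)^(1/2)` and dense in `C₀(M)` for the uniform norm. -/
def IsRegularForm (m : Measure M) (X : ℝ≥0 → Ω → OnePoint M)
    (P : OnePoint M → Measure Ω) : Prop :=
  (∀ u : M → ℝ, InFormDomain m X P u → ∀ ε : ℝ, 0 < ε → ∃ v : M → ℝ, InCore m X P v ∧
    dirichletEnergy m X P (fun x => u x - v x) + ∫⁻ x, ENNReal.ofReal ((u x - v x) ^ 2) ∂m
      < ENNReal.ofReal ε) ∧
  (∀ f : M → ℝ, Continuous f → HasCompactSupport f → ∀ ε : ℝ, 0 < ε →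
    ∃ v : M → ℝ, InCore m X P v ∧ ∀ x, |f x - v x| < ε)

/-- `N` is a properly exceptional Borel set: `m(N) = 0`, and, started outside `N`, almost surely
neither `X_t` nor the left limit `X_{t-}` lies in `N` for any `t > 0`. -/
def IsProperlyExceptional (m : Measure M) (X : ℝ≥0 → Ω → OnePoint M)
    (P : OnePoint M → Measure Ω) (N : Set M) : Prop :=
  MeasurableSet N ∧ m N = 0 ∧
  ∀ x : M, x ∉ N → ∀ᵐ ω ∂P (x : OnePoint M), ∀ t : ℝ≥0, 0 < t →
    X t ω ∉ ((↑) : M → OnePoint M) '' N ∧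
    ∀ z : OnePoint M, Tendsto (fun s => X s ω) (𝓝[<] t) (𝓝 z) → z ∉ ((↑) : M → OnePoint M) '' N

/-- `p` is the heat kernel of the process, with properly exceptional set `N`: a nonnegative jointly
measurable symmetric transition density on `(0, ∞) × (M \ N) × (M \ N)` satisfying the
Chapman–Kolmogorov equation. -/
structure IsHeatKernel (m : Measure M) (X : ℝ≥0 → Ω → OnePoint M)
    (P : OnePoint M → Measure Ω) (N : Set M) (p : ℝ≥0 → M → M → ℝ≥0) : Prop where
  exceptional : IsProperlyExceptional m X P N
  measurable : Measurable fun z : Ioi (0 : ℝ≥0) × (Nᶜ : Set M) × (Nᶜ : Set M) =>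
    p z.1 z.2.1 z.2.2
  symm : ∀ t : ℝ≥0, 0 < t → ∀ x y : M, x ∉ N → y ∉ N → p t x y = p t y x
  density : ∀ t : ℝ≥0, 0 < t → ∀ x : M, x ∉ N → ∀ A : Set M, MeasurableSet A →
    P (x : OnePoint M) {ω | X t ω ∈ ((↑) : M → OnePoint M) '' A} = ∫⁻ y in A, (p t x y : ℝ≥0∞) ∂m
  chapman_kolmogorov : ∀ t s : ℝ≥0, 0 < t → 0 < s → ∀ x y : M, x ∉ N → y ∉ N →
    (p (t + s) x y : ℝ≥0∞) = ∫⁻ z, (p t x z : ℝ≥0∞) * (p s z y : ℝ≥0∞) ∂m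

end SymmProc

/-! ### Sub-Gaussian bounds -/

/-- `c / V(x, t^(1/β)) * exp(-C (d(x,y)^β / t)^(1/(β-1)))`. -/
noncomputable def subGaussian {M : Type*} [MetricSpace M] [MeasurableSpace M] (m : Measure M)
    (β c C : ℝ) (t : ℝ) (x y : M) : ℝ :=
  c / vol m x (t ^ (1 / β)) * Real.exp (-(C * (dist x y ^ β / t) ^ (1 / (β - 1))))

/-- Two-sided sub-Gaussian bounds on `M \ N`, with walk dimension `β₁` for `t ≤ 1 ∨ d(x,y)` and
`β₂` for `t ≥ 1 ∨ d(x,y)`. -/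
def SubGaussianBounds {M : Type*} [MetricSpace M] [MeasurableSpace M] (m : Measure M)
    (N : Set M) (p : ℝ≥0 → M → M → ℝ≥0) (β₁ β₂ : ℝ) : Prop :=
  ∃ c₁ c₂ c₃ c₄ C₁ C₂ C₃ C₄ : ℝ, 0 < c₁ ∧ 0 < c₂ ∧ 0 < c₃ ∧ 0 < c₄ ∧
    0 < C₁ ∧ 0 < C₂ ∧ 0 < C₃ ∧ 0 < C₄ ∧
    ∀ (t : ℝ≥0) (x y : M), 0 < t → x ∉ N → y ∉ N →
      ((t : ℝ) ≤ max 1 (dist x y) →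
        subGaussian m β₁ c₁ C₁ t x y ≤ p t x y ∧ (p t x y : ℝ) ≤ subGaussian m β₁ c₂ C₂ t x y) ∧
      (max 1 (dist x y) ≤ (t : ℝ) →
        subGaussian m β₂ c₃ C₃ t x y ≤ p t x y ∧ (p t x y : ℝ) ≤ subGaussian m β₂ c₄ C₄ t x y)

/-! ### Stable subordinators and subordination -/

/-- A subordinator under `μ`: a Lévy process (started from `0`, with independent and stationary
increments and right-continuous paths) with increasing paths in `[0, ∞)`. -/
structure IsSubordinator {Ω : Type*} [MeasurableSpace Ω] (τ : ℝ≥0 → Ω → ℝ≥0)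
    (μ : Measure Ω) : Prop where
  measurable : ∀ t, Measurable (τ t)
  zero : ∀ᵐ ω ∂μ, τ 0 ω = 0
  monotone : ∀ᵐ ω ∂μ, Monotone fun t => τ t ω
  right_continuous : ∀ᵐ ω ∂μ, ∀ t : ℝ≥0, ContinuousWithinAt (fun s => τ s ω) (Ici t) t
  indep_increments : HasIndepIncrements (fun t ω => (τ t ω : ℝ)) μ
  stationary_increments : ∀ s t : ℝ≥0,
    IdentDistrib (fun ω => (τ (s + t) ω : ℝ) - τ s ω) (fun ω => (τ t ω : ℝ)) μ μ

/-- A `γ`-stable subordinator: `E[exp(-λ τ_t)] = exp(-t λ^γ)`. -/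
def IsStableSubordinator {Ω : Type*} [MeasurableSpace Ω] (γ : ℝ) (τ : ℝ≥0 → Ω → ℝ≥0)
    (μ : Measure Ω) : Prop :=
  IsSubordinator τ μ ∧ ∀ (t : ℝ≥0) (l : ℝ), 0 < t → 0 < l →
    ∫ ω, Real.exp (-(l * τ t ω)) ∂μ = Real.exp (-(t * l ^ γ))

/-- The subordinated process `Y_t = X_{τ_t}`. -/
def subordinate {M Ω : Type*} (X : ℝ≥0 → Ω → OnePoint M) (τ : ℝ≥0 → Ω → ℝ≥0) :
    ℝ≥0 → Ω → OnePoint M :=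
  fun t ω => X (τ t ω) ω

/-! ### Stable-like quantities -/

/-- The kernel `1 / (V(x, d(x,y)) φ(d(x,y)))`, with `φ = scale γ β₁ β₂`. -/
noncomputable def stableJump {M : Type*} [MetricSpace M] [MeasurableSpace M] (m : Measure M)
    (γ β₁ β₂ : ℝ) (x y : M) : ℝ :=
  1 / (vol m x (dist x y) * scale γ β₁ β₂ (dist x y))

/-- `min {1 / V(x, φ⁻¹(t)), t / (V(x, d(x,y)) φ(d(x,y)))}` in `[0, ∞]`, with `φ = scale γ β₁ β₂`;
for `x = y` the second term is `t / 0 = ∞`. -/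
noncomputable def stableHeat {M : Type*} [MetricSpace M] [MeasurableSpace M] (m : Measure M)
    (γ β₁ β₂ : ℝ) (t : ℝ) (x y : M) : ℝ≥0∞ :=
  min (ENNReal.ofReal (1 / vol m x (scaleInv γ β₁ β₂ t)))
    (ENNReal.ofReal t / ENNReal.ofReal (vol m x (dist x y) * scale γ β₁ β₂ (dist x y)))

/-- `∬_{x ≠ y} (u(x) - u(y))² J(x,y) m(dx) m(dy)`. -/
noncomputable def jumpEnergy {M : Type*} [MetricSpace M] [MeasurableSpace M] (m : Measure M)
    (J : M → M → ℝ) (u : M → ℝ) : ℝ≥0∞ :=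
  ∫⁻ z in {z : M × M | z.1 ≠ z.2},
    ENNReal.ofReal ((u z.1 - u z.2) ^ 2 * J z.1 z.2) ∂(m.prod m)

/-! Conditioning on the independent clock writes the transition density of $Y$ as a mixture
$q_t=\int p_s\,\eta_t(ds)$, where $\eta_t$ is the law of $\tau_t$. The jump kernel should be the
corresponding mixture $J=\frac12\int p_s\,\nu(ds)$ by the Lévy measure
$\nu(ds)=\frac{\gamma}{\Gamma(1-\gamma)}s^{-1-\gamma}ds$. The bounds in 1 and 3 are therefore
statements about mixtures of $p_s$.

Write $\Phi$ for `scale 1 β₁ β₂`, so that $\phi=\Phi^\gamma$, and $d=d(x,y)$. With volume doubling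
the sub-Gaussian estimates reduce to three facts: $p_s\le\frac{K}{V(x,d)}\min(1,s/\Phi(d))$; $p_s\le
K/V(x,\Phi^{-1}(s))$; and $p_s\ge c/V(x,\Phi^{-1}(s))$ when $\Phi(d)\le s$. The jump-type upper
bound and the lower bound see the mixing measure $\rho$ only through $\int(1-e^{-ls})\rho(ds)$,
which is at most $tl^\gamma$ and, for small $l$, at least half of it. This treats $\eta_t$ and $\nu$
(with $t=1$) at once: it bounds $\int\min(1,s/R)\,d\rho$ and forces mass of order $tR^{-\gamma}$ in
a window $[R,KR]$ (`exists_window`). The on-diagonal upper bound uses negative moments of $\eta_t$.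

For the form, put $F(s)=\langle u-T_su,u\rangle$. The energy of $Y$ is $\sup_t t^{-1}\int
F\,d\eta_t$, and the point is that it equals $\int F\,d\nu$ (`iSup_inv_mul_lintegral_eq`). Here $F$
is nondecreasing, subadditive and zero at $0$. Monotonicity lets the convergence
$t^{-1}\eta_t\to\nu$ on upper sets pass to $F$ by the layer-cake formula; subadditivity makes the
supremum a limit as $t\to0$. By conservativeness $2F(s)=\iint(u(x)-u(y))^2p_s$, so $\int F\,d\nu$ is
the jump form of $J$, and the bounds on $J$ give part 2.

For regularity, $F(s)\le\min(\|u\|^2,s\,\mathcal E(u,u))$ embeds $\mathcal F$ continuously in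
$\mathcal F^{(1)}$. Moreover $T_\varepsilon$ maps $L^2$ into $\mathcal F$, and $T_\varepsilon u\to
u$ in $\mathcal F^{(1)}$, so the core of $\mathcal F$ is dense in $\mathcal F^{(1)}$. -/

/-! ### The Lévy measure of the stable subordinator -/

/-- The Lévy measure `γ / Γ(1 - γ) s ^ (-1 - γ) ds` of the `γ`-stable subordinator. -/
noncomputable def stableLevyMeasure (γ : ℝ) : Measure ℝ≥0 :=
  ((volume.restrict (Ioi (0 : ℝ))).withDensity
    (fun s => ENNReal.ofReal (γ / Real.Gamma (1 - γ) * s ^ (-1 - γ)))).map Real.toNNReal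

instance stableLevyMeasure.instSFinite (γ : ℝ) : SFinite (stableLevyMeasure γ) := by
  unfold stableLevyMeasure; infer_instance

theorem lintegral_stableLevyMeasure (γ : ℝ) {f : ℝ≥0 → ℝ≥0∞} (hf : Measurable f) :
    ∫⁻ s, f s ∂stableLevyMeasure γ =
      ∫⁻ s in Ioi (0 : ℝ), ENNReal.ofReal (γ / Real.Gamma (1 - γ) * s ^ (-1 - γ)) *
        f s.toNNReal := by
  unfold stableLevyMeasure
  rw [lintegral_map hf measurable_real_toNNReal, lintegral_withDensity_eq_lintegral_mul]
  · rfl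
  · fun_prop
  · exact hf.comp measurable_real_toNNReal

theorem lintegral_rpow_mul_exp_neg {a r : ℝ} (ha : 0 < a) (hr : 0 < r) :
    ∫⁻ t in Ioi (0 : ℝ), ENNReal.ofReal (t ^ (a - 1) * Real.exp (-(r * t))) =
      ENNReal.ofReal ((1 / r) ^ a * Real.Gamma a) := by
  have hG := Real.Gamma_pos_of_pos ha
  have h := Real.integral_rpow_mul_exp_neg_mul_Ioi ha hr
  rw [← h, ofReal_integral_eq_lintegral_ofReal]
  · apply Integrable.of_integral_ne_zero
    rw [h]; positivity
  · filter_upwards [self_mem_ae_restrict measurableSet_Ioi] with t ht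
    have : 0 < t := ht
    positivity

theorem stableLevyMeasure_Ioi {γ r : ℝ} (h0 : 0 < γ) (h1 : γ < 1) (hr : 0 < r) :
    stableLevyMeasure γ (Ioi r.toNNReal) = ENNReal.ofReal (r ^ (-γ) / Real.Gamma (1 - γ)) := by
  have hG := Real.Gamma_pos_of_pos (sub_pos.2 h1)
  rw [← lintegral_indicator_one measurableSet_Ioi,
    lintegral_stableLevyMeasure _ (measurable_one.indicator measurableSet_Ioi)]
  have : ∀ s ∈ Ioi (0 : ℝ), ENNReal.ofReal (γ / Real.Gamma (1 - γ) * s ^ (-1 - γ)) *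
      (Ioi r.toNNReal).indicator 1 s.toNNReal =
      (Ioi r).indicator (fun s => ENNReal.ofReal (γ / Real.Gamma (1 - γ) * s ^ (-1 - γ))) s := by
    intro s hs
    by_cases h : r < s
    · rw [indicator_of_mem (show s ∈ Ioi r from h), indicator_of_mem]
      · simp
      · exact (Real.toNNReal_lt_toNNReal_iff hs).2 h
    · rw [indicator_of_notMem (show s ∉ Ioi r from h), indicator_of_notMem]
      · simp
      · exact fun h' => h ((Real.toNNReal_lt_toNNReal_iff hs).1 h')
  rw [setLIntegral_congr_fun measurableSet_Ioi this, lintegral_indicator measurableSet_Ioi,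
    Measure.restrict_restrict measurableSet_Ioi, inter_eq_left.2 (Ioi_subset_Ioi hr.le),
    ← ofReal_integral_eq_lintegral_ofReal]
  · rw [integral_const_mul, integral_Ioi_rpow_of_lt (by linarith) hr]
    congr 1
    rw [show -1 - γ + 1 = -γ by ring]
    field_simp
  · exact (integrableOn_Ioi_rpow_of_lt (by linarith) hr).const_mul _
  · filter_upwards [self_mem_ae_restrict measurableSet_Ioi] with t ht
    have : 0 < t := hr.trans ht
    positivity

/-- Tonelli applied to $e^{-as}-e^{-bs}=\int_a^b s\,e^{-ls}\,dl$: the $s$-integral is a Gamma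
integral leaving $\gamma l^{\gamma-1}$. The difference is what makes the integral converge near
$s=0$. -/
theorem lintegral_exp_sub_exp_stableLevyMeasure {γ a b : ℝ} (h0 : 0 < γ) (h1 : γ < 1)
    (ha : 0 ≤ a) (hab : a ≤ b) :
    ∫⁻ s : ℝ≥0, ENNReal.ofReal (Real.exp (-(a * s)) - Real.exp (-(b * s)))
      ∂stableLevyMeasure γ = ENNReal.ofReal (b ^ γ - a ^ γ) := by
  have hG := Real.Gamma_pos_of_pos (sub_pos.2 h1)
  set c := γ / Real.Gamma (1 - γ) with hc
  have hc0 : 0 < c := by positivity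
  rw [lintegral_stableLevyMeasure _ (by fun_prop)]
  have key : ∀ s ∈ Ioi (0 : ℝ), ENNReal.ofReal (c * s ^ (-1 - γ)) *
      ENNReal.ofReal (Real.exp (-(a * (s.toNNReal : ℝ))) - Real.exp (-(b * (s.toNNReal : ℝ)))) =
      ∫⁻ l in Ioc a b, ENNReal.ofReal (c * (s ^ ((1 - γ) - 1) * Real.exp (-(l * s)))) := by
    intro s hs
    have hs' : 0 < s := hs
    have hint : ∫ l in a..b, s * Real.exp (-(l * s)) =
        Real.exp (-(a * s)) - Real.exp (-(b * s)) := by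
      rw [intervalIntegral.integral_eq_sub_of_hasDerivAt
        (f := fun l => -Real.exp (-(l * s)))]
      · ring
      · intro l _
        have := (((hasDerivAt_id l).mul_const s).neg.exp).neg
        convert! this using 1
        simp; ring
      · apply Continuous.intervalIntegrable; fun_prop
    rw [Real.coe_toNNReal _ hs'.le, ← hint, intervalIntegral.integral_of_le hab,
      ← ENNReal.ofReal_mul (by positivity), ← integral_const_mul,
      ofReal_integral_eq_lintegral_ofReal]
    · refine lintegral_congr fun l => ?_
      congr 1
      have : s ^ (1 - γ - 1) = s ^ (-1 - γ) * s := by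
        rw [← Real.rpow_add_one hs'.ne']; congr 1; ring
      rw [this]; ring
    · apply Continuous.integrableOn_Ioc; fun_prop
    · exact Eventually.of_forall fun l => by positivity
  rw [setLIntegral_congr_fun measurableSet_Ioi key, lintegral_lintegral_swap]
  · have : ∀ l ∈ Ioc a b, ∫⁻ s in Ioi (0 : ℝ),
        ENNReal.ofReal (c * (s ^ ((1 - γ) - 1) * Real.exp (-(l * s)))) =
        ENNReal.ofReal (γ * l ^ (γ - 1)) := by
      intro l hl
      have hl' : 0 < l := ha.trans_lt hl.1
      simp_rw [ENNReal.ofReal_mul hc0.le]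
      rw [lintegral_const_mul _ (by fun_prop),
        lintegral_rpow_mul_exp_neg (sub_pos.2 h1) hl', ← ENNReal.ofReal_mul hc0.le]
      congr 1
      rw [hc, one_div, ← Real.rpow_neg_one, ← Real.rpow_mul hl'.le]
      rw [show -1 * (1 - γ) = γ - 1 by ring]
      field_simp
    rw [setLIntegral_congr_fun measurableSet_Ioc this, ← ofReal_integral_eq_lintegral_ofReal,
      ← intervalIntegral.integral_of_le hab, intervalIntegral.integral_const_mul,
      integral_rpow (Or.inl (by linarith))]
    · congr 1
      rw [show γ - 1 + 1 = γ by ring]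
      field_simp
    · exact ((intervalIntegral.intervalIntegrable_rpow' (by linarith)).1).const_mul _
    · filter_upwards [self_mem_ae_restrict measurableSet_Ioc] with t ht
      have : 0 < t := ha.trans_lt ht.1
      positivity
  · fun_prop

theorem stableLevyMeasure_zero (γ : ℝ) : stableLevyMeasure γ {0} = 0 := by
  rw [← lintegral_indicator_one (measurableSet_singleton _),
    lintegral_stableLevyMeasure _ (measurable_one.indicator (measurableSet_singleton _))]
  rw [← lintegral_zero (μ := volume.restrict (Ioi (0:ℝ)))]
  refine setLIntegral_congr_fun measurableSet_Ioi fun s hs => ?_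
  have : s.toNNReal ≠ 0 := (Real.toNNReal_pos.2 hs).ne'
  simp [this]

/-! ### Measures on the half-line controlled by their Laplace transforms -/

/-- Since $e^x\ge1+x$, one has $1-e^{-x}\ge x/(1+x)$. This converts Laplace exponents into truncated
first moments. -/
theorem min_one_le_two_mul_one_sub_exp {x : ℝ} (hx : 0 ≤ x) :
    min 1 x ≤ 2 * (1 - Real.exp (-x)) := by
  have h : Real.exp (-x) ≤ 1 / (1 + x) := by
    rw [Real.exp_neg, ← one_div]
    exact one_div_le_one_div_of_le (by positivity) (by linarith [Real.add_one_le_exp x])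
  have h2 : 1 / (1 + x) = 1 - x / (1 + x) := by field_simp; ring
  have h3 : min 1 x ≤ 2 * (x / (1 + x)) := by
    rw [← mul_div_assoc, le_div_iff₀ (by positivity)]
    rcases le_total x 1 with hx1 | hx1
    · rw [min_eq_right hx1]; nlinarith
    · rw [min_eq_left hx1]; linarith
  linarith

/-- The Laplace bound is evaluated at the single point $l=1/R$. -/
theorem lintegral_min_one_le {γ t R : ℝ} (hR : 0 < R) {ρ : Measure ℝ≥0}
    (hU : ∀ l : ℝ, 0 < l → ∫⁻ s : ℝ≥0, ENNReal.ofReal (1 - Real.exp (-(l * s))) ∂ρ ≤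
      ENNReal.ofReal (t * l ^ γ)) :
    ∫⁻ s : ℝ≥0, ENNReal.ofReal (min 1 (s / R)) ∂ρ ≤ ENNReal.ofReal (2 * (t * R ^ (-γ))) := by
  calc _ ≤ ∫⁻ s : ℝ≥0, ENNReal.ofReal 2 * ENNReal.ofReal (1 - Real.exp (-(R⁻¹ * s))) ∂ρ := by
        refine lintegral_mono fun s => ?_
        rw [← ENNReal.ofReal_mul (by norm_num)]
        refine ENNReal.ofReal_le_ofReal ?_
        have := min_one_le_two_mul_one_sub_exp (x := R⁻¹ * s) (by positivity)
        rwa [show (s : ℝ) / R = R⁻¹ * s by rw [div_eq_inv_mul]]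
    _ ≤ _ := by
        rw [lintegral_const_mul _ (by fun_prop), ENNReal.ofReal_mul (p := 2) (by norm_num)]
        gcongr
        refine (hU R⁻¹ (by positivity)).trans_eq ?_
        rw [Real.rpow_neg hR.le, Real.inv_rpow hR.le]

/-- A measure whose Laplace exponent is comparable to `t λ ^ γ` up to `1 / R` charges
`[R, K R]` with mass at least of order `t R ^ (-γ)`. -/
theorem exists_window {γ : ℝ} (h0 : 0 < γ) (h1 : γ < 1) :
    ∃ K c : ℝ, 1 ≤ K ∧ 0 < c ∧ ∀ (t R : ℝ) (ρ : Measure ℝ≥0), 0 ≤ t → 0 < R →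
      (∀ l : ℝ, 0 < l → ∫⁻ s : ℝ≥0, ENNReal.ofReal (1 - Real.exp (-(l * s))) ∂ρ ≤
        ENNReal.ofReal (t * l ^ γ)) →
      (∀ l : ℝ, 0 < l → l ≤ 1 / R → ENNReal.ofReal (t * l ^ γ / 2) ≤
        ∫⁻ s : ℝ≥0, ENNReal.ofReal (1 - Real.exp (-(l * s))) ∂ρ) →
      ENNReal.ofReal (c * (t * R ^ (-γ))) ≤ ρ {s : ℝ≥0 | R ≤ s ∧ s ≤ K * R} := by
  -- The Laplace exponent will be tested at $l=\theta/R$. As $\gamma<1$, a small $\theta$ makes the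
  -- contribution of $s<R$, of order $\theta$, negligible against $\theta^\gamma$; here
  -- $\theta=\theta^\gamma/16$.
  set θ : ℝ := (1 / 16) ^ (1 / (1 - γ)) with hθ
  have hg : 0 < 1 - γ := sub_pos.2 h1
  have hθ0 : 0 < θ := by positivity
  have hθ1 : θ ≤ 1 := Real.rpow_le_one (by norm_num) (by norm_num) (by positivity)
  have hθ2 : θ = θ ^ γ / 16 := by
    have : θ ^ (1 - γ) = 1 / 16 := by
      rw [hθ, ← Real.rpow_mul (by norm_num), one_div_mul_cancel hg.ne', Real.rpow_one]
    calc θ = θ ^ γ * θ ^ (1 - γ) := by rw [← Real.rpow_add hθ0]; simp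
      _ = _ := by rw [this]; ring
  -- Chosen so that $K^{-\gamma}=\theta^\gamma/16$, which makes the contribution of $s>KR$ equally
  -- small.
  set K : ℝ := (θ ^ γ / 16) ^ (-1 / γ) with hK
  have hθγ : 0 < θ ^ γ := by positivity
  have hθγ1 : θ ^ γ ≤ 1 := Real.rpow_le_one hθ0.le hθ1 h0.le
  have hK1 : 1 ≤ K := by
    apply Real.one_le_rpow_of_pos_of_le_one_of_nonpos (by positivity) (by linarith)
    rw [neg_div]; simp only [one_div, Left.neg_nonpos_iff, inv_nonneg]; exact h0.le
  have hKγ : K ^ (-γ) = θ ^ γ / 16 := by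
    rw [hK, ← Real.rpow_mul (by positivity)]
    have : -1 / γ * -γ = 1 := by field_simp
    rw [this, Real.rpow_one]
  refine ⟨K, θ ^ γ / 4, hK1, by positivity, fun t R ρ ht hR hU hL => ?_⟩
  set W : ℝ := t * R ^ (-γ) with hW
  have hW0 : 0 ≤ W := by positivity
  set A : Set ℝ≥0 := {s : ℝ≥0 | R ≤ s ∧ s ≤ K * R} with hA
  have hAm : MeasurableSet A :=
    (measurableSet_le measurable_const measurable_coe_nnreal_real).inter
      (measurableSet_le measurable_coe_nnreal_real measurable_const)
  -- Below the window the integrand is at most $\theta s/R$, above it at most $1$; each is compared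
  -- with a Laplace integrand at scale $R$ or $KR$.
  have hpt : ∀ s : ℝ≥0, ENNReal.ofReal (1 - Real.exp (-(θ / R * s))) ≤ A.indicator 1 s +
      (ENNReal.ofReal (2 * θ) * ENNReal.ofReal (1 - Real.exp (-(R⁻¹ * s))) +
      ENNReal.ofReal 2 * ENNReal.ofReal (1 - Real.exp (-((K * R)⁻¹ * s)))) := by
    intro s
    by_cases hs : s ∈ A
    · rw [indicator_of_mem hs]
      refine le_trans ?_ le_self_add
      simp only [Pi.one_apply, ENNReal.ofReal_le_one]
      linarith [Real.exp_pos (-(θ / R * s))]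
    rw [indicator_of_notMem hs, zero_add, ← ENNReal.ofReal_mul (by positivity),
      ← ENNReal.ofReal_mul (by positivity), ← ENNReal.ofReal_add]
    rotate_left
    · have : Real.exp (-(R⁻¹ * s)) ≤ 1 := Real.exp_le_one_iff.2 (by
        simp only [Left.neg_nonpos_iff]; positivity)
      exact mul_nonneg (by positivity) (by linarith)
    · have : Real.exp (-((K * R)⁻¹ * s)) ≤ 1 := Real.exp_le_one_iff.2 (by
        simp only [Left.neg_nonpos_iff]; positivity)
      exact mul_nonneg (by positivity) (by linarith)
    refine ENNReal.ofReal_le_ofReal ?_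
    have e1 := min_one_le_two_mul_one_sub_exp (x := R⁻¹ * s) (by positivity)
    have e2 := min_one_le_two_mul_one_sub_exp (x := (K * R)⁻¹ * s) (by positivity)
    have e3 : 1 - Real.exp (-(θ / R * s)) ≤ θ / R * s := by
      linarith [Real.add_one_le_exp (-(θ / R * s))]
    by_cases hsR : (s : ℝ) < R
    · have : R⁻¹ * s ≤ 1 := by rw [inv_mul_le_one₀ hR]; exact hsR.le
      rw [min_eq_right this] at e1
      have e5 : 0 ≤ min 1 ((K * R)⁻¹ * (s : ℝ)) := by positivity
      have e6 : θ * (R⁻¹ * s) ≤ θ * (2 * (1 - Real.exp (-(R⁻¹ * s)))) :=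
        mul_le_mul_of_nonneg_left e1 hθ0.le
      have : θ / R * s = θ * (R⁻¹ * s) := by rw [div_eq_mul_inv]; ring
      linarith
    · have hsK : K * R < s := by
        by_contra h
        exact hs ⟨not_lt.1 hsR, not_lt.1 h⟩
      have : 1 ≤ (K * R)⁻¹ * s := by
        rw [le_inv_mul_iff₀ (by positivity)]; linarith
      rw [min_eq_left this] at e2
      have e5 : 0 ≤ min 1 (R⁻¹ * (s : ℝ)) := by positivity
      have e6 : 0 ≤ θ * (2 * (1 - Real.exp (-(R⁻¹ * s)))) :=
        mul_nonneg hθ0.le (e5.trans e1)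
      linarith [Real.exp_pos (-(θ / R * s))]
  have hl : θ / R ≤ 1 / R := by gcongr
  have hlow := hL (θ / R) (by positivity) hl
  have hsum := hlow.trans (lintegral_mono hpt)
  rw [lintegral_add_left (measurable_one.indicator hAm), lintegral_indicator_one hAm,
    lintegral_add_left (by fun_prop), lintegral_const_mul _ (by fun_prop),
    lintegral_const_mul _ (by fun_prop)] at hsum
  have b1 := hU R⁻¹ (by positivity)
  have b2 := hU (K * R)⁻¹ (by positivity)
  have r1 : t * R⁻¹ ^ γ = W := by rw [hW, Real.rpow_neg hR.le, Real.inv_rpow hR.le]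
  have r2 : t * (K * R)⁻¹ ^ γ = W * (θ ^ γ / 16) := by
    rw [← hKγ, hW, Real.inv_rpow (by positivity), Real.mul_rpow (by positivity) hR.le,
      Real.rpow_neg hR.le, Real.rpow_neg (by positivity), mul_inv]
    ring
  have r3 : t * (θ / R) ^ γ = W * θ ^ γ := by
    rw [hW, Real.div_rpow hθ0.le hR.le, Real.rpow_neg hR.le]; ring
  rw [r1] at b1
  rw [r2] at b2
  rw [r3] at hsum
  -- The two tails contribute $2\theta W$ and $2K^{-\gamma}W$, each $W\theta^\gamma/8$. This is half
  -- of the lower bound $W\theta^\gamma/2$, so $W\theta^\gamma/4$ remains for the window.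
  have hsum2 : ENNReal.ofReal (W * θ ^ γ / 2) ≤ ρ A + ENNReal.ofReal (W * θ ^ γ / 4) := by
    refine hsum.trans ?_
    gcongr
    calc _ ≤ ENNReal.ofReal (2 * θ) * ENNReal.ofReal W +
          ENNReal.ofReal 2 * ENNReal.ofReal (W * (θ ^ γ / 16)) := by gcongr
      _ = _ := by
        rw [← ENNReal.ofReal_mul (by positivity), ← ENNReal.ofReal_mul (by positivity),
          ← ENNReal.ofReal_add (by positivity) (by positivity)]
        congr 1
        nth_rewrite 1 [hθ2]
        ring
  have : ENNReal.ofReal (W * θ ^ γ / 2) - ENNReal.ofReal (W * θ ^ γ / 4) ≤ ρ A :=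
    tsub_le_iff_right.2 hsum2
  rw [← ENNReal.ofReal_sub _ (by positivity)] at this
  convert this using 2
  ring

/-! ### Stable laws -/

/-- `ρ` is the law at time `t` of a `γ`-stable subordinator. -/
structure IsStableLaw (γ : ℝ) (t : ℝ≥0) (ρ : Measure ℝ≥0) : Prop where
  isProbabilityMeasure : IsProbabilityMeasure ρ
  laplace : ∀ l : ℝ, 0 < l →
    ∫ s : ℝ≥0, Real.exp (-(l * s)) ∂ρ = Real.exp (-(t * l ^ γ))

theorem integrable_exp_neg_mul_coe {l : ℝ} (hl : 0 ≤ l) (ρ : Measure ℝ≥0) [IsFiniteMeasure ρ] :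
    Integrable (fun s : ℝ≥0 => Real.exp (-(l * s))) ρ := by
  refine Integrable.of_bound (by fun_prop) 1 (Eventually.of_forall fun s => ?_)
  rw [Real.norm_of_nonneg (Real.exp_pos _).le]
  exact Real.exp_le_one_iff.2 (by simp only [Left.neg_nonpos_iff]; positivity)

theorem IsStableLaw.lintegral_exp {γ : ℝ} {t : ℝ≥0} {ρ : Measure ℝ≥0} (h : IsStableLaw γ t ρ)
    {l : ℝ} (hl : 0 < l) :
    ∫⁻ s : ℝ≥0, ENNReal.ofReal (Real.exp (-(l * s))) ∂ρ =
      ENNReal.ofReal (Real.exp (-(t * l ^ γ))) := by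
  have := h.isProbabilityMeasure
  rw [← h.laplace l hl, ofReal_integral_eq_lintegral_ofReal (integrable_exp_neg_mul_coe hl.le ρ)]
  exact Eventually.of_forall fun s => (Real.exp_pos _).le

theorem IsStableLaw.lintegral_one_sub_exp {γ : ℝ} {t : ℝ≥0} {ρ : Measure ℝ≥0}
    (h : IsStableLaw γ t ρ) {l : ℝ} (hl : 0 < l) :
    ∫⁻ s : ℝ≥0, ENNReal.ofReal (1 - Real.exp (-(l * s))) ∂ρ =
      ENNReal.ofReal (1 - Real.exp (-(t * l ^ γ))) := by
  have := h.isProbabilityMeasure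
  have hi := integrable_exp_neg_mul_coe hl.le ρ
  rw [← ofReal_integral_eq_lintegral_ofReal
    (f := fun s : ℝ≥0 => 1 - Real.exp (-(l * s))) ((integrable_const _).sub hi)]
  · rw [integral_sub (integrable_const _) hi, h.laplace l hl]; simp
  · refine Eventually.of_forall fun s => ?_
    have : Real.exp (-(l * s)) ≤ 1 :=
      Real.exp_le_one_iff.2 (by simp only [Left.neg_nonpos_iff]; positivity)
    simpa using this

theorem IsStableLaw.lintegral_one_sub_exp_le {γ : ℝ} {t : ℝ≥0} {ρ : Measure ℝ≥0}
    (h : IsStableLaw γ t ρ) {l : ℝ} (hl : 0 < l) :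
    ∫⁻ s : ℝ≥0, ENNReal.ofReal (1 - Real.exp (-(l * s))) ∂ρ ≤ ENNReal.ofReal (t * l ^ γ) := by
  rw [h.lintegral_one_sub_exp hl]
  exact ENNReal.ofReal_le_ofReal (by linarith [Real.add_one_le_exp (-(t * l ^ γ))])

theorem IsStableLaw.le_lintegral_one_sub_exp {γ : ℝ} {t : ℝ≥0} {ρ : Measure ℝ≥0}
    (h : IsStableLaw γ t ρ) {l : ℝ} (hl : 0 < l) (hl1 : t * l ^ γ ≤ 1) :
    ENNReal.ofReal (t * l ^ γ / 2) ≤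
      ∫⁻ s : ℝ≥0, ENNReal.ofReal (1 - Real.exp (-(l * s))) ∂ρ := by
  rw [h.lintegral_one_sub_exp hl]
  refine ENNReal.ofReal_le_ofReal ?_
  have := min_one_le_two_mul_one_sub_exp (x := t * l ^ γ) (by positivity)
  rw [min_eq_right hl1] at this
  linarith

theorem lintegral_one_sub_exp_stableLevyMeasure {γ l : ℝ} (h0 : 0 < γ) (h1 : γ < 1)
    (hl : 0 ≤ l) :
    ∫⁻ s : ℝ≥0, ENNReal.ofReal (1 - Real.exp (-(l * s))) ∂stableLevyMeasure γ =
      ENNReal.ofReal (l ^ γ) := by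
  have := lintegral_exp_sub_exp_stableLevyMeasure h0 h1 le_rfl hl
  simpa [Real.zero_rpow h0.ne'] using this

/-- Negative moments of stable laws. -/
theorem exists_lintegral_rpow_neg_le {γ k : ℝ} (h0 : 0 < γ) (hk : 0 < k) :
    ∃ C : ℝ, 0 < C ∧ ∀ (t : ℝ≥0) (ρ : Measure ℝ≥0), 0 < t → IsStableLaw γ t ρ →
      ∫⁻ s : ℝ≥0, ENNReal.ofReal (((t : ℝ) ^ (1 / γ) / s) ^ k) ∂ρ ≤ ENNReal.ofReal C := by
  have hG := Real.Gamma_pos_of_pos hk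
  set I : ℝ := ∫ x in Ioi (0 : ℝ), x ^ (k - 1) * Real.exp (-x ^ γ) with hI
  have hIv := integral_rpow_mul_exp_neg_rpow h0 (q := k - 1) (by linarith)
  have hI0 : 0 < I := by
    rw [hI, hIv]
    have := Real.Gamma_pos_of_pos (s := (k - 1 + 1) / γ) (by rw [sub_add_cancel]; positivity)
    positivity
  refine ⟨I / Real.Gamma k, by positivity, fun t ρ ht hρ => ?_⟩
  have := hρ.isProbabilityMeasure
  set T : ℝ := (t : ℝ) ^ (1 / γ) with hT
  have hT0 : 0 < T := by positivity
  -- A negative power is a Gamma integral of exponentials, so Tonelli brings in the Laplace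
  -- transform. Scaling by $T=t^{1/\gamma}$ turns it into $e^{-l^\gamma}$, independent of $t$. At
  -- $s=0$ the convention $T/0=0$ makes the bound trivial.
  have hpt : ∀ s : ℝ≥0, ENNReal.ofReal ((T / s) ^ k) ≤ ENNReal.ofReal (Real.Gamma k)⁻¹ *
      ∫⁻ l in Ioi (0 : ℝ), ENNReal.ofReal (l ^ (k - 1) * Real.exp (-(s / T * l))) := by
    intro s
    rcases eq_or_lt_of_le (zero_le (a := s)) with rfl | hs
    · simp [Real.zero_rpow hk.ne']
    · have hs' : (0 : ℝ) < s := hs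
      rw [lintegral_rpow_mul_exp_neg hk (by positivity), ← ENNReal.ofReal_mul (by positivity)]
      refine ENNReal.ofReal_le_ofReal (le_of_eq ?_)
      rw [one_div_div]; field_simp
  refine (lintegral_mono hpt).trans ?_
  rw [lintegral_const_mul _ (Measurable.lintegral_prod_right' (f := fun z : ℝ≥0 × ℝ =>
      ENNReal.ofReal (z.2 ^ (k - 1) * Real.exp (-(z.1 / T * z.2)))) (by fun_prop)),
    lintegral_lintegral_swap (by fun_prop)]
  have : ∀ l ∈ Ioi (0 : ℝ), ∫⁻ s : ℝ≥0,
      ENNReal.ofReal (l ^ (k - 1) * Real.exp (-(s / T * l))) ∂ρ =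
      ENNReal.ofReal (l ^ (k - 1) * Real.exp (-l ^ γ)) := by
    intro l hl
    have hl' : 0 < l := hl
    simp_rw [ENNReal.ofReal_mul (Real.rpow_nonneg hl'.le (k - 1))]
    rw [lintegral_const_mul _ (by fun_prop)]
    have e : ∀ s : ℝ≥0, (s : ℝ) / T * l = l / T * s := fun s => by ring
    simp_rw [e]
    rw [hρ.lintegral_exp (by positivity)]
    congr 3
    rw [Real.div_rpow hl'.le hT0.le, hT, ← Real.rpow_mul t.coe_nonneg, one_div_mul_cancel h0.ne',
      Real.rpow_one]
    have : (t : ℝ) ≠ 0 := by exact_mod_cast ht.ne'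
    field_simp
  rw [setLIntegral_congr_fun measurableSet_Ioi this, ← ofReal_integral_eq_lintegral_ofReal]
  · rw [← ENNReal.ofReal_mul (by positivity)]
    refine ENNReal.ofReal_le_ofReal (le_of_eq ?_)
    rw [div_eq_inv_mul]
  · exact Integrable.of_integral_ne_zero hI0.ne'
  · filter_upwards [self_mem_ae_restrict measurableSet_Ioi] with l hl
    have : 0 < l := hl
    positivity

/-! ### Convergence of measures on the half-line through exponential moments -/

theorem exp_neg_coe_mem_Icc (s : ℝ≥0) : Real.exp (-(s : ℝ)) ∈ Icc (0 : ℝ) 1 :=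
  ⟨(Real.exp_pos _).le, Real.exp_le_one_iff.2 (by simp)⟩

theorem continuous_comp_exp_neg {f : ℝ → ℝ} (hf : ContinuousOn f (Icc 0 1)) :
    Continuous fun s : ℝ≥0 => f (Real.exp (-(s : ℝ))) :=
  hf.comp_continuous (by fun_prop) exp_neg_coe_mem_Icc

theorem integrable_comp_exp_neg {f : ℝ → ℝ} (hf : ContinuousOn f (Icc 0 1)) (ρ : Measure ℝ≥0)
    [IsFiniteMeasure ρ] : Integrable (fun s : ℝ≥0 => f (Real.exp (-(s : ℝ)))) ρ := by
  obtain ⟨C, hC⟩ := isCompact_Icc.exists_bound_of_continuousOn hf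
  exact Integrable.of_bound (continuous_comp_exp_neg hf).aestronglyMeasurable C
    (Eventually.of_forall fun s => hC _ (exp_neg_coe_mem_Icc s))

/-- The substitution $x=e^{-s}$ turns exponential moments into polynomial moments on $[0,1]$, and
Weierstrass approximation does the rest. Test functions may have a nonzero limit at $s=\infty$, so
no separate tightness argument is needed. -/
theorem tendsto_integral_comp_exp_neg {ι : Type*} {l : Filter ι} {μ : ι → Measure ℝ≥0}
    {μ₀ : Measure ℝ≥0} [∀ i, IsFiniteMeasure (μ i)] [IsFiniteMeasure μ₀]
    (h : ∀ k : ℕ, Tendsto (fun i => ∫ s : ℝ≥0, Real.exp (-(k * s)) ∂μ i) l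
      (𝓝 (∫ s : ℝ≥0, Real.exp (-(k * s)) ∂μ₀)))
    {f : ℝ → ℝ} (hf : ContinuousOn f (Icc 0 1)) :
    Tendsto (fun i => ∫ s : ℝ≥0, f (Real.exp (-(s : ℝ))) ∂μ i) l
      (𝓝 (∫ s : ℝ≥0, f (Real.exp (-(s : ℝ))) ∂μ₀)) := by
  have hpoly : ∀ P : Polynomial ℝ,
      Tendsto (fun i => ∫ s : ℝ≥0, P.eval (Real.exp (-(s : ℝ))) ∂μ i) l
        (𝓝 (∫ s : ℝ≥0, P.eval (Real.exp (-(s : ℝ))) ∂μ₀)) := by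
    intro P
    have e : ∀ (ρ : Measure ℝ≥0) [IsFiniteMeasure ρ],
        ∫ s : ℝ≥0, P.eval (Real.exp (-(s : ℝ))) ∂ρ =
        ∑ k ∈ Finset.range (P.natDegree + 1),
          P.coeff k * ∫ s : ℝ≥0, Real.exp (-(k * s)) ∂ρ := by
      intro ρ _
      have : ∀ s : ℝ≥0, P.eval (Real.exp (-(s : ℝ))) =
          ∑ k ∈ Finset.range (P.natDegree + 1), P.coeff k * Real.exp (-(k * s)) := by
        intro s
        rw [Polynomial.eval_eq_sum_range]
        refine Finset.sum_congr rfl fun k _ => ?_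
        rw [← Real.exp_nat_mul]; ring_nf
      simp_rw [this]
      rw [integral_finsetSum]
      · simp_rw [integral_const_mul]
      · intro k _
        exact (integrable_exp_neg_mul_coe (by positivity) ρ).const_mul _
    simp_rw [fun i => e (μ i)]
    rw [e μ₀]
    exact tendsto_finsetSum _ fun k _ => (h k).const_mul _
  have hclose : ∀ (ρ : Measure ℝ≥0) [IsFiniteMeasure ρ] (δ : ℝ) (P : Polynomial ℝ),
      (∀ x ∈ Icc (0 : ℝ) 1, |P.eval x - f x| < δ) →
      |∫ s : ℝ≥0, P.eval (Real.exp (-(s : ℝ))) ∂ρ - ∫ s : ℝ≥0, f (Real.exp (-(s : ℝ))) ∂ρ| ≤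
        δ * ρ.real univ := by
    intro ρ _ δ P hP
    rw [← integral_sub (integrable_comp_exp_neg P.continuous.continuousOn ρ)
      (integrable_comp_exp_neg hf ρ)]
    exact norm_integral_le_of_norm_le_const (μ := ρ) (C := δ)
      (f := fun s : ℝ≥0 => P.eval (Real.exp (-(s : ℝ))) - f (Real.exp (-(s : ℝ))))
      (Eventually.of_forall fun s => (hP _ (exp_neg_coe_mem_Icc s)).le)
  -- The moment $k=0$ gives convergence, hence eventual boundedness, of the total masses; this
  -- controls the error of uniform approximation.
  have hmass : Tendsto (fun i => (μ i).real univ) l (𝓝 (μ₀.real univ)) := by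
    simpa using h 0
  rw [Metric.tendsto_nhds]
  intro ε hε
  set A := μ₀.real univ + 1 with hA
  have hA0 : 0 < A := by positivity
  obtain ⟨P, hP⟩ := exists_polynomial_near_of_continuousOn 0 1 f hf (ε / (4 * A)) (by positivity)
  filter_upwards [hmass.eventually (gt_mem_nhds (show μ₀.real univ < A by linarith)),
    (Metric.tendsto_nhds.1 (hpoly P)) (ε / 4) (by positivity)] with i hi1 hi2
  have c1 := hclose (μ i) _ P hP
  have c2 := hclose μ₀ _ P hP
  rw [Real.dist_eq] at hi2 ⊢
  have d1 : ε / (4 * A) * (μ i).real univ ≤ ε / 4 := by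
    rw [div_mul_eq_mul_div, div_le_div_iff₀ (by positivity) (by positivity)]
    nlinarith
  have d2 : ε / (4 * A) * μ₀.real univ ≤ ε / 4 := by
    rw [div_mul_eq_mul_div, div_le_div_iff₀ (by positivity) (by positivity)]
    nlinarith
  rw [abs_le] at c1 c2
  rw [abs_lt] at hi2 ⊢
  constructor <;> linarith

/-- A finite measure on the half-line is determined by its exponential moments. -/
theorem ext_of_exp_moments {μ ν : Measure ℝ≥0} [IsFiniteMeasure μ] [IsFiniteMeasure ν]
    (h : ∀ k : ℕ, ∫ s : ℝ≥0, Real.exp (-(k * s)) ∂μ = ∫ s : ℝ≥0, Real.exp (-(k * s)) ∂ν) :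
    μ = ν := by
  set e : ℝ≥0 → ℝ := fun s => Real.exp (-(s : ℝ)) with he
  have hec : Continuous e := by fun_prop
  have hei : Function.Injective e := fun a b hab => by
    have := Real.exp_injective hab
    exact NNReal.coe_injective (neg_injective this)
  have hemb : MeasurableEmbedding e := hec.measurableEmbedding hei
  have hmap : μ.map e = ν.map e := by
    refine ext_of_forall_integral_eq_of_IsFiniteMeasure fun f => ?_
    rw [hemb.integral_map, hemb.integral_map]
    have := tendsto_integral_comp_exp_neg (l := (atTop : Filter ℕ)) (μ := fun _ => μ) (μ₀ := ν)
      (fun k => by rw [h k]; exact tendsto_const_nhds) (f := f) f.continuous.continuousOn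
    exact tendsto_nhds_unique tendsto_const_nhds this
  rw [← hemb.comap_map μ, hmap, hemb.comap_map]

theorem IsStableLaw.laplace_nat {γ : ℝ} {t : ℝ≥0} {ρ : Measure ℝ≥0} (h0 : 0 < γ)
    (h : IsStableLaw γ t ρ) (k : ℕ) :
    ∫ s : ℝ≥0, Real.exp (-(k * s)) ∂ρ = Real.exp (-(t * (k : ℝ) ^ γ)) := by
  have := h.isProbabilityMeasure
  rcases Nat.eq_zero_or_pos k with rfl | hk
  · simp [Real.zero_rpow h0.ne']
  · exact h.laplace k (by exact_mod_cast hk)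

/-- This is what makes the law of $\tau_t$ the same under every $P_x$. -/
theorem IsStableLaw.unique {γ : ℝ} {t : ℝ≥0} {ρ ρ' : Measure ℝ≥0} (h0 : 0 < γ)
    (h : IsStableLaw γ t ρ) (h' : IsStableLaw γ t ρ') : ρ = ρ' := by
  have := h.isProbabilityMeasure
  have := h'.isProbabilityMeasure
  exact ext_of_exp_moments fun k => by rw [h.laplace_nat h0, h'.laplace_nat h0]

/-- The atom at $0$ is bounded by the Laplace transform at every $l$, which tends to $0$. Time $0$,
where there is no density, can thus be ignored in mixtures. -/
theorem IsStableLaw.measure_zero {γ : ℝ} {t : ℝ≥0} {ρ : Measure ℝ≥0} (h0 : 0 < γ) (ht : 0 < t)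
    (h : IsStableLaw γ t ρ) : ρ {0} = 0 := by
  have := h.isProbabilityMeasure
  have hle : ∀ l : ℝ, 0 < l → ρ {0} ≤ ENNReal.ofReal (Real.exp (-(t * l ^ γ))) := by
    intro l hl
    rw [← h.lintegral_exp hl, ← lintegral_indicator_one (measurableSet_singleton _)]
    refine lintegral_mono fun s => ?_
    by_cases hs : s = 0
    · simp [hs]
    · simp [hs]
  have hlim : Tendsto (fun l : ℝ => ENNReal.ofReal (Real.exp (-(t * l ^ γ)))) atTop (𝓝 0) := by
    rw [← ENNReal.ofReal_zero]
    refine ENNReal.tendsto_ofReal ?_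
    refine Real.tendsto_exp_neg_atTop_nhds_zero.comp ?_
    exact (tendsto_rpow_atTop h0).const_mul_atTop (by exact_mod_cast ht)
  exact le_antisymm (ge_of_tendsto hlim ((eventually_gt_atTop 0).mono hle)) zero_le

/-! ### Small time asymptotics of stable laws -/

theorem stableLevyMeasure_singleton (γ : ℝ) (r : ℝ≥0) : stableLevyMeasure γ {r} = 0 := by
  rw [← lintegral_indicator_one (measurableSet_singleton _),
    lintegral_stableLevyMeasure _ (measurable_one.indicator (measurableSet_singleton _))]
  rw [← lintegral_zero (μ := volume.restrict (Ioi (0:ℝ)))]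
  refine lintegral_congr_ae ?_
  have h1 : ∀ᵐ s : ℝ ∂volume.restrict (Ioi (0:ℝ)), s ≠ r :=
    ae_restrict_of_ae (Measure.ae_ne volume (r : ℝ))
  filter_upwards [h1, self_mem_ae_restrict measurableSet_Ioi] with s hs hs0
  have : s.toNNReal ≠ r := fun h => hs (by rw [← h, Real.coe_toNNReal _ (le_of_lt hs0)])
  simp [this]

theorem tendsto_inv_mul_exp_sub_exp (a b : ℝ) :
    Tendsto (fun t : ℝ≥0 => (t : ℝ)⁻¹ * (Real.exp (-(t * a)) - Real.exp (-(t * b))))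
      (𝓝[>] 0) (𝓝 (b - a)) := by
  have hd : HasDerivAt (fun t : ℝ => Real.exp (-(t * a)) - Real.exp (-(t * b))) (b - a) 0 := by
    have h1 : ∀ c : ℝ, HasDerivAt (fun t : ℝ => Real.exp (-(t * c))) (-c) 0 := by
      intro c
      have := ((hasDerivAt_id (0 : ℝ)).mul_const c).neg.exp
      convert! this using 1
      simp
    convert! (h1 a).sub (h1 b) using 1
    ring
  have h2 := hd.tendsto_slope_zero_right
  have h3 : Tendsto (fun t : ℝ≥0 => (t : ℝ)) (𝓝[>] 0) (𝓝[>] 0) := by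
    refine tendsto_nhdsWithin_iff.2 ⟨?_, ?_⟩
    · exact (NNReal.continuous_coe.tendsto' 0 0 rfl).mono_left nhdsWithin_le_nhds
    · filter_upwards [self_mem_nhdsWithin] with t ht
      exact NNReal.coe_pos.2 ht
  refine (h2.comp h3).congr fun t => ?_
  simp

section Asymptotics

variable {γ : ℝ} {η : ℝ≥0 → Measure ℝ≥0}

/-- Continuous cut-offs of the tail have converging rescaled integrals. -/
theorem exists_cutoff_tendsto (h0 : 0 < γ) (h1 : γ < 1)
    (hη : ∀ t : ℝ≥0, 0 < t → IsStableLaw γ t (η t)) {a b : ℝ≥0} (ha : 0 < a) (hab : a < b) :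
    ∃ h : ℝ≥0 → ℝ, Measurable h ∧ (∀ s, 0 ≤ h s) ∧ (∀ s, h s ≤ 1) ∧ (∀ s ≤ a, h s = 0) ∧
      (∀ s, b ≤ s → h s = 1) ∧
      Tendsto (fun t : ℝ≥0 => (t : ℝ)⁻¹ * ∫ s, h s ∂η t) (𝓝[>] 0)
        (𝓝 (∫ s, h s ∂stableLevyMeasure γ)) := by
  -- The weight $1-e^{-s}$ makes $t^{-1}\eta_t$ and $\nu$ finite measures whose $k$-th exponential
  -- moments are differences of Laplace exponents at $k$ and $k+1$.
  set w : ℝ≥0 → ℝ := fun s => 1 - Real.exp (-(s : ℝ)) with hw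
  have hw0 : ∀ s, 0 ≤ w s := fun s => sub_nonneg.2 (exp_neg_coe_mem_Icc s).2
  have hw1 : ∀ s, w s ≤ 1 := fun s => by
    simp only [hw]; linarith [Real.exp_pos (-(s : ℝ))]
  set A : ℝ := Real.exp (-(a : ℝ)) with hA
  set B : ℝ := Real.exp (-(b : ℝ)) with hB
  have hBA : B < A := Real.exp_lt_exp.2 (neg_lt_neg (by exact_mod_cast hab))
  have hA1 : A < 1 := by
    rw [hA, Real.exp_lt_one_iff]
    simpa using ha
  set g : ℝ → ℝ := fun x => max 0 (min 1 ((A - x) / (A - B))) with hg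
  -- This is $g(x)/(1-x)$, made continuous at $x=1$ (that is, $s=0$): the denominator is altered
  -- only for $x>A$, where $g$ vanishes. Thus the cut-off is the weight times a continuous function
  -- of $e^{-s}$.
  set f : ℝ → ℝ := fun x => g x / max (1 - x) (1 - A) with hf
  have hfc : Continuous f := by
    refine Continuous.div (by fun_prop) (by fun_prop) fun x => ?_
    exact (lt_of_lt_of_le (sub_pos.2 hA1) (le_max_right _ _)).ne'
  have hgf : ∀ s : ℝ≥0, g (Real.exp (-(s : ℝ))) = w s * f (Real.exp (-(s : ℝ))) := by
    intro s
    simp only [hf, hw]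
    by_cases hs : Real.exp (-(s : ℝ)) ≤ A
    · rw [max_eq_left (by linarith), mul_div_cancel₀]
      linarith
    · have : g (Real.exp (-(s : ℝ))) = 0 := by
        simp only [hg]
        refine max_eq_left ((min_le_right _ _).trans ?_)
        exact div_nonpos_of_nonpos_of_nonneg (by linarith) (by linarith)
      rw [this]; simp
  have hwm : Measurable fun s => ENNReal.ofReal (w s) := by fun_prop
  have hden : ∀ (ρ : Measure ℝ≥0) (c : ℝ), 0 ≤ c → ∀ u : ℝ≥0 → ℝ,
      ∫ s, u s ∂(ρ.withDensity fun s => ENNReal.ofReal (c * w s)) = c * ∫ s, w s * u s ∂ρ := by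
    intro ρ c hc u
    rw [integral_withDensity_eq_integral_toReal_smul₀ (by fun_prop)
      (Eventually.of_forall fun s => ENNReal.ofReal_lt_top), ← integral_const_mul]
    refine integral_congr_ae (Eventually.of_forall fun s => ?_)
    simp only [smul_eq_mul]
    rw [ENNReal.toReal_ofReal (mul_nonneg hc (hw0 s)), mul_assoc]
  set μ₀ : Measure ℝ≥0 := (stableLevyMeasure γ).withDensity fun s => ENNReal.ofReal (1 * w s)
    with hμ₀
  -- The value $0$ at $t=0$, where nothing is known about `η`, keeps every member of the family
  -- finite.
  set μ : ℝ≥0 → Measure ℝ≥0 := fun t => if 0 < t then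
    (η t).withDensity fun s => ENNReal.ofReal ((t : ℝ)⁻¹ * w s) else 0 with hμ
  have hfin₀ : IsFiniteMeasure μ₀ := by
    refine isFiniteMeasure_withDensity ?_
    have := lintegral_one_sub_exp_stableLevyMeasure h0 h1 zero_le_one
    simp only [one_mul] at this ⊢
    simp only [hw]
    rw [this]; exact ENNReal.ofReal_ne_top
  have hfin : ∀ t, IsFiniteMeasure (μ t) := by
    intro t
    simp only [hμ]
    split_ifs with ht
    · have := (hη t ht).isProbabilityMeasure
      refine isFiniteMeasure_withDensity_ofReal ?_
      refine (Integrable.of_bound (C := (t : ℝ)⁻¹) (by fun_prop)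
        (Eventually.of_forall fun s => ?_)).2
      rw [Real.norm_of_nonneg (mul_nonneg (by positivity) (hw0 s))]
      exact mul_le_of_le_one_right (by positivity) (hw1 s)
    · infer_instance
  have hmom : ∀ k : ℕ, Tendsto (fun t => ∫ s : ℝ≥0, Real.exp (-(k * s)) ∂μ t) (𝓝[>] 0)
      (𝓝 (∫ s : ℝ≥0, Real.exp (-(k * s)) ∂μ₀)) := by
    intro k
    have ew : ∀ s : ℝ≥0, w s * Real.exp (-(k * s)) =
        Real.exp (-(k * s)) - Real.exp (-((k + 1 : ℕ) * s)) := by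
      intro s
      simp only [hw]
      rw [sub_mul, ← Real.exp_add, one_mul]
      congr 2
      push_cast; ring
    have e₀ : ∫ s : ℝ≥0, Real.exp (-(k * s)) ∂μ₀ = ((k + 1 : ℕ) : ℝ) ^ γ - (k : ℝ) ^ γ := by
      rw [hμ₀, hden _ _ zero_le_one, one_mul]
      simp_rw [ew]
      rw [integral_eq_lintegral_of_nonneg_ae, lintegral_exp_sub_exp_stableLevyMeasure h0 h1
        (by positivity) (by push_cast; linarith), ENNReal.toReal_ofReal]
      · exact sub_nonneg.2 (Real.rpow_le_rpow (by positivity) (by push_cast; linarith) h0.le)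
      · refine Eventually.of_forall fun s => ?_
        have := mul_nonneg (hw0 s) (Real.exp_pos (-(k * s))).le
        rw [ew] at this
        exact this
      · fun_prop
    rw [e₀]
    refine (tendsto_inv_mul_exp_sub_exp _ _).congr' ?_
    filter_upwards [self_mem_nhdsWithin] with t ht
    have ht' : 0 < t := ht
    have := (hη t ht).isProbabilityMeasure
    simp only [hμ, if_pos ht']
    rw [hden _ _ (by positivity)]
    simp_rw [ew]
    rw [integral_sub (integrable_exp_neg_mul_coe (by positivity) _)
      (integrable_exp_neg_mul_coe (by positivity) _), (hη t ht).laplace_nat h0,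
      (hη t ht).laplace_nat h0]
  have hlim := tendsto_integral_comp_exp_neg hmom hfc.continuousOn
  refine ⟨fun s => g (Real.exp (-(s : ℝ))), by fun_prop, fun s => le_max_left _ _,
    fun s => max_le zero_le_one (min_le_left _ _), fun s hs => ?_, fun s hs => ?_, ?_⟩
  · have : A ≤ Real.exp (-(s : ℝ)) := Real.exp_le_exp.2 (neg_le_neg (by exact_mod_cast hs))
    simp only [hg]
    refine max_eq_left ((min_le_right _ _).trans ?_)
    exact div_nonpos_of_nonpos_of_nonneg (by linarith) (by linarith)
  · have : Real.exp (-(s : ℝ)) ≤ B := Real.exp_le_exp.2 (neg_le_neg (by exact_mod_cast hs))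
    simp only [hg]
    rw [min_eq_left, max_eq_right zero_le_one]
    rw [one_le_div (by linarith)]; linarith
  · simp_rw [hgf]
    have e := hden (stableLevyMeasure γ) 1 zero_le_one fun s => f (Real.exp (-(s : ℝ)))
    rw [one_mul] at e
    rw [← e]
    refine hlim.congr' ?_
    filter_upwards [self_mem_nhdsWithin] with t ht
    have ht' : 0 < t := ht
    simp only [hμ, if_pos ht']
    rw [hden _ _ (by positivity)]

theorem stableLevyMeasure_Ioi_coe (h0 : 0 < γ) (h1 : γ < 1) {r : ℝ≥0} (hr : 0 < r) :
    stableLevyMeasure γ (Ioi r) = ENNReal.ofReal ((r : ℝ) ^ (-γ) / Real.Gamma (1 - γ)) := by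
  have := stableLevyMeasure_Ioi h0 h1 (r := r) (by exact_mod_cast hr)
  rwa [Real.toNNReal_coe] at this

/-- The tail of $\nu$ is continuous and $\nu$ has no atom at $r$. A cut-off rising just to the right
of $r$ gives the lower bound, one rising just to the left the upper bound. -/
theorem tendsto_inv_mul_measure_of_Ioi_subset_subset_Ici (h0 : 0 < γ) (h1 : γ < 1)
    (hη : ∀ t : ℝ≥0, 0 < t → IsStableLaw γ t (η t)) {r : ℝ≥0} (hr : 0 < r) {U : Set ℝ≥0}
    (hU1 : Ioi r ⊆ U) (hU2 : U ⊆ Ici r) :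
    Tendsto (fun t : ℝ≥0 => (t : ℝ≥0∞)⁻¹ * η t U) (𝓝[>] 0) (𝓝 (stableLevyMeasure γ U)) := by
  have hG := Real.Gamma_pos_of_pos (sub_pos.2 h1)
  set T : ℝ≥0 → ℝ := fun r => (r : ℝ) ^ (-γ) / Real.Gamma (1 - γ) with hT
  have hTpos : ∀ r, 0 ≤ T r := fun r => by positivity
  have hIoi : ∀ r : ℝ≥0, 0 < r → stableLevyMeasure γ (Ioi r) = ENNReal.ofReal (T r) :=
    fun r hr => stableLevyMeasure_Ioi_coe h0 h1 hr
  have hIci : ∀ r : ℝ≥0, 0 < r → stableLevyMeasure γ (Ici r) = ENNReal.ofReal (T r) := by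
    intro r hr
    rw [← hIoi r hr]
    refine le_antisymm ?_ (measure_mono Ioi_subset_Ici_self)
    rw [← Ioi_insert, insert_eq]
    refine (measure_union_le _ _).trans ?_
    rw [stableLevyMeasure_singleton, zero_add]
  have hνU : stableLevyMeasure γ U = ENNReal.ofReal (T r) :=
    le_antisymm ((measure_mono hU2).trans_eq (hIci r hr))
      ((hIoi r hr).symm.trans_le (measure_mono hU1))
  have hTc : ContinuousAt T r := by
    have : (r : ℝ) ≠ 0 := by exact_mod_cast hr.ne'
    refine ContinuousAt.div_const ?_ _
    exact (Real.continuousAt_rpow_const _ _ (Or.inl this)).comp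
      NNReal.continuous_coe.continuousAt
  have hint : ∀ {a b : ℝ≥0} {h : ℝ≥0 → ℝ}, Measurable h → (∀ s, 0 ≤ h s) → (∀ s, h s ≤ 1) →
      (∀ s ≤ a, h s = 0) → (∀ s, b ≤ s → h s = 1) → ∀ ρ : Measure ℝ≥0, ρ (Ioi a) ≠ ∞ →
      ρ (Ici b) ≤ ENNReal.ofReal (∫ s, h s ∂ρ) ∧ ENNReal.ofReal (∫ s, h s ∂ρ) ≤ ρ (Ioi a) := by
    intro a b h hm hn h1 ha hb ρ hρ
    have hle : ∀ s, h s ≤ (Ioi a).indicator 1 s := by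
      intro s
      by_cases hs : s ∈ Ioi a
      · rw [indicator_of_mem hs]; exact h1 s
      · rw [indicator_of_notMem hs, ha s (not_lt.1 hs)]
    have hi1 : Integrable ((Ioi a).indicator (1 : ℝ≥0 → ℝ)) ρ :=
      (integrable_indicator_iff measurableSet_Ioi).2 (integrableOn_const hρ)
    have hi : Integrable h ρ := hi1.mono' hm.aestronglyMeasurable
      (Eventually.of_forall fun s => by rw [Real.norm_of_nonneg (hn s)]; exact hle s)
    rw [ofReal_integral_eq_lintegral_ofReal hi (Eventually.of_forall hn)]
    constructor
    · rw [← lintegral_indicator_one measurableSet_Ici]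
      refine lintegral_mono fun s => ?_
      by_cases hs : s ∈ Ici b
      · simp [indicator_of_mem hs, hb s hs]
      · simp [indicator_of_notMem hs]
    · rw [← lintegral_indicator_one measurableSet_Ioi]
      refine lintegral_mono fun s => ?_
      by_cases hs : s ∈ Ioi a
      · rw [indicator_of_mem hs]; exact ENNReal.ofReal_le_one.2 (h1 s)
      · rw [indicator_of_notMem hs, ha s (not_lt.1 hs)]; simp
  have hmul : ∀ (t : ℝ≥0) (x : ℝ), 0 < t → (t : ℝ≥0∞)⁻¹ * ENNReal.ofReal x =
      ENNReal.ofReal ((t : ℝ)⁻¹ * x) := by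
    intro t x ht
    rw [ENNReal.ofReal_mul (by positivity), ENNReal.ofReal_inv_of_pos (by exact_mod_cast ht),
      ENNReal.ofReal_coe_nnreal]
  rw [hνU]
  refine tendsto_order.2 ⟨fun c hc => ?_, fun c hc => ?_⟩
  · have hev : ∀ᶠ b in 𝓝 r, c < ENNReal.ofReal (T b) :=
      (ENNReal.continuous_ofReal.continuousAt.comp hTc).eventually (lt_mem_nhds hc)
    obtain ⟨b, hbr, hb⟩ := ((hev.filter_mono nhdsWithin_le_nhds).and
      (self_mem_nhdsWithin (a := r) (s := Ioi r))).exists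
    have hb' : r < b := hb
    obtain ⟨h, hm, hn, hle, hz, ho, hlim⟩ := exists_cutoff_tendsto h0 h1 hη hr hb'
    have hν := (hint hm hn hle hz ho (stableLevyMeasure γ)
      (by rw [hIoi r hr]; exact ENNReal.ofReal_ne_top)).1
    rw [hIci b (hr.trans hb')] at hν
    have hlim2 := (ENNReal.continuous_ofReal.tendsto _).comp hlim
    filter_upwards [hlim2.eventually (lt_mem_nhds (hbr.trans_le hν)), self_mem_nhdsWithin]
      with t ht ht0
    have ht0' : 0 < t := ht0
    have := (hη t ht0).isProbabilityMeasure
    refine ht.trans_le ?_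
    simp only [Function.comp_apply]
    rw [← hmul t _ ht0']
    gcongr
    exact (hint hm hn hle hz ho (η t) (measure_ne_top _ _)).2.trans (measure_mono hU1)
  · have hev : ∀ᶠ b in 𝓝 r, ENNReal.ofReal (T b) < c :=
      (ENNReal.continuous_ofReal.continuousAt.comp hTc).eventually (gt_mem_nhds hc)
    have : (𝓝[<] r).NeBot := nhdsLT_neBot_of_exists_lt ⟨0, hr⟩
    obtain ⟨a, ⟨har, ha⟩, ha0⟩ := (((hev.and (lt_mem_nhds hr)).filter_mono
      nhdsWithin_le_nhds).and (self_mem_nhdsWithin (a := r) (s := Iio r))).exists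
    have ha' : a < r := ha0
    obtain ⟨h, hm, hn, hle, hz, ho, hlim⟩ := exists_cutoff_tendsto h0 h1 hη ha ha'
    have hν := (hint hm hn hle hz ho (stableLevyMeasure γ)
      (by rw [hIoi a ha]; exact ENNReal.ofReal_ne_top)).2
    rw [hIoi a ha] at hν
    have hlim2 := (ENNReal.continuous_ofReal.tendsto _).comp hlim
    filter_upwards [hlim2.eventually (gt_mem_nhds (hν.trans_lt har)), self_mem_nhdsWithin]
      with t ht ht0
    have ht0' : 0 < t := ht0
    have := (hη t ht0).isProbabilityMeasure
    refine lt_of_le_of_lt ?_ ht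
    simp only [Function.comp_apply]
    rw [← hmul t _ ht0']
    gcongr
    exact (measure_mono hU2).trans (hint hm hn hle hz ho (η t) (measure_ne_top _ _)).1

theorem stableLevyMeasure_Ioi_zero (h0 : 0 < γ) (h1 : γ < 1) :
    stableLevyMeasure γ (Ioi 0) = ∞ := by
  have hG := Real.Gamma_pos_of_pos (sub_pos.2 h1)
  refine ENNReal.eq_top_of_forall_nnreal_le fun c => ?_
  obtain ⟨r, hr, hrc⟩ : ∃ r : ℝ≥0, 0 < r ∧ (c : ℝ) ≤ (r : ℝ) ^ (-γ) / Real.Gamma (1 - γ) := by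
    set x : ℝ := (c + 1) * Real.Gamma (1 - γ)
    have hx : 0 < x := by positivity
    refine ⟨(x ^ (-1 / γ)).toNNReal, Real.toNNReal_pos.2 (by positivity), ?_⟩
    rw [Real.coe_toNNReal _ (by positivity), ← Real.rpow_mul hx.le]
    have : -1 / γ * -γ = 1 := by field_simp
    rw [this, Real.rpow_one]
    simp only [x]
    rw [mul_div_cancel_right₀ _ hG.ne']
    linarith
  calc (c : ℝ≥0∞) = ENNReal.ofReal c := by simp
    _ ≤ stableLevyMeasure γ (Ioi r) := by
      rw [stableLevyMeasure_Ioi_coe h0 h1 hr]; exact ENNReal.ofReal_le_ofReal hrc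
    _ ≤ _ := measure_mono (Ioi_subset_Ioi zero_le)

/-- For upper sets `U` off `0`, the rescaled masses `η_t(U) / t` converge to the mass for the Lévy
measure, and are bounded by a multiple of it. -/
theorem upperSet_asymptotics (h0 : 0 < γ) (h1 : γ < 1)
    (hη : ∀ t : ℝ≥0, 0 < t → IsStableLaw γ t (η t)) {U : Set ℝ≥0} (hU : IsUpperSet U)
    (hU0 : 0 ∉ U) :
    Tendsto (fun t : ℝ≥0 => (t : ℝ≥0∞)⁻¹ * η t U) (𝓝[>] 0) (𝓝 (stableLevyMeasure γ U)) ∧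
    ∀ t : ℝ≥0, 0 < t → (t : ℝ≥0∞)⁻¹ * η t U ≤
      ENNReal.ofReal (2 * Real.Gamma (1 - γ)) * stableLevyMeasure γ U := by
  have hG := Real.Gamma_pos_of_pos (sub_pos.2 h1)
  rcases U.eq_empty_or_nonempty with rfl | hne
  · simp
  set r := sInf U with hr
  have hU1 : Ioi r ⊆ U := by
    intro s hs
    obtain ⟨u, hu, hus⟩ := exists_lt_of_csInf_lt hne hs
    exact hU hus.le hu
  have hU2 : U ⊆ Ici r := fun s hs => csInf_le (OrderBot.bddBelow U) hs
  rcases eq_or_lt_of_le (zero_le (a := r)) with hr0 | hr0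
  -- If the infimum is $0$ then $U=(0,\infty)$, which has $\eta_t$-mass $1$ and infinite $\nu$-mass.
  · have hUe : U = Ioi 0 := by
      refine Subset.antisymm (fun s hs => ?_) (by rw [hr0]; exact hU1)
      exact pos_iff_ne_zero.2 fun h => hU0 (h ▸ hs)
    rw [hUe, stableLevyMeasure_Ioi_zero h0 h1]
    constructor
    · have hm : ∀ t : ℝ≥0, 0 < t → η t (Ioi 0) = 1 := by
        intro t ht
        have := (hη t ht).isProbabilityMeasure
        have e : Ioi (0 : ℝ≥0) = {0}ᶜ := by ext s; simp [pos_iff_ne_zero]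
        rw [e, prob_compl_eq_one_iff (measurableSet_singleton _)]
        exact (hη t ht).measure_zero h0 ht
      have : Tendsto (fun t : ℝ≥0 => (t : ℝ≥0∞)⁻¹) (𝓝[>] 0) (𝓝 ∞) := by
        rw [← ENNReal.inv_zero]
        refine (continuous_inv.tendsto _).comp ?_
        exact (ENNReal.continuous_coe.tendsto' 0 0 rfl).mono_left nhdsWithin_le_nhds
      refine this.congr' ?_
      filter_upwards [self_mem_nhdsWithin] with t ht
      rw [hm t ht, mul_one]
    · intro t ht
      rw [ENNReal.mul_top]
      · exact le_top
      · simp [hG]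
  · refine ⟨tendsto_inv_mul_measure_of_Ioi_subset_subset_Ici h0 h1 hη hr0 hU1 hU2, fun t ht => ?_⟩
    have hr' : (0 : ℝ) < r := by exact_mod_cast hr0
    -- Truncation at $R=r$ gives $\eta_t([r,\infty))\le2tr^{-\gamma}$; comparison with the tail
    -- $r^{-\gamma}/\Gamma(1-\gamma)$ of $\nu$ produces the constant $2\Gamma(1-\gamma)$.
    have hb := lintegral_min_one_le hr' (fun l hl => (hη t ht).lintegral_one_sub_exp_le hl)
    have hm : η t U ≤ ENNReal.ofReal (2 * (t * (r : ℝ) ^ (-γ))) := by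
      refine le_trans ?_ hb
      refine (measure_mono hU2).trans ?_
      rw [← lintegral_indicator_one measurableSet_Ici]
      refine lintegral_mono fun s => ?_
      by_cases hs : s ∈ Ici r
      · rw [indicator_of_mem hs, min_eq_left]
        · simp
        · rw [one_le_div hr']; exact_mod_cast hs
      · simp [indicator_of_notMem hs]
    calc _ ≤ (t : ℝ≥0∞)⁻¹ * ENNReal.ofReal (2 * (t * (r : ℝ) ^ (-γ))) := by gcongr
      _ = ENNReal.ofReal (2 * Real.Gamma (1 - γ)) * stableLevyMeasure γ (Ioi r) := by
        have ht' : (0 : ℝ) < t := by exact_mod_cast ht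
        rw [stableLevyMeasure_Ioi_coe h0 h1 hr0, ← ENNReal.ofReal_mul (by positivity),
          ← ENNReal.ofReal_coe_nnreal (p := t), ← ENNReal.ofReal_inv_of_pos ht',
          ← ENNReal.ofReal_mul (by positivity)]
        congr 1
        field_simp
      _ ≤ _ := by gcongr

/-- The superlevel sets of $F$ at positive levels are upper sets avoiding $0$, so
`upperSet_asymptotics` applies under the layer-cake integral. -/
theorem tendsto_inv_mul_lintegral_of_monotone (h0 : 0 < γ) (h1 : γ < 1)
    (hη : ∀ t : ℝ≥0, 0 < t → IsStableLaw γ t (η t)) {F : ℝ≥0 → ℝ} (hF : Monotone F)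
    (hF0 : F 0 = 0) :
    Tendsto (fun t : ℝ≥0 => (t : ℝ≥0∞)⁻¹ * ∫⁻ s, ENNReal.ofReal (F s) ∂η t) (𝓝[>] 0)
      (𝓝 (∫⁻ s, ENNReal.ofReal (F s) ∂stableLevyMeasure γ)) := by
  have hnn : ∀ s, 0 ≤ F s := fun s => hF0 ▸ hF zero_le
  have hcake : ∀ ρ : Measure ℝ≥0, ∫⁻ s, ENNReal.ofReal (F s) ∂ρ =
      ∫⁻ y in Ioi 0, ρ {s | y ≤ F s} := fun ρ =>
    lintegral_eq_lintegral_meas_le ρ (Eventually.of_forall hnn) hF.measurable.aemeasurable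
  have hup : ∀ y : ℝ, IsUpperSet {s | y ≤ F s} := fun y s s' hs h => le_trans h (hF hs)
  have hnot : ∀ y ∈ Ioi (0 : ℝ), (0 : ℝ≥0) ∉ {s | y ≤ F s} := fun y hy h => by
    have : y ≤ 0 := hF0 ▸ h
    exact absurd hy (not_lt.2 this)
  have hanti : ∀ ρ : Measure ℝ≥0, Antitone fun y : ℝ => ρ {s | y ≤ F s} := fun ρ y y' hy =>
    measure_mono fun s hs => le_trans hy hs
  -- Sequences suffice, and Fatou's lemma is available along them.
  refine tendsto_of_seq_tendsto fun u hu => ?_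
  have hpos : ∀ᶠ n in atTop, 0 < u n := hu.eventually self_mem_nhdsWithin
  have hcake' : ∀ n, (u n : ℝ≥0∞)⁻¹ * ∫⁻ s, ENNReal.ofReal (F s) ∂η (u n) =
      ∫⁻ y in Ioi 0, (u n : ℝ≥0∞)⁻¹ * η (u n) {s | y ≤ F s} := fun n => by
    rw [hcake, lintegral_const_mul _ (hanti _).measurable]
  have hlim : ∀ᵐ y ∂volume.restrict (Ioi (0 : ℝ)),
      Tendsto (fun n => (u n : ℝ≥0∞)⁻¹ * η (u n) {s | y ≤ F s}) atTop
        (𝓝 (stableLevyMeasure γ {s | y ≤ F s})) := by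
    filter_upwards [self_mem_ae_restrict measurableSet_Ioi] with y hy
    exact (upperSet_asymptotics h0 h1 hη (hup y) (hnot y hy)).1.comp hu
  simp only [Function.comp_def]
  simp_rw [hcake']
  rw [hcake]
  -- When the limit is infinite the dominating function is not integrable, and Fatou's lemma alone
  -- settles the matter.
  by_cases hfin : ∫⁻ y in Ioi (0 : ℝ), stableLevyMeasure γ {s | y ≤ F s} = ∞
  · rw [hfin]
    refine tendsto_of_le_liminf_of_limsup_le ?_ le_top
    rw [← hfin]
    calc _ = ∫⁻ y in Ioi (0 : ℝ),
          liminf (fun n => (u n : ℝ≥0∞)⁻¹ * η (u n) {s | y ≤ F s}) atTop :=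
          lintegral_congr_ae (hlim.mono fun y hy => hy.liminf_eq.symm)
      _ ≤ _ := lintegral_liminf_le fun n => (hanti _).measurable.const_mul _
  · refine tendsto_lintegral_filter_of_dominated_convergence
      (fun y => ENNReal.ofReal (2 * Real.Gamma (1 - γ)) * stableLevyMeasure γ {s | y ≤ F s})
      (Eventually.of_forall fun n => (hanti _).measurable.const_mul _) ?_ ?_ hlim
    · filter_upwards [hpos] with n hn
      filter_upwards [self_mem_ae_restrict measurableSet_Ioi] with y hy
      exact (upperSet_asymptotics h0 h1 hη (hup y) (hnot y hy)).2 _ hn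
    · rw [lintegral_const_mul _ (hanti _).measurable]
      exact ENNReal.mul_ne_top ENNReal.ofReal_ne_top hfin

/-- For monotone subadditive `F` vanishing at `0`, the supremum of `∫ F dη_t / t` is the integral
of `F` for the Lévy measure. -/
theorem iSup_inv_mul_lintegral_eq (h0 : 0 < γ) (h1 : γ < 1)
    (hη : ∀ t : ℝ≥0, 0 < t → IsStableLaw γ t (η t))
    (hconv : ∀ t : ℝ≥0, 0 < t → ∀ f : ℝ≥0 → ℝ≥0∞, Measurable f →
      ∫⁻ s, f s ∂η (t + t) = ∫⁻ a, ∫⁻ b, f (a + b) ∂η t ∂η t)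
    {F : ℝ≥0 → ℝ} (hF : Monotone F) (hF0 : F 0 = 0) (hsub : ∀ a b, F (a + b) ≤ F a + F b) :
    ⨆ (t : ℝ≥0) (_ : 0 < t), (t : ℝ≥0∞)⁻¹ * ∫⁻ s, ENNReal.ofReal (F s) ∂η t =
      ∫⁻ s, ENNReal.ofReal (F s) ∂stableLevyMeasure γ := by
  have hlim := tendsto_inv_mul_lintegral_of_monotone h0 h1 hη hF hF0
  have hnn : ∀ s, 0 ≤ F s := fun s => hF0 ▸ hF zero_le
  have hFm : Measurable fun s => ENNReal.ofReal (F s) := hF.measurable.ennreal_ofReal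
  set g : ℝ≥0 → ℝ≥0∞ := fun t => (t : ℝ≥0∞)⁻¹ * ∫⁻ s, ENNReal.ofReal (F s) ∂η t with hg
  -- Since $\eta_{2t}=\eta_t*\eta_t$ and $F$ is subadditive, the quotient cannot increase when $t$
  -- doubles. Halving $t$ repeatedly then bounds it at any $t$ by its limit at $0$.
  have hdouble : ∀ t : ℝ≥0, 0 < t → g (t + t) ≤ g t := by
    intro t ht
    have := (hη t ht).isProbabilityMeasure
    have h2 : ∫⁻ s, ENNReal.ofReal (F s) ∂η (t + t) ≤ 2 * ∫⁻ s, ENNReal.ofReal (F s) ∂η t := by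
      rw [hconv t ht _ hFm]
      calc _ ≤ ∫⁻ a, ∫⁻ b, (ENNReal.ofReal (F a) + ENNReal.ofReal (F b)) ∂η t ∂η t := by
            refine lintegral_mono fun a => lintegral_mono fun b => ?_
            rw [← ENNReal.ofReal_add (hnn a) (hnn b)]
            exact ENNReal.ofReal_le_ofReal (hsub a b)
        _ = _ := by
            simp_rw [lintegral_add_left measurable_const, lintegral_const, measure_univ, mul_one]
            rw [lintegral_add_left hFm, lintegral_const, measure_univ, mul_one, two_mul]
    simp only [hg]
    calc _ ≤ ((t + t : ℝ≥0) : ℝ≥0∞)⁻¹ * (2 * ∫⁻ s, ENNReal.ofReal (F s) ∂η t) := by gcongr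
      _ = _ := by
        rw [← mul_assoc]
        congr 1
        rw [← two_mul, ENNReal.coe_mul, ENNReal.mul_inv (by simp) (by simp), mul_comm,
          ← mul_assoc]
        rw [ENNReal.coe_ofNat, ENNReal.mul_inv_cancel (by simp) (by simp), one_mul]
  refine le_antisymm (iSup₂_le fun t ht => ?_) ?_
  · have hseq : ∀ n : ℕ, g t ≤ g (t / 2 ^ n) := by
      intro n
      induction n with
      | zero => simp
      | succ n ih =>
        refine ih.trans ?_
        have := hdouble (t / 2 ^ (n + 1)) (by positivity)
        convert! this using 2
        rw [pow_succ]; field_simp; norm_num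
    have htend : Tendsto (fun n : ℕ => t / 2 ^ n) atTop (𝓝[>] 0) := by
      refine tendsto_nhdsWithin_iff.2 ⟨?_, Eventually.of_forall fun n => ?_⟩
      · have : Tendsto (fun n : ℕ => t * (1 / 2 : ℝ≥0) ^ n) atTop (𝓝 (t * 0)) :=
          (NNReal.tendsto_pow_atTop_nhds_zero_of_lt_one (by
            rw [← NNReal.coe_lt_coe]; norm_num)).const_mul t
        rw [mul_zero] at this
        refine this.congr fun n => ?_
        rw [div_pow, one_pow, mul_one_div]
      · exact div_pos ht (by positivity)
    exact ge_of_tendsto' (hlim.comp htend) hseq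
  · refine le_of_tendsto hlim ?_
    filter_upwards [self_mem_nhdsWithin] with t ht
    exact le_iSup₂ (f := fun (t : ℝ≥0) (_ : 0 < t) => g t) t ht

end Asymptotics

/-! ### Symmetric contraction semigroups on a real Hilbert space -/

/-- A semigroup of symmetric contractions of a real inner product space. -/
structure SymmContractionSemigroup (E : Type*) [NormedAddCommGroup E]
    [InnerProductSpace ℝ E] where
  /-- the operators -/
  S : ℝ≥0 → E →ₗ[ℝ] E
  zero : ∀ u, S 0 u = u
  add : ∀ s t u, S (s + t) u = S s (S t u)
  symm : ∀ t u v, inner ℝ (S t u) v = inner ℝ u (S t v)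
  contr : ∀ t u, ‖S t u‖ ≤ ‖u‖

/-- Midpoint convexity makes the increments nondecreasing, so a positive first increment would force
linear growth. -/
theorem le_of_midpoint_convex_of_bounded {d : ℕ → ℝ} {C : ℝ} (hC : ∀ n, d n ≤ C)
    (hd : ∀ n, 2 * d (n + 1) ≤ d n + d (n + 2)) : d 1 ≤ d 0 := by
  by_contra! h
  set δ := d 1 - d 0 with hδ
  have hδ0 : 0 < δ := sub_pos.2 h
  have hinc : ∀ n, δ ≤ d (n + 1) - d n := by
    intro n
    induction n with
    | zero => simp [hδ]
    | succ n ih => linarith [hd n]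
  have hlin : ∀ n : ℕ, d 0 + n * δ ≤ d n := by
    intro n
    induction n with
    | zero => simp
    | succ n ih => push_cast; linarith [hinc n]
  obtain ⟨n, hn⟩ := exists_nat_gt ((C - d 0) / δ)
  rw [div_lt_iff₀ hδ0] at hn
  linarith [hlin n, hC n]

namespace SymmContractionSemigroup

variable {E : Type*} [NormedAddCommGroup E] [InnerProductSpace ℝ E]
  (T : SymmContractionSemigroup E)

/-- The approximating form `⟨u - S_s u, u⟩`. -/
noncomputable def form (u : E) (s : ℝ≥0) : ℝ := inner ℝ (u - T.S s u) u

theorem comm (s t : ℝ≥0) (u : E) : T.S s (T.S t u) = T.S t (T.S s u) := by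
  rw [← T.add, add_comm, T.add]

/-- Each operator is the square of a symmetric one, hence positive. This supplies the positivity
that spectral calculus would otherwise give. -/
theorem inner_S_eq (s : ℝ≥0) (u : E) :
    inner ℝ (T.S s u) u = ‖T.S (s / 2) u‖ ^ 2 := by
  rw [← real_inner_self_eq_norm_sq, ← T.symm, ← T.add, add_halves]

theorem inner_S_nonneg (s : ℝ≥0) (u : E) : 0 ≤ inner ℝ (T.S s u) u := by
  rw [inner_S_eq]; positivity

theorem form_eq (u : E) (s : ℝ≥0) : T.form u s = ‖u‖ ^ 2 - inner ℝ (T.S s u) u := by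
  rw [form, inner_sub_left, real_inner_self_eq_norm_sq]

theorem form_nonneg (u : E) (s : ℝ≥0) : 0 ≤ T.form u s := by
  rw [form_eq, inner_S_eq]
  have := T.contr (s / 2) u
  have : ‖T.S (s / 2) u‖ ^ 2 ≤ ‖u‖ ^ 2 := by gcongr
  linarith

theorem form_le (u : E) (s : ℝ≥0) : T.form u s ≤ ‖u‖ ^ 2 := by
  rw [form_eq]; linarith [T.inner_S_nonneg s u]

theorem form_zero (u : E) : T.form u 0 = 0 := by
  rw [form, T.zero, sub_self, inner_zero_left]

theorem form_parallelogram (u v : E) (s : ℝ≥0) :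
    T.form (u - v) s + T.form (u + v) s = 2 * T.form u s + 2 * T.form v s := by
  simp only [form, map_sub, map_add, inner_sub_left, inner_sub_right, inner_add_left,
    inner_add_right]
  ring

theorem form_sub_le (u v : E) (s : ℝ≥0) :
    T.form (u - v) s ≤ 2 * T.form u s + 2 * T.form v s := by
  linarith [T.form_parallelogram u v s, T.form_nonneg (u + v) s]

theorem form_add_le (u v : E) (s : ℝ≥0) :
    T.form (u + v) s ≤ 2 * T.form u s + 2 * T.form v s := by
  linarith [T.form_parallelogram u v s, T.form_nonneg (u - v) s]

/-- Along the orbit $w_n=S_{nr}u$ the form is bounded. It is also midpoint convex: its value at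
$w_n-w_{n+2}$ is nonnegative, and by symmetry each cross term there is the form at $w_{n+1}$. Hence
it does not increase at the first step. -/
theorem form_S_le (r s : ℝ≥0) (u : E) : T.form (T.S r u) s ≤ T.form u s := by
  set w : ℕ → E := fun n => T.S (n * r) u with hw
  have hsucc : ∀ n, w (n + 1) = T.S r (w n) := fun n => by
    simp only [hw]
    rw [← T.add]; congr 2; push_cast; ring
  have hw0 : w 0 = u := by simp [hw, T.zero]
  have hbd : ∀ n, T.form (w n) s ≤ ‖u‖ ^ 2 := fun n =>
    (T.form_le _ _).trans (by gcongr; exact T.contr _ _)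
  have hmid : ∀ n, 2 * T.form (w (n + 1)) s ≤ T.form (w n) s + T.form (w (n + 2)) s := by
    intro n
    have hnn := T.form_nonneg (w n - w (n + 2)) s
    have e1 : inner ℝ (w n - T.S s (w n)) (w (n + 2)) = T.form (w (n + 1)) s := by
      rw [form, hsucc (n + 1), ← T.symm, map_sub, T.comm r s, ← hsucc n]
    have e2 : inner ℝ (w (n + 2) - T.S s (w (n + 2))) (w n) = T.form (w (n + 1)) s := by
      rw [← e1, inner_sub_left, inner_sub_left, T.symm s (w (n + 2)),
        real_inner_comm (w n) (w (n + 2)), real_inner_comm (T.S s (w n)) (w (n + 2))]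
    have : T.form (w n - w (n + 2)) s = T.form (w n) s + T.form (w (n + 2)) s -
        2 * T.form (w (n + 1)) s := by
      have e : T.form (w n - w (n + 2)) s = T.form (w n) s + T.form (w (n + 2)) s -
          inner ℝ (w n - T.S s (w n)) (w (n + 2)) -
          inner ℝ (w (n + 2) - T.S s (w (n + 2))) (w n) := by
        simp only [form, map_sub, inner_sub_left, inner_sub_right]
        ring
      rw [e, e1, e2]; ring
    linarith
  have := le_of_midpoint_convex_of_bounded hbd hmid
  rwa [hsucc 0, hw0] at this

/-- An increment in time is the form of the smoothed vector $S_{r/2}u$. Nonnegativity of that form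
gives monotonicity, and `form_S_le` gives subadditivity. -/
theorem form_add_sub (u : E) (s r : ℝ≥0) :
    T.form u (s + r) - T.form u r = T.form (T.S (r / 2) u) s := by
  have e1 : inner ℝ (T.S (r / 2) u) (T.S (r / 2) u) = inner ℝ (T.S r u) u := by
    rw [← T.symm, ← T.add, add_halves]
  have e2 : inner ℝ (T.S s (T.S (r / 2) u)) (T.S (r / 2) u) = inner ℝ (T.S (s + r) u) u := by
    rw [← T.symm, ← T.add, ← T.add]
    congr 3
    rw [add_comm (r / 2) s, add_assoc, add_halves]
  rw [form_eq, form_eq, form, inner_sub_left, e1, e2]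
  ring

theorem form_mono (u : E) : Monotone (T.form u) := by
  intro r t hrt
  obtain ⟨s, rfl⟩ := exists_add_of_le hrt
  have := T.form_add_sub u s r
  rw [add_comm] at this
  linarith [T.form_nonneg (T.S (r / 2) u) s]

theorem form_subadd (u : E) (s r : ℝ≥0) : T.form u (s + r) ≤ T.form u s + T.form u r := by
  linarith [T.form_add_sub u s r, T.form_S_le (r / 2) s u]

theorem norm_sub_S_sq_le (u : E) (s : ℝ≥0) : ‖u - T.S s u‖ ^ 2 ≤ 2 * T.form u s := by
  have e : ‖u - T.S s u‖ ^ 2 = ‖u‖ ^ 2 - 2 * inner ℝ (T.S s u) u + ‖T.S s u‖ ^ 2 := by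
    rw [norm_sub_sq_real, real_inner_comm]
  have : ‖T.S s u‖ ^ 2 ≤ ‖u‖ ^ 2 := by gcongr; exact T.contr _ _
  rw [e, form_eq]; linarith

/-- By `form_add_sub`, $\langle u-S_{nt}u,u\rangle$ is the sum over $j<n$ of the forms of
$S_{jt/2}u$ at time $t$. Those with $jt/2\le\varepsilon$ all dominate the form of $S_\varepsilon u$;
there are more than $2\varepsilon/t$ of them, and the sum is at most $\|u\|^2$. -/
theorem form_S_le_div {ε t : ℝ≥0} (hε : 0 < ε) (ht : 0 < t) (u : E) :
    (t : ℝ)⁻¹ * T.form (T.S ε u) t ≤ (2 * ε : ℝ)⁻¹ * ‖u‖ ^ 2 := by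
  set k : ℕ := ⌊2 * ε / t⌋₊ with hk
  have hk1 : (k : ℝ≥0) ≤ 2 * ε / t := Nat.floor_le (by positivity)
  have hk2 : 2 * ε / t < k + 1 := Nat.lt_floor_add_one _
  have htele : ∀ n : ℕ, ∑ j ∈ Finset.range n, T.form (T.S (j * t / 2) u) t = T.form u (n * t) := by
    intro n
    induction n with
    | zero => simp [T.form_zero]
    | succ n ih =>
      rw [Finset.sum_range_succ, ih, ← T.form_add_sub]
      have : (((n + 1 : ℕ) : ℝ≥0)) * t = t + n * t := by push_cast; ring
      rw [this]; ring
  have hle : ∀ j ∈ Finset.range (k + 1), T.form (T.S ε u) t ≤ T.form (T.S (j * t / 2) u) t := by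
    intro j hj
    have hjk : (j : ℝ≥0) ≤ k := by exact_mod_cast Nat.lt_succ_iff.1 (Finset.mem_range.1 hj)
    have : (j : ℝ≥0) * t / 2 ≤ ε := by
      rw [div_le_iff₀ (by norm_num), mul_comm ε 2, ← le_div_iff₀ ht]
      exact hjk.trans hk1
    obtain ⟨r, hr⟩ := exists_add_of_le this
    rw [hr, add_comm, T.add]
    exact T.form_S_le _ _ _
  have hsum := Finset.sum_le_sum hle
  rw [htele, Finset.sum_const, Finset.card_range, nsmul_eq_mul] at hsum
  have h1 : (2 * ε / t : ℝ) ≤ (k + 1 : ℕ) := by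
    have := hk2.le
    rw [← NNReal.coe_le_coe] at this
    push_cast at this ⊢
    exact this
  have h2 : (2 * ε / t : ℝ) * T.form (T.S ε u) t ≤ ‖u‖ ^ 2 :=
    (mul_le_mul_of_nonneg_right h1 (T.form_nonneg _ _)).trans (hsum.trans (T.form_le _ _))
  have ht' : (0 : ℝ) < t := by exact_mod_cast ht
  have hε' : (0 : ℝ) < ε := by exact_mod_cast hε
  rw [le_inv_mul_iff₀ (by positivity)]
  calc _ = (2 * ε / t : ℝ) * T.form (T.S ε u) t := by field_simp
    _ ≤ _ := h2

end SymmContractionSemigroup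

/-! ### Integral operators with symmetric sub-Markov densities -/

/-- Cauchy–Schwarz against the constant $1$ for the measure $k\,m$, of mass at most one. -/
theorem sq_lintegral_mul_le {α : Type*} [MeasurableSpace α] (m : Measure α) {g k : α → ℝ≥0∞}
    (hg : AEMeasurable g m) (hk : Measurable k) (h1 : ∫⁻ y, k y ∂m ≤ 1) :
    (∫⁻ y, g y * k y ∂m) ^ 2 ≤ ∫⁻ y, g y ^ 2 * k y ∂m := by
  have hg' : AEMeasurable g (m.withDensity k) :=
    hg.mono_ac (withDensity_absolutelyContinuous m k)
  have e1 : ∫⁻ y, g y * k y ∂m = ∫⁻ y, g y ∂(m.withDensity k) := by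
    rw [lintegral_withDensity_eq_lintegral_mul₀ hk.aemeasurable hg]
    simp only [Pi.mul_apply, mul_comm]
  have e2 : ∫⁻ y, g y ^ 2 * k y ∂m = ∫⁻ y, g y ^ 2 ∂(m.withDensity k) := by
    rw [lintegral_withDensity_eq_lintegral_mul₀ hk.aemeasurable (hg.pow_const 2)]
    simp only [Pi.mul_apply, mul_comm]
  rw [e1, e2]
  have h := ENNReal.lintegral_mul_le_Lp_mul_Lq (m.withDensity k) Real.HolderConjugate.two_two
    hg' (aemeasurable_const (b := (1 : ℝ≥0∞)))
  simp only [Pi.mul_apply, mul_one, lintegral_const, ENNReal.rpow_two] at h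
  have h2 : (m.withDensity k) univ ≤ 1 := by
    rw [withDensity_apply _ MeasurableSet.univ, Measure.restrict_univ]; exact h1
  have h3 : ∫⁻ y, g y ∂(m.withDensity k) ≤ (∫⁻ y, g y ^ 2 ∂(m.withDensity k)) ^ (1 / 2 : ℝ) := by
    refine h.trans (mul_le_of_le_one_right zero_le ?_)
    exact ENNReal.rpow_le_one (by simpa using h2) (by norm_num)
  calc _ ≤ ((∫⁻ y, g y ^ 2 ∂(m.withDensity k)) ^ (1 / 2 : ℝ)) ^ 2 := by gcongr
    _ = _ := by rw [← ENNReal.rpow_natCast, ← ENNReal.rpow_mul]; norm_num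

/-- A finite, symmetric, jointly measurable, sub-Markov density with square integrable
sections. -/
structure IsSubMarkovDensity {α : Type*} [MeasurableSpace α] (m : Measure α)
    (k : α → α → ℝ≥0∞) : Prop where
  measurable : Measurable (Function.uncurry k)
  symm : ∀ x y, k x y = k y x
  lt_top : ∀ x y, k x y < ∞
  mass_le : ∀ x, ∫⁻ y, k x y ∂m ≤ 1
  sq_lt_top : ∀ x, ∫⁻ y, k x y ^ 2 ∂m < ∞

/-- The integral operator with density `k`. -/
noncomputable def kernelOp {α : Type*} [MeasurableSpace α] (m : Measure α)
    (k : α → α → ℝ≥0∞) (f : α → ℝ) (x : α) : ℝ := ∫ y, f y * (k x y).toReal ∂m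

theorem kernelOp_congr {α : Type*} [MeasurableSpace α] {m : Measure α} (k : α → α → ℝ≥0∞)
    {f g : α → ℝ} (h : f =ᵐ[m] g) : kernelOp m k f = kernelOp m k g := by
  ext x
  exact integral_congr_ae (h.mono fun y hy => by simp only [hy])

theorem lintegral_enorm_sq_lt_top {α : Type*} [MeasurableSpace α] {m : Measure α} {f : α → ℝ}
    (hf : MemLp f 2 m) : ∫⁻ x, ‖f x‖ₑ ^ 2 ∂m < ∞ := by
  have := (eLpNorm_lt_top_iff_lintegral_rpow_enorm_lt_top (by norm_num) (by norm_num)).1 hf.2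
  simpa using this

namespace IsSubMarkovDensity

variable {α : Type*} [MeasurableSpace α] {m : Measure α} {k : α → α → ℝ≥0∞}

theorem measurable_section (h : IsSubMarkovDensity m k) (x : α) : Measurable (k x) :=
  h.measurable.comp measurable_prodMk_left

theorem memLp_section (h : IsSubMarkovDensity m k) (x : α) :
    MemLp (fun y => (k x y).toReal) 2 m := by
  refine ⟨(h.measurable_section x).ennreal_toReal.aestronglyMeasurable, ?_⟩
  rw [eLpNorm_lt_top_iff_lintegral_rpow_enorm_lt_top (by norm_num) (by norm_num)]
  refine lt_of_le_of_lt (le_of_eq (lintegral_congr fun y => ?_)) (h.sq_lt_top x)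
  rw [Real.enorm_of_nonneg ENNReal.toReal_nonneg, ENNReal.ofReal_toReal (h.lt_top x y).ne]
  simp

theorem integrable_mul (h : IsSubMarkovDensity m k) {f : α → ℝ} (hf : MemLp f 2 m) (x : α) :
    Integrable (fun y => f y * (k x y).toReal) m :=
  hf.integrable_mul (h.memLp_section x)

theorem enorm_mul_toReal (h : IsSubMarkovDensity m k) (c : ℝ) (x y : α) :
    ‖c * (k x y).toReal‖ₑ = ‖c‖ₑ * k x y := by
  rw [enorm_mul, Real.enorm_of_nonneg ENNReal.toReal_nonneg,
    ENNReal.ofReal_toReal (h.lt_top x y).ne]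

variable [SigmaFinite m]

theorem stronglyMeasurable_kernelOp (h : IsSubMarkovDensity m k) {f : α → ℝ}
    (hf : AEStronglyMeasurable f m) : StronglyMeasurable (kernelOp m k f) := by
  rw [kernelOp_congr k hf.ae_eq_mk]
  refine StronglyMeasurable.integral_prod_right' (f := fun z : α × α =>
    hf.mk f z.2 * (k z.1 z.2).toReal) ?_
  exact ((hf.stronglyMeasurable_mk.measurable.comp measurable_snd).mul
    h.measurable.ennreal_toReal).stronglyMeasurable

theorem lintegral_swap_mass (h : IsSubMarkovDensity m k) {g : α → ℝ≥0∞} (hg : AEMeasurable g m) :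
    ∫⁻ x, ∫⁻ y, g y * k x y ∂m ∂m = ∫⁻ y, g y * ∫⁻ x, k y x ∂m ∂m := by
  rw [lintegral_lintegral_swap ((hg.comp_snd).mul h.measurable.aemeasurable)]
  refine lintegral_congr fun y => ?_
  simp_rw [fun x => h.symm x y]
  rw [lintegral_const_mul _ (h.measurable_section y)]

/-- The $L^2$ contraction comes from `sq_lintegral_mul_le` in $y$, followed by Tonelli and the
symmetry of $k$. -/
theorem lintegral_enorm_kernelOp_sq_le (h : IsSubMarkovDensity m k) {f : α → ℝ}
    (hf : MemLp f 2 m) :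
    ∫⁻ x, ‖kernelOp m k f x‖ₑ ^ 2 ∂m ≤ ∫⁻ x, ‖f x‖ₑ ^ 2 ∂m := by
  calc _ ≤ ∫⁻ x, (∫⁻ y, ‖f y‖ₑ * k x y ∂m) ^ 2 ∂m := by
        refine lintegral_mono fun x => ?_
        gcongr
        refine (enorm_integral_le_lintegral_enorm _).trans_eq ?_
        exact lintegral_congr fun y => h.enorm_mul_toReal _ _ _
    _ ≤ ∫⁻ x, ∫⁻ y, ‖f y‖ₑ ^ 2 * k x y ∂m ∂m := lintegral_mono fun x =>
        sq_lintegral_mul_le m hf.1.enorm (h.measurable_section x) (h.mass_le x)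
    _ = ∫⁻ y, ‖f y‖ₑ ^ 2 * ∫⁻ x, k y x ∂m ∂m := h.lintegral_swap_mass (hf.1.enorm.pow_const 2)
    _ ≤ _ := lintegral_mono fun y => mul_le_of_le_one_right zero_le (h.mass_le y)

theorem eLpNorm_kernelOp_le (h : IsSubMarkovDensity m k) {f : α → ℝ} (hf : MemLp f 2 m) :
    eLpNorm (kernelOp m k f) 2 m ≤ eLpNorm f 2 m := by
  rw [eLpNorm_eq_lintegral_rpow_enorm_toReal (by norm_num) (by norm_num),
    eLpNorm_eq_lintegral_rpow_enorm_toReal (by norm_num) (by norm_num)]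
  refine ENNReal.rpow_le_rpow ?_ (by norm_num)
  simpa using h.lintegral_enorm_kernelOp_sq_le hf

theorem memLp_kernelOp (h : IsSubMarkovDensity m k) {f : α → ℝ} (hf : MemLp f 2 m) :
    MemLp (kernelOp m k f) 2 m :=
  ⟨(h.stronglyMeasurable_kernelOp hf.1).aestronglyMeasurable,
    (h.eLpNorm_kernelOp_le hf).trans_lt hf.2⟩

theorem integrable_prod (h : IsSubMarkovDensity m k) {f g : α → ℝ} (hf : MemLp f 2 m)
    (hg : MemLp g 2 m) :
    Integrable (fun z : α × α => g z.1 * (f z.2 * (k z.1 z.2).toReal)) (m.prod m) := by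
  have hmeas : AEStronglyMeasurable (fun z : α × α => g z.1 * (f z.2 * (k z.1 z.2).toReal))
      (m.prod m) := by
    exact hg.1.comp_fst.mul (hf.1.comp_snd.mul h.measurable.ennreal_toReal.aestronglyMeasurable)
  refine ⟨hmeas, ?_⟩
  rw [HasFiniteIntegral, lintegral_prod _ hmeas.enorm]
  have hpt : ∀ x y : α, ‖g x * (f y * (k x y).toReal)‖ₑ ≤
      ‖g x‖ₑ ^ 2 * k x y + ‖f y‖ₑ ^ 2 * k x y := by
    intro x y
    rw [enorm_mul, h.enorm_mul_toReal, ← mul_assoc, ← add_mul]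
    gcongr
    rcases le_total ‖g x‖ₑ ‖f y‖ₑ with hl | hl
    · refine le_trans ?_ le_add_self
      rw [sq]; gcongr
    · refine le_trans ?_ le_self_add
      rw [sq]; gcongr
  calc _ ≤ ∫⁻ x, ∫⁻ y, (‖g x‖ₑ ^ 2 * k x y + ‖f y‖ₑ ^ 2 * k x y) ∂m ∂m :=
        lintegral_mono fun x => lintegral_mono fun y => hpt x y
    _ = ∫⁻ x, (‖g x‖ₑ ^ 2 * ∫⁻ y, k x y ∂m + ∫⁻ y, ‖f y‖ₑ ^ 2 * k x y ∂m) ∂m := by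
        refine lintegral_congr fun x => ?_
        rw [lintegral_add_left ((h.measurable_section x).const_mul _),
          lintegral_const_mul _ (h.measurable_section x)]
    _ = ∫⁻ x, ‖g x‖ₑ ^ 2 * ∫⁻ y, k x y ∂m ∂m + ∫⁻ x, ∫⁻ y, ‖f y‖ₑ ^ 2 * k x y ∂m ∂m := by
        rw [lintegral_add_left']
        exact (hg.1.enorm.pow_const 2).mul
          (h.measurable.lintegral_prod_right').aemeasurable
    _ ≤ ∫⁻ x, ‖g x‖ₑ ^ 2 ∂m + ∫⁻ y, ‖f y‖ₑ ^ 2 ∂m := by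
        rw [h.lintegral_swap_mass (hf.1.enorm.pow_const 2)]
        gcongr
        · exact mul_le_of_le_one_right zero_le (h.mass_le _)
        · exact mul_le_of_le_one_right zero_le (h.mass_le _)
    _ < ∞ := ENNReal.add_lt_top.2 ⟨lintegral_enorm_sq_lt_top hg, lintegral_enorm_sq_lt_top hf⟩

theorem integral_kernelOp_mul (h : IsSubMarkovDensity m k) {f g : α → ℝ} (hf : MemLp f 2 m)
    (hg : MemLp g 2 m) :
    ∫ x, g x * kernelOp m k f x ∂m = ∫ x, f x * kernelOp m k g x ∂m := by
  have h1 : ∫ x, g x * kernelOp m k f x ∂m =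
      ∫ x, ∫ y, g x * (f y * (k x y).toReal) ∂m ∂m :=
    integral_congr_ae (Eventually.of_forall fun x => by
      simp only [kernelOp]; rw [integral_const_mul])
  have h2 : ∫ x, f x * kernelOp m k g x ∂m =
      ∫ y, ∫ x, g x * (f y * (k x y).toReal) ∂m ∂m :=
    integral_congr_ae (Eventually.of_forall fun y => by
      simp only [kernelOp]
      rw [← integral_const_mul]
      refine integral_congr_ae (Eventually.of_forall fun x => ?_)
      simp only [h.symm y x]; ring)
  rw [h1, h2]
  exact integral_integral_swap (h.integrable_prod hf hg)

theorem kernelOp_kernelOp {k₁ k₂ k₁₂ : α → α → ℝ≥0∞} (h₁ : IsSubMarkovDensity m k₁)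
    (h₂ : IsSubMarkovDensity m k₂) (h₁₂ : IsSubMarkovDensity m k₁₂)
    (hck : ∀ x y, k₁₂ x y = ∫⁻ z, k₁ x z * k₂ z y ∂m) {f : α → ℝ} (hf : MemLp f 2 m) :
    kernelOp m k₁ (kernelOp m k₂ f) = kernelOp m k₁₂ f := by
  ext x
  have hmeas : AEStronglyMeasurable (fun z : α × α =>
      f z.2 * (k₂ z.1 z.2).toReal * (k₁ x z.1).toReal) (m.prod m) :=
    (hf.1.comp_snd.mul h₂.measurable.ennreal_toReal.aestronglyMeasurable).mul
      (((h₁.measurable_section x).comp measurable_fst).ennreal_toReal.aestronglyMeasurable)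
  have hen : ∀ z y, ‖f y * (k₂ z y).toReal * (k₁ x z).toReal‖ₑ = ‖f y‖ₑ * (k₁ x z * k₂ z y) := by
    intro z y
    rw [h₁.enorm_mul_toReal, h₂.enorm_mul_toReal]; ring
  have hmk : ∀ y, Measurable fun z => k₁ x z * k₂ z y := fun y =>
    (h₁.measurable_section x).mul (h₂.measurable.comp measurable_prodMk_right)
  have hint : Integrable (fun z : α × α =>
      f z.2 * (k₂ z.1 z.2).toReal * (k₁ x z.1).toReal) (m.prod m) := by
    refine ⟨hmeas, ?_⟩
    -- Integrating in the intermediate variable first collapses the two kernels to $k_{12}$, whose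
    -- section at $x$ is square integrable; this justifies Fubini.
    rw [HasFiniteIntegral, lintegral_prod_symm _ hmeas.enorm]
    have : ∀ y, ∫⁻ z, ‖f y * (k₂ z y).toReal * (k₁ x z).toReal‖ₑ ∂m =
        ‖f y * (k₁₂ x y).toReal‖ₑ := by
      intro y
      simp_rw [hen]
      rw [lintegral_const_mul _ (hmk y), ← hck, h₁₂.enorm_mul_toReal]
    simp_rw [this]
    exact (h₁₂.integrable_mul hf x).2
  have e1 : kernelOp m k₁ (kernelOp m k₂ f) x =
      ∫ z, ∫ y, f y * (k₂ z y).toReal * (k₁ x z).toReal ∂m ∂m := by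
    simp only [kernelOp]
    refine integral_congr_ae (Eventually.of_forall fun z => ?_)
    simp only
    rw [integral_mul_const]
  rw [e1, integral_integral_swap hint]
  refine integral_congr_ae (Eventually.of_forall fun y => ?_)
  simp only
  simp_rw [mul_assoc]
  rw [integral_const_mul, hck]
  congr 1
  simp_rw [← ENNReal.toReal_mul]
  rw [integral_toReal]
  · congr 1
    exact lintegral_congr fun z => mul_comm _ _
  · exact ((h₂.measurable.comp measurable_prodMk_right).mul
      (h₁.measurable_section x)).aemeasurable
  · exact Eventually.of_forall fun z => ENNReal.mul_lt_top (h₂.lt_top z y) (h₁.lt_top x z)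

/-- The quadratic form of a Markov density as a double integral of squared differences. -/
theorem lintegral_sq_sub_mul (h : IsSubMarkovDensity m k)
    (hmass : ∀ᵐ x ∂m, ∫⁻ y, k x y ∂m = 1) {u : α → ℝ} (hu : MemLp u 2 m) :
    ∫⁻ z : α × α, ENNReal.ofReal ((u z.1 - u z.2) ^ 2) * k z.1 z.2 ∂(m.prod m) =
      ENNReal.ofReal (2 * (∫ x, u x ^ 2 ∂m - ∫ x, u x * kernelOp m k u x ∂m)) := by
  have hkm : AEStronglyMeasurable (fun z : α × α => (k z.1 z.2).toReal) (m.prod m) :=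
    h.measurable.ennreal_toReal.aestronglyMeasurable
  have hC := h.integrable_prod hu hu
  have hsq : MemLp (fun x => u x ^ 2) 1 m := memLp_one_iff_integrable.2 hu.integrable_sq
  have hmass' : ∀ᵐ x ∂m, ∫ y, (k x y).toReal ∂m = 1 := by
    filter_upwards [hmass] with x hx
    rw [integral_toReal (h.measurable_section x).aemeasurable
      (Eventually.of_forall fun y => h.lt_top x y), hx, ENNReal.toReal_one]
  have hA : Integrable (fun z : α × α => u z.1 ^ 2 * (k z.1 z.2).toReal) (m.prod m) := by
    have hm : AEStronglyMeasurable (fun z : α × α => u z.1 ^ 2 * (k z.1 z.2).toReal)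
      (m.prod m) := (hu.1.comp_fst.pow 2).mul hkm
    refine ⟨hm, ?_⟩
    rw [HasFiniteIntegral, lintegral_prod _ hm.enorm]
    have : ∀ x, ∫⁻ y, ‖u x ^ 2 * (k x y).toReal‖ₑ ∂m ≤ ‖u x ^ 2‖ₑ := by
      intro x
      simp_rw [h.enorm_mul_toReal]
      rw [lintegral_const_mul _ (h.measurable_section x)]
      exact mul_le_of_le_one_right zero_le (h.mass_le x)
    exact (lintegral_mono this).trans_lt hu.integrable_sq.2
  have hAv : ∫ z : α × α, u z.1 ^ 2 * (k z.1 z.2).toReal ∂(m.prod m) = ∫ x, u x ^ 2 ∂m := by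
    rw [integral_prod _ hA]
    refine integral_congr_ae ?_
    filter_upwards [hmass'] with x hx
    rw [integral_const_mul, hx, mul_one]
  have hsw : (fun z : α × α => u z.2 ^ 2 * (k z.1 z.2).toReal) =
      (fun z : α × α => u z.1 ^ 2 * (k z.1 z.2).toReal) ∘ Prod.swap := by
    ext z; simp [h.symm z.1 z.2]
  have hB : Integrable (fun z : α × α => u z.2 ^ 2 * (k z.1 z.2).toReal) (m.prod m) := by
    rw [hsw]; exact hA.swap
  have hBv : ∫ z : α × α, u z.2 ^ 2 * (k z.1 z.2).toReal ∂(m.prod m) = ∫ x, u x ^ 2 ∂m := by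
    rw [hsw, ← hAv]
    exact integral_prod_swap (fun z : α × α => u z.1 ^ 2 * (k z.1 z.2).toReal)
  have hCv : ∫ z : α × α, u z.1 * (u z.2 * (k z.1 z.2).toReal) ∂(m.prod m) =
      ∫ x, u x * kernelOp m k u x ∂m := by
    rw [integral_prod _ hC]
    refine integral_congr_ae (Eventually.of_forall fun x => ?_)
    simp only [kernelOp]
    rw [integral_const_mul]
  -- After expansion of the square, unit mass and symmetry turn each of the two square terms into
  -- $\|u\|^2$.
  have e : ∀ z : α × α, (u z.1 - u z.2) ^ 2 * (k z.1 z.2).toReal =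
      (u z.1 ^ 2 * (k z.1 z.2).toReal + u z.2 ^ 2 * (k z.1 z.2).toReal) -
        2 * (u z.1 * (u z.2 * (k z.1 z.2).toReal)) := fun z => by ring
  have hI : Integrable (fun z : α × α => (u z.1 - u z.2) ^ 2 * (k z.1 z.2).toReal) (m.prod m) := by
    simp_rw [e]; exact (hA.add hB).sub (hC.const_mul 2)
  have hv : ∫ z : α × α, (u z.1 - u z.2) ^ 2 * (k z.1 z.2).toReal ∂(m.prod m) =
      2 * (∫ x, u x ^ 2 ∂m - ∫ x, u x * kernelOp m k u x ∂m) := by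
    simp_rw [e]
    have h1 := integral_sub (hA.add hB) (hC.const_mul 2)
    have h2 := integral_add hA hB
    rw [integral_const_mul, hCv] at h1
    rw [hAv, hBv] at h2
    simp only [Pi.add_apply] at h1
    rw [h1, h2]; ring
  rw [← hv, ofReal_integral_eq_lintegral_ofReal hI
    (Eventually.of_forall fun z => mul_nonneg (sq_nonneg _) ENNReal.toReal_nonneg)]
  refine lintegral_congr fun z => ?_
  rw [ENNReal.ofReal_mul (sq_nonneg _), ENNReal.ofReal_toReal (h.lt_top _ _).ne]

end IsSubMarkovDensity

/-! ### The semigroup of a heat density on `L²` -/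

/-- A symmetric Markovian heat density: a measurable family of sub-Markov densities satisfying the
Chapman–Kolmogorov equation, with total mass one almost everywhere. -/
structure IsHeatDensity {α : Type*} [MeasurableSpace α] (m : Measure α)
    (k : ℝ≥0 → α → α → ℝ≥0∞) : Prop where
  measurable : Measurable fun z : ℝ≥0 × α × α => k z.1 z.2.1 z.2.2
  density : ∀ t, 0 < t → IsSubMarkovDensity m (k t)
  chapman_kolmogorov : ∀ t s, 0 < t → 0 < s → ∀ x y,
    k (t + s) x y = ∫⁻ z, k t x z * k s z y ∂m
  mass : ∀ t, 0 < t → ∀ᵐ x ∂m, ∫⁻ y, k t x y ∂m = 1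

/-- The integral operator of a sub-Markov density on `L²`. -/
noncomputable def IsSubMarkovDensity.toLinearMap {α : Type*} [MeasurableSpace α] {m : Measure α}
    [SigmaFinite m] {k : α → α → ℝ≥0∞} (h : IsSubMarkovDensity m k) :
    Lp ℝ 2 m →ₗ[ℝ] Lp ℝ 2 m where
  toFun f := (h.memLp_kernelOp (Lp.memLp f)).toLp _
  map_add' f g := by
    rw [← MemLp.toLp_add]
    refine MemLp.toLp_congr _ _ (Eventually.of_forall fun x => ?_)
    rw [kernelOp_congr k (Lp.coeFn_add f g)]
    simp only [kernelOp, Pi.add_apply, add_mul]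
    exact integral_add (h.integrable_mul (Lp.memLp f) x) (h.integrable_mul (Lp.memLp g) x)
  map_smul' c f := by
    rw [RingHom.id_apply, ← MemLp.toLp_const_smul]
    refine MemLp.toLp_congr _ _ (Eventually.of_forall fun x => ?_)
    rw [kernelOp_congr k (Lp.coeFn_smul c f)]
    simp only [kernelOp, Pi.smul_apply, smul_eq_mul, mul_assoc]
    exact integral_const_mul _ _

section

variable {α : Type*} [MeasurableSpace α] {m : Measure α}

theorem inner_toLp_toLp {f g : α → ℝ} (hf : MemLp f 2 m) (hg : MemLp g 2 m) :
    inner ℝ (hf.toLp f) (hg.toLp g) = ∫ x, f x * g x ∂m := by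
  rw [L2.inner_def]
  refine integral_congr_ae ?_
  filter_upwards [hf.coeFn_toLp, hg.coeFn_toLp] with x h1 h2
  rw [h1, h2, RCLike.inner_apply, conj_trivial, mul_comm]

theorem norm_toLp_sq {f : α → ℝ} (hf : MemLp f 2 m) :
    ‖hf.toLp f‖ ^ 2 = ∫ x, f x ^ 2 ∂m := by
  rw [← real_inner_self_eq_norm_sq, inner_toLp_toLp]
  simp_rw [sq]

theorem exists_memLp_eq_toLp (f : Lp ℝ 2 m) : ∃ (u : α → ℝ) (hu : MemLp u 2 m), f = hu.toLp u :=
  ⟨f, Lp.memLp f, (Lp.toLp_coeFn f _).symm⟩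

theorem IsHeatDensity.measurable_mix {k : ℝ≥0 → α → α → ℝ≥0∞} (h : IsHeatDensity m k)
    (ρ : Measure ℝ≥0) [SFinite ρ] :
    Measurable fun z : α × α => ∫⁻ s, k s z.1 z.2 ∂ρ := by
  refine Measurable.lintegral_prod_left (f := fun s (z : α × α) => k s z.1 z.2) ?_
  exact h.measurable

variable [SigmaFinite m]

theorem IsSubMarkovDensity.toLinearMap_toLp {k : α → α → ℝ≥0∞} (h : IsSubMarkovDensity m k)
    {f : α → ℝ} (hf : MemLp f 2 m) :
    h.toLinearMap (hf.toLp f) = (h.memLp_kernelOp hf).toLp _ := by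
  refine MemLp.toLp_congr (h.memLp_kernelOp (Lp.memLp _)) (h.memLp_kernelOp hf)
    (Eventually.of_forall fun x => ?_)
  rw [kernelOp_congr k hf.coeFn_toLp]

namespace IsHeatDensity

variable {k : ℝ≥0 → α → α → ℝ≥0∞}

/-- The semigroup on `L²` of a heat density. -/
noncomputable def semigroup (h : IsHeatDensity m k) : SymmContractionSemigroup (Lp ℝ 2 m) where
  -- The density carries no information at $t=0$, so the identity is prescribed there.
  S t := if ht : 0 < t then (h.density t ht).toLinearMap else LinearMap.id
  zero u := by simp
  add s t u := by
    rcases eq_or_lt_of_le (zero_le (a := s)) with rfl | hs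
    · simp
    rcases eq_or_lt_of_le (zero_le (a := t)) with rfl | ht
    · simp
    obtain ⟨f, hf, rfl⟩ := exists_memLp_eq_toLp u
    rw [dif_pos hs, dif_pos ht, dif_pos (add_pos hs ht), IsSubMarkovDensity.toLinearMap_toLp,
      IsSubMarkovDensity.toLinearMap_toLp, IsSubMarkovDensity.toLinearMap_toLp]
    refine MemLp.toLp_congr _ _ (Eventually.of_forall fun x => ?_)
    rw [IsSubMarkovDensity.kernelOp_kernelOp (h.density s hs) (h.density t ht)
      (h.density _ (add_pos hs ht)) (h.chapman_kolmogorov s t hs ht) hf]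
  symm t u v := by
    rcases eq_or_lt_of_le (zero_le (a := t)) with rfl | ht
    · simp
    obtain ⟨f, hf, rfl⟩ := exists_memLp_eq_toLp u
    obtain ⟨g, hg, rfl⟩ := exists_memLp_eq_toLp v
    rw [dif_pos ht, IsSubMarkovDensity.toLinearMap_toLp, IsSubMarkovDensity.toLinearMap_toLp,
      inner_toLp_toLp, inner_toLp_toLp]
    simp_rw [fun x => mul_comm (kernelOp m (k t) f x) (g x)]
    exact (h.density t ht).integral_kernelOp_mul hf hg
  contr t u := by
    rcases eq_or_lt_of_le (zero_le (a := t)) with rfl | ht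
    · simp
    obtain ⟨f, hf, rfl⟩ := exists_memLp_eq_toLp u
    rw [dif_pos ht, IsSubMarkovDensity.toLinearMap_toLp, Lp.norm_toLp, Lp.norm_toLp]
    exact ENNReal.toReal_mono hf.2.ne ((h.density t ht).eLpNorm_kernelOp_le hf)

theorem semigroup_toLp (h : IsHeatDensity m k) {t : ℝ≥0} (ht : 0 < t) {f : α → ℝ}
    (hf : MemLp f 2 m) :
    h.semigroup.S t (hf.toLp f) = ((h.density t ht).memLp_kernelOp hf).toLp _ := by
  simp only [semigroup, dif_pos ht]
  exact IsSubMarkovDensity.toLinearMap_toLp _ hf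

theorem form_toLp (h : IsHeatDensity m k) {t : ℝ≥0} (ht : 0 < t) {u : α → ℝ}
    (hu : MemLp u 2 m) :
    h.semigroup.form (hu.toLp u) t =
      ∫ x, u x ^ 2 ∂m - ∫ x, u x * kernelOp m (k t) u x ∂m := by
  rw [SymmContractionSemigroup.form_eq, h.semigroup_toLp ht, inner_toLp_toLp, norm_toLp_sq]
  simp_rw [fun x => mul_comm (kernelOp m (k t) u x) (u x)]

/-- The quadratic form of a mixture of heat densities is the mixture of the approximating
forms. -/
theorem lintegral_sq_sub_mul_mix (h : IsHeatDensity m k) (ρ : Measure ℝ≥0) [SFinite ρ]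
    (hρ : ρ {0} = 0) {u : α → ℝ} (hu : MemLp u 2 m) :
    ∫⁻ z : α × α, ENNReal.ofReal ((u z.1 - u z.2) ^ 2) * ∫⁻ s, k s z.1 z.2 ∂ρ ∂(m.prod m) =
      2 * ∫⁻ s, ENNReal.ofReal (h.semigroup.form (hu.toLp u) s) ∂ρ := by
  have hum : AEMeasurable (fun z : α × α => ENNReal.ofReal ((u z.1 - u z.2) ^ 2)) (m.prod m) :=
    ((hu.1.comp_fst.sub hu.1.comp_snd).aemeasurable.pow_const 2).ennreal_ofReal
  have hmk : ∀ z : α × α, Measurable fun s => k s z.1 z.2 := fun z =>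
    h.measurable.comp (measurable_id.prodMk measurable_const)
  have e1 : ∀ z : α × α, ENNReal.ofReal ((u z.1 - u z.2) ^ 2) * ∫⁻ s, k s z.1 z.2 ∂ρ =
      ∫⁻ s, ENNReal.ofReal ((u z.1 - u z.2) ^ 2) * k s z.1 z.2 ∂ρ := fun z =>
    (lintegral_const_mul _ (hmk z)).symm
  simp_rw [e1]
  rw [lintegral_lintegral_swap, ← lintegral_const_mul]
  · refine lintegral_congr_ae ?_
    have : ∀ᵐ s ∂ρ, s ≠ 0 := by
      rw [ae_iff]; simpa using hρ
    filter_upwards [this] with s hs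
    have hs' : 0 < s := pos_iff_ne_zero.2 hs
    rw [(h.density s hs').lintegral_sq_sub_mul (h.mass s hs') hu, h.form_toLp hs',
      ENNReal.ofReal_mul (by norm_num)]
    simp
  · exact (h.semigroup.form_mono _).measurable.ennreal_ofReal
  · refine AEMeasurable.mul hum.comp_fst ?_
    exact (h.measurable.comp (measurable_snd.prodMk measurable_fst)).aemeasurable

end IsHeatDensity

end

/-! ### The scale function -/

section Scale

variable {γ β₁ β₂ : ℝ}

theorem scale_pos {r : ℝ} (hr : 0 < r) : 0 < scale γ β₁ β₂ r := by
  unfold scale; split_ifs <;> positivity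

theorem scaleInv_pos {r : ℝ} (hr : 0 < r) : 0 < scaleInv γ β₁ β₂ r := by
  unfold scaleInv; split_ifs <;> positivity

/-- With its companion for the inverse, this reduces all scale estimates to $\gamma=1$, the
space-time scaling of the original diffusion. -/
theorem scale_eq_rpow {r : ℝ} (hr : 0 ≤ r) : scale γ β₁ β₂ r = scale 1 β₁ β₂ r ^ γ := by
  unfold scale
  split_ifs <;> rw [← Real.rpow_mul hr] <;> ring_nf

/-- The time $t^{1/\gamma}$ is the typical size of $\tau_t$. -/
theorem scaleInv_eq {t : ℝ} (hγ : 0 < γ) (ht : 0 ≤ t) :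
    scaleInv γ β₁ β₂ t = scaleInv 1 β₁ β₂ (t ^ (1 / γ)) := by
  have h : t ^ (1 / γ) < 1 ↔ t < 1 :=
    ⟨fun h => lt_of_not_ge fun h' => h.not_ge (Real.one_le_rpow h' (by positivity)),
      fun h => Real.rpow_lt_one ht h (by positivity)⟩
  unfold scaleInv
  simp only [h]
  split_ifs <;> rw [← Real.rpow_mul ht] <;> congr 1 <;> field_simp

theorem scaleInv_mono {t t' : ℝ} (h1 : 0 < β₁) (h2 : 0 < β₂) (ht : 0 ≤ t) (htt : t ≤ t') :
    scaleInv 1 β₁ β₂ t ≤ scaleInv 1 β₁ β₂ t' := by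
  unfold scaleInv
  simp only [one_mul]
  split_ifs with ha hb hb
  · gcongr
  · exact (Real.rpow_le_one ht ha.le (by positivity)).trans
      (Real.one_le_rpow (not_lt.1 hb) (by positivity))
  · exact absurd (htt.trans_lt hb) ha
  · gcongr

/-- Both exponents $1/\beta_i$ are at most $1$. In the crossing case $R<1\le KR$ one passes through
the linear function: $(KR)^{1/\beta_2}\le KR\le KR^{1/\beta_1}$. -/
theorem scaleInv_mul_le {K R : ℝ} (h1 : 1 ≤ β₁) (h2 : 1 ≤ β₂) (hK : 1 ≤ K) (hR : 0 < R) :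
    scaleInv 1 β₁ β₂ (K * R) ≤ K * scaleInv 1 β₁ β₂ R := by
  have hK0 : 0 < K := by linarith
  have e1 : 1 / β₁ ≤ 1 := by rw [div_le_one (by linarith)]; exact h1
  have e2 : 1 / β₂ ≤ 1 := by rw [div_le_one (by linarith)]; exact h2
  have hle : R ≤ K * R := le_mul_of_one_le_left hR.le hK
  have hKe : ∀ e : ℝ, e ≤ 1 → K ^ e ≤ K := fun e he => by
    simpa using Real.rpow_le_rpow_of_exponent_le hK he
  unfold scaleInv
  simp only [one_mul]
  split_ifs with ha hb hb
  · rw [Real.mul_rpow hK0.le hR.le]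
    gcongr; exact hKe _ e1
  · exact absurd (hle.trans_lt ha) hb
  · calc (K * R) ^ (1 / β₂) ≤ (K * R) ^ (1 : ℝ) :=
          Real.rpow_le_rpow_of_exponent_le (not_lt.1 ha) e2
      _ = K * R ^ (1 : ℝ) := by rw [Real.rpow_one, Real.rpow_one]
      _ ≤ K * R ^ (1 / β₁) := by
        gcongr 1
        exact Real.rpow_le_rpow_of_exponent_ge hR hb.le e1
  · rw [Real.mul_rpow hK0.le hR.le]
    gcongr; exact hKe _ e2

end Scale

/-! ### Volumes of balls -/

section Volume

variable {M : Type*} [MetricSpace M] [MeasurableSpace M] {m : Measure M}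

theorem VolumeGrowth.vol_pos [m.IsOpenPosMeasure] (hV : VolumeGrowth m) (x : M) {r : ℝ}
    (hr : 0 < r) : 0 < vol m x r :=
  ENNReal.toReal_pos (Metric.measure_ball_pos m x hr).ne' (hV.1 x r hr).ne

theorem VolumeGrowth.vol_mono (hV : VolumeGrowth m) (x : M) {r R : ℝ} (hR : 0 < R)
    (hrR : r ≤ R) : vol m x r ≤ vol m x R :=
  measureReal_mono (Metric.ball_subset_ball hrR) (hV.1 x R hR).ne

theorem VolumeGrowth.doubling [m.IsOpenPosMeasure] (hV : VolumeGrowth m) :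
    ∃ A D : ℝ, 0 < A ∧ 0 < D ∧ ∀ (x : M) (r R : ℝ), 0 < r → r ≤ R →
      vol m x R ≤ A * (R / r) ^ D * vol m x r := by
  obtain ⟨c₁, A, d₁, D, -, -, hA, hd, hdD, h⟩ := hV.2
  refine ⟨A, D, by linarith, by linarith, fun x r R hr hrR => ?_⟩
  rcases hrR.eq_or_lt with rfl | hlt
  · rw [div_self hr.ne', Real.one_rpow, mul_one]
    exact le_mul_of_one_le_left (hV.vol_pos x hr).le hA
  · exact (div_le_iff₀ (hV.vol_pos x hr)).1 (h x r R hr hlt).2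

end Volume

/-! ### Pointwise consequences of the sub-Gaussian bounds -/

theorem exists_rpow_mul_exp_neg_le {k C α : ℝ} (hC : 0 < C) (hα : 0 < α) :
    ∃ K : ℝ, 0 < K ∧ ∀ z : ℝ, 1 ≤ z → z ^ k * Real.exp (-(C * z ^ α)) ≤ K := by
  obtain ⟨n, hn⟩ := exists_nat_ge (k / α)
  refine ⟨n.factorial / C ^ n, by positivity, fun z hz => ?_⟩
  have hz0 : 0 < z := by linarith
  have h1 : z ^ k ≤ (z ^ α) ^ n := by
    rw [← Real.rpow_natCast, ← Real.rpow_mul hz0.le]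
    refine Real.rpow_le_rpow_of_exponent_le hz ?_
    rwa [div_le_iff₀' hα] at hn
  have h2 := Real.pow_div_factorial_le_exp (C * z ^ α) (by positivity) n
  rw [Real.exp_neg, ← div_eq_mul_inv, div_le_iff₀ (Real.exp_pos _)]
  calc z ^ k ≤ (z ^ α) ^ n := h1
    _ = n.factorial / C ^ n * ((C * z ^ α) ^ n / n.factorial) := by
      rw [mul_pow]; field_simp
    _ ≤ _ := by gcongr

section Bounds

variable {M : Type*} [MetricSpace M] [MeasurableSpace M] {m : Measure M} [m.IsOpenPosMeasure]

theorem subGaussian_le (hV : VolumeGrowth m) {β c C : ℝ} (hc : 0 < c) (hC : 0 < C)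
    {t : ℝ} (ht : 0 < t) (x y : M) :
    subGaussian m β c C t x y ≤ c / vol m x (t ^ (1 / β)) := by
  unfold subGaussian
  have := hV.vol_pos x (r := t ^ (1 / β)) (by positivity)
  refine mul_le_of_le_one_right (by positivity) (Real.exp_le_one_iff.2 ?_)
  rw [Left.neg_nonpos_iff]; positivity

theorem le_subGaussian (hV : VolumeGrowth m) {β c C : ℝ} (hβ : 1 < β) (hc : 0 < c) (hC : 0 < C)
    {t : ℝ} (ht : 0 < t) {x y : M} (hd : dist x y ^ β ≤ t) :
    c * Real.exp (-C) / vol m x (t ^ (1 / β)) ≤ subGaussian m β c C t x y := by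
  unfold subGaussian
  have := hV.vol_pos x (r := t ^ (1 / β)) (by positivity)
  rw [mul_div_right_comm]
  gcongr
  refine mul_le_of_le_one_right hC.le (Real.rpow_le_one (by positivity) ?_ ?_)
  · rwa [div_le_one ht]
  · rw [one_div, inv_nonneg]; linarith

/-- Put $z=d^\beta/t\ge1$. Replacing $V(x,t^{1/\beta})$ by $V(x,d)$ costs a factor $z^{D/\beta}$ by
doubling, and the stretched exponential in $z$ absorbs this together with $z^k$. -/
theorem exists_subGaussian_le_rpow (hV : VolumeGrowth m) {β c C : ℝ} (hβ : 1 < β) (hc : 0 < c)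
    (hC : 0 < C) (k : ℝ) :
    ∃ K : ℝ, 0 < K ∧ ∀ (t : ℝ) (x y : M), 0 < t → x ≠ y → t ≤ dist x y ^ β →
      subGaussian m β c C t x y ≤ K / vol m x (dist x y) * (t / dist x y ^ β) ^ k := by
  obtain ⟨A, D, hA, hD, hdbl⟩ := hV.doubling
  have hα : 0 < 1 / (β - 1) := by rw [one_div, inv_pos]; linarith
  obtain ⟨K, hK, hdec⟩ := exists_rpow_mul_exp_neg_le (k := k + D / β) hC hα
  refine ⟨c * A * K, by positivity, fun t x y ht hxy htd => ?_⟩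
  have hd : 0 < dist x y := dist_pos.2 hxy
  set d := dist x y with hdd
  have hz : 1 ≤ d ^ β / t := by rwa [one_le_div ht]
  have hz0 : 0 < d ^ β / t := by positivity
  have hr : 0 < t ^ (1 / β) := by positivity
  have hrd : t ^ (1 / β) ≤ d := by
    calc t ^ (1 / β) ≤ (d ^ β) ^ (1 / β) := by gcongr
      _ = d := by rw [← Real.rpow_mul hd.le, mul_one_div_cancel (by linarith), Real.rpow_one]
  have hv1 := hV.vol_pos x hr
  have hv2 := hV.vol_pos x hd
  have hvol := hdbl x _ _ hr hrd
  have hratio : (d / t ^ (1 / β)) ^ D = (d ^ β / t) ^ (D / β) := by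
    have : d / t ^ (1 / β) = (d ^ β / t) ^ (1 / β) := by
      rw [Real.div_rpow (by positivity) ht.le, ← Real.rpow_mul hd.le,
        mul_one_div_cancel (by linarith), Real.rpow_one]
    rw [this, ← Real.rpow_mul hz0.le]
    congr 1; ring
  rw [hratio] at hvol
  have h1 : c / vol m x (t ^ (1 / β)) ≤ c * (A * (d ^ β / t) ^ (D / β)) / vol m x d := by
    rw [div_le_div_iff₀ hv1 hv2]
    calc c * vol m x d ≤ c * (A * (d ^ β / t) ^ (D / β) * vol m x (t ^ (1 / β))) := by gcongr
      _ = _ := by ring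
  have hinv : (t / d ^ β) ^ k = (d ^ β / t) ^ (-k) := by
    rw [Real.rpow_neg hz0.le, ← Real.inv_rpow hz0.le, inv_div]
  unfold subGaussian
  rw [hinv]
  calc _ ≤ c * (A * (d ^ β / t) ^ (D / β)) / vol m x d *
        Real.exp (-(C * (d ^ β / t) ^ (1 / (β - 1)))) := by gcongr
    _ = c * A / vol m x d * ((d ^ β / t) ^ (-k) * ((d ^ β / t) ^ (k + D / β) *
        Real.exp (-(C * (d ^ β / t) ^ (1 / (β - 1)))))) := by
      rw [Real.rpow_add hz0, Real.rpow_neg hz0.le]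
      field_simp
    _ ≤ c * A / vol m x d * ((d ^ β / t) ^ (-k) * K) := by
      gcongr; exact hdec _ hz
    _ = _ := by ring

theorem exists_subGaussian_le_min (hV : VolumeGrowth m) {β c C : ℝ} (hβ : 1 < β) (hc : 0 < c)
    (hC : 0 < C) :
    ∃ K : ℝ, 0 < K ∧ ∀ (t : ℝ) (x y : M), 0 < t → x ≠ y →
      subGaussian m β c C t x y ≤ K / vol m x (dist x y) * min 1 (t / dist x y ^ β) := by
  obtain ⟨K, hK, h⟩ := exists_subGaussian_le_rpow hV hβ hc hC 1
  refine ⟨max c K, by positivity, fun t x y ht hxy => ?_⟩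
  have hd : 0 < dist x y := dist_pos.2 hxy
  have hv := hV.vol_pos x hd
  have hdβ : 0 < dist x y ^ β := by positivity
  rcases le_total t (dist x y ^ β) with htd | htd
  · refine (h t x y ht hxy htd).trans ?_
    rw [Real.rpow_one, min_eq_right (by rwa [div_le_one hdβ])]
    gcongr
    exact le_max_right _ _
  · refine (subGaussian_le hV hc hC ht x y).trans ?_
    rw [min_eq_left (by rwa [one_le_div hdβ]), mul_one]
    have hdt : dist x y ≤ t ^ (1 / β) := by
      calc dist x y = (dist x y ^ β) ^ (1 / β) := by
            rw [← Real.rpow_mul hd.le, mul_one_div_cancel (by linarith), Real.rpow_one]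
        _ ≤ _ := by gcongr
    have := hV.vol_mono x (by positivity) hdt
    gcongr
    exact le_max_left _ _

variable {N : Set M} {p : ℝ≥0 → M → M → ℝ≥0} {β₁ β₂ : ℝ}

/-- This merges the two time regimes into one bound with the scale $\Phi$. The delicate region is
$t\le d$, $d\ge1$, where the kernel obeys the $\beta_1$ estimate but the target is $t/d^{\beta_2}$.
-/
theorem SubGaussianBounds.exists_le_min (hV : VolumeGrowth m) (hβ₁ : 2 ≤ β₁) (hβ₂ : 2 ≤ β₂)
    (h : SubGaussianBounds m N p β₁ β₂) :
    ∃ K : ℝ, 0 < K ∧ ∀ (t : ℝ≥0) (x y : M), 0 < t → x ∉ N → y ∉ N → x ≠ y →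
      (p t x y : ℝ) ≤ K / vol m x (dist x y) * min 1 (t / scale 1 β₁ β₂ (dist x y)) := by
  obtain ⟨c₁, c₂, c₃, c₄, C₁, C₂, C₃, C₄, hc₁, hc₂, hc₃, hc₄, hC₁, hC₂, hC₃, hC₄, hb⟩ := h
  obtain ⟨K₁, hK₁, h₁⟩ := exists_subGaussian_le_min hV (β := β₁) (by linarith) hc₂ hC₂
  obtain ⟨K₂, hK₂, h₂⟩ := exists_subGaussian_le_min hV (β := β₂) (by linarith) hc₄ hC₄
  -- Decay of order $\beta_2$ is extracted because $\beta_1\ge2$ yields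
  -- $(t/d^{\beta_1})^{\beta_2}\le(t/d)^{\beta_2}d^{-\beta_2}\le t\,d^{-\beta_2}$ in that region.
  obtain ⟨K₃, hK₃, h₃⟩ := exists_subGaussian_le_rpow hV (β := β₁) (by linarith) hc₂ hC₂ β₂
  refine ⟨K₁ + K₂ + K₃, by positivity, fun t x y ht hx hy hxy => ?_⟩
  have ht' : (0 : ℝ) < t := by exact_mod_cast ht
  have hd : 0 < dist x y := dist_pos.2 hxy
  have hv := hV.vol_pos x hd
  obtain ⟨hb1, hb2⟩ := hb t x y ht hx hy
  have hmono : ∀ {K w : ℝ}, K ≤ K₁ + K₂ + K₃ → 0 ≤ w →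
      K / vol m x (dist x y) * w ≤ (K₁ + K₂ + K₃) / vol m x (dist x y) * w := by
    intro K w hK hw
    gcongr
  have hs := scale_pos (γ := 1) (β₁ := β₁) (β₂ := β₂) hd
  by_cases hd1 : dist x y < 1
  · have hsc : scale 1 β₁ β₂ (dist x y) = dist x y ^ β₁ := by
      unfold scale; rw [if_pos hd1, one_mul]
    rw [max_eq_left hd1.le] at hb1 hb2
    rcases le_total (t : ℝ) 1 with ht1 | ht1
    · refine (hb1 ht1).2.trans ((h₁ t x y ht' hxy).trans ?_)
      rw [hsc]
      exact hmono (by linarith) (by positivity)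
    · refine (hb2 ht1).2.trans ((h₂ t x y ht' hxy).trans ?_)
      refine le_trans ?_ (hmono (K := K₂) (by linarith) (by positivity))
      gcongr _ * ?_
      have : min 1 ((t : ℝ) / scale 1 β₁ β₂ (dist x y)) = 1 := by
        refine min_eq_left ?_
        rw [one_le_div hs, hsc]
        exact (Real.rpow_le_one hd.le hd1.le (by linarith)).trans ht1
      rw [this]
      exact min_le_left _ _
  · have hd1' := not_lt.1 hd1
    have hsc : scale 1 β₁ β₂ (dist x y) = dist x y ^ β₂ := by
      unfold scale; rw [if_neg hd1, one_mul]
    rw [max_eq_right hd1'] at hb1 hb2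
    rcases le_total (t : ℝ) (dist x y) with htd | htd
    · have hdβ1 : dist x y ≤ dist x y ^ β₁ := by
        simpa using Real.rpow_le_rpow_of_exponent_le hd1' (show (1 : ℝ) ≤ β₁ by linarith)
      have hdβ2 : dist x y ≤ dist x y ^ β₂ := by
        simpa using Real.rpow_le_rpow_of_exponent_le hd1' (show (1 : ℝ) ≤ β₂ by linarith)
      refine (hb1 htd).2.trans ((h₃ t x y ht' hxy (htd.trans hdβ1)).trans ?_)
      refine le_trans ?_ (hmono (K := K₃) (by linarith) (by positivity))
      gcongr _ * ?_
      rw [hsc, min_eq_right (by rw [div_le_one (by positivity)]; exact htd.trans hdβ2)]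
      have e1 : (t : ℝ) / dist x y ^ β₁ ≤ t / dist x y / dist x y := by
        rw [div_div]
        gcongr
        rw [← sq, ← Real.rpow_two]
        exact Real.rpow_le_rpow_of_exponent_le hd1' hβ₁
      have htd1 : (t : ℝ) / dist x y ≤ 1 := by rwa [div_le_one hd]
      calc ((t : ℝ) / dist x y ^ β₁) ^ β₂ ≤ (t / dist x y / dist x y) ^ β₂ := by gcongr
        _ = (t / dist x y) ^ β₂ / dist x y ^ β₂ := Real.div_rpow (by positivity) hd.le _
        _ ≤ t / dist x y ^ β₂ := by
          gcongr
          calc ((t : ℝ) / dist x y) ^ β₂ ≤ (t / dist x y) ^ (1 : ℝ) :=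
                Real.rpow_le_rpow_of_exponent_ge (by positivity) htd1 (by linarith)
            _ = t / dist x y := Real.rpow_one _
            _ ≤ t := div_le_self ht'.le hd1'
    · refine (hb2 htd).2.trans ((h₂ t x y ht' hxy).trans ?_)
      rw [hsc]
      exact hmono (by linarith) (by positivity)

/-- Only $1\le t<d$ needs an argument, since the estimate available there is the $\beta_1$ one. The
off-diagonal bound gives $K/V(x,d)$, and $t^{1/\beta_2}\le t<d$. -/
theorem SubGaussianBounds.exists_le_inv_vol (hV : VolumeGrowth m) (hβ₁ : 2 ≤ β₁) (hβ₂ : 2 ≤ β₂)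
    (h : SubGaussianBounds m N p β₁ β₂) :
    ∃ K : ℝ, 0 < K ∧ ∀ (t : ℝ≥0) (x y : M), 0 < t → x ∉ N → y ∉ N →
      (p t x y : ℝ) ≤ K / vol m x (scaleInv 1 β₁ β₂ t) := by
  obtain ⟨K, hK, hmin⟩ := h.exists_le_min hV hβ₁ hβ₂
  obtain ⟨c₁, c₂, c₃, c₄, C₁, C₂, C₃, C₄, hc₁, hc₂, hc₃, hc₄, hC₁, hC₂, hC₃, hC₄, hb⟩ := h
  refine ⟨c₂ + c₄ + K, by positivity, fun t x y ht hx hy => ?_⟩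
  have ht' : (0 : ℝ) < t := by exact_mod_cast ht
  obtain ⟨hb1, hb2⟩ := hb t x y ht hx hy
  have hv := hV.vol_pos x (scaleInv_pos (γ := 1) (β₁ := β₁) (β₂ := β₂) ht')
  have hmono : ∀ {K' : ℝ}, K' ≤ c₂ + c₄ + K → K' / vol m x (scaleInv 1 β₁ β₂ t) ≤
      (c₂ + c₄ + K) / vol m x (scaleInv 1 β₁ β₂ t) := by
    intro K' hK'
    gcongr
  by_cases ht1 : (t : ℝ) < 1
  · have hsc : scaleInv 1 β₁ β₂ t = (t : ℝ) ^ (1 / β₁) := by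
      unfold scaleInv; rw [if_pos ht1, one_mul]
    refine (hb1 (ht1.le.trans (le_max_left _ _))).2.trans ((subGaussian_le hV hc₂ hC₂ ht' x y).trans
      ?_)
    rw [← hsc]
    exact hmono (by linarith)
  · have ht1' := not_lt.1 ht1
    have hsc : scaleInv 1 β₁ β₂ t = (t : ℝ) ^ (1 / β₂) := by
      unfold scaleInv; rw [if_neg ht1, one_mul]
    rcases le_or_gt (dist x y) t with htd | htd
    · refine (hb2 (max_le ht1' htd)).2.trans ((subGaussian_le hV hc₄ hC₄ ht' x y).trans ?_)
      rw [← hsc]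
      exact hmono (by linarith)
    · have hd : 0 < dist x y := ht'.trans htd
      refine (hmin t x y ht hx hy (dist_pos.1 hd)).trans ?_
      refine le_trans ?_ (hmono (K' := K) (by linarith))
      have hvd := hV.vol_pos x hd
      refine (mul_le_of_le_one_right (by positivity) (min_le_left _ _)).trans ?_
      have : scaleInv 1 β₁ β₂ t ≤ dist x y := by
        rw [hsc]
        refine le_trans ?_ htd.le
        have : 1 / β₂ ≤ 1 := by rw [div_le_one (by linarith)]; linarith
        simpa using Real.rpow_le_rpow_of_exponent_le ht1' this
      have := hV.vol_mono x hd this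
      gcongr

/-- The condition $\Phi(d)\le t$ keeps the exponential factor bounded below. It also matches the
regimes: for $t\ge1$ it implies $d\le t$, and for $t<1$ it forces $d<1$. -/
theorem SubGaussianBounds.exists_inv_vol_le (hV : VolumeGrowth m) (hβ₁ : 2 ≤ β₁) (hβ₂ : 2 ≤ β₂)
    (h : SubGaussianBounds m N p β₁ β₂) :
    ∃ c : ℝ, 0 < c ∧ ∀ (t : ℝ≥0) (x y : M), 0 < t → x ∉ N → y ∉ N →
      scale 1 β₁ β₂ (dist x y) ≤ t → c / vol m x (scaleInv 1 β₁ β₂ t) ≤ p t x y := by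
  obtain ⟨c₁, c₂, c₃, c₄, C₁, C₂, C₃, C₄, hc₁, hc₂, hc₃, hc₄, hC₁, hC₂, hC₃, hC₄, hb⟩ := h
  refine ⟨min (c₁ * Real.exp (-C₁)) (c₃ * Real.exp (-C₃)), by positivity,
    fun t x y ht hx hy hdt => ?_⟩
  have ht' : (0 : ℝ) < t := by exact_mod_cast ht
  obtain ⟨hb1, hb2⟩ := hb t x y ht hx hy
  have hv := hV.vol_pos x (scaleInv_pos (γ := 1) (β₁ := β₁) (β₂ := β₂) ht')
  have hd0 : 0 ≤ dist x y := dist_nonneg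
  unfold scale at hdt
  rw [one_mul, one_mul] at hdt
  by_cases ht1 : (t : ℝ) < 1
  · have hsc : scaleInv 1 β₁ β₂ t = (t : ℝ) ^ (1 / β₁) := by
      unfold scaleInv; rw [if_pos ht1, one_mul]
    have hdβ : dist x y ^ β₁ ≤ t := by
      split_ifs at hdt with hd1
      · exact hdt
      · have := Real.one_le_rpow (not_lt.1 hd1) (show 0 ≤ β₂ by linarith)
        linarith
    refine le_trans ?_ ((le_subGaussian hV (by linarith) hc₁ hC₁ ht' hdβ).trans
      (hb1 (ht1.le.trans (le_max_left _ _))).1)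
    rw [← hsc]
    gcongr
    exact min_le_left _ _
  · have ht1' := not_lt.1 ht1
    have hsc : scaleInv 1 β₁ β₂ t = (t : ℝ) ^ (1 / β₂) := by
      unfold scaleInv; rw [if_neg ht1, one_mul]
    have hdd : dist x y ^ β₂ ≤ t ∧ dist x y ≤ t := by
      split_ifs at hdt with hd1
      · exact ⟨(Real.rpow_le_one hd0 hd1.le (by linarith)).trans ht1', hd1.le.trans ht1'⟩
      · refine ⟨hdt, le_trans ?_ hdt⟩
        simpa using Real.rpow_le_rpow_of_exponent_le (not_lt.1 hd1) (show (1 : ℝ) ≤ β₂ by linarith)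
    refine le_trans ?_ ((le_subGaussian hV (by linarith) hc₃ hC₃ ht' hdd.1).trans
      (hb2 (max_le ht1' hdd.2)).1)
    rw [← hsc]
    gcongr
    exact min_le_right _ _

end Bounds

/-! ### Bounds for mixtures of the heat kernel -/

section Mixture

variable {M : Type*} [MetricSpace M] [MeasurableSpace M] {m : Measure M} [m.IsOpenPosMeasure]
  {N : Set M} {p : ℝ≥0 → M → M → ℝ≥0} {γ β₁ β₂ : ℝ}

/-- The off-diagonal bound is integrated with truncation level $R=\Phi(d)$, for which
$R^{-\gamma}=1/\phi(d)$. -/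
theorem SubGaussianBounds.exists_lintegral_le_jump (hV : VolumeGrowth m) (hβ₁ : 2 ≤ β₁)
    (hβ₂ : 2 ≤ β₂) (h : SubGaussianBounds m N p β₁ β₂) (γ : ℝ) :
    ∃ C : ℝ, 0 < C ∧ ∀ (t : ℝ) (ρ : Measure ℝ≥0), ρ {0} = 0 →
      (∀ l : ℝ, 0 < l → ∫⁻ s : ℝ≥0, ENNReal.ofReal (1 - Real.exp (-(l * s))) ∂ρ ≤
        ENNReal.ofReal (t * l ^ γ)) →
      ∀ x y : M, x ∉ N → y ∉ N → x ≠ y → ∫⁻ s, (p s x y : ℝ≥0∞) ∂ρ ≤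
        ENNReal.ofReal (C * (t / (vol m x (dist x y) * scale γ β₁ β₂ (dist x y)))) := by
  obtain ⟨K, hK, hb⟩ := h.exists_le_min hV hβ₁ hβ₂
  refine ⟨2 * K, by positivity, fun t ρ hρ hU x y hx hy hxy => ?_⟩
  have hd : 0 < dist x y := dist_pos.2 hxy
  have hs := scale_pos (γ := 1) (β₁ := β₁) (β₂ := β₂) hd
  have hv := hV.vol_pos x hd
  have h0 : ∀ᵐ s ∂ρ, s ≠ 0 := by rw [ae_iff]; simpa using hρ
  calc _ ≤ ∫⁻ s : ℝ≥0, ENNReal.ofReal (K / vol m x (dist x y)) *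
        ENNReal.ofReal (min 1 (s / scale 1 β₁ β₂ (dist x y))) ∂ρ := by
        refine lintegral_mono_ae ?_
        filter_upwards [h0] with s hs0
        rw [← ENNReal.ofReal_mul (by positivity), ← ENNReal.ofReal_coe_nnreal]
        exact ENNReal.ofReal_le_ofReal (hb s x y (pos_iff_ne_zero.2 hs0) hx hy hxy)
    _ ≤ ENNReal.ofReal (K / vol m x (dist x y)) *
        ENNReal.ofReal (2 * (t * scale 1 β₁ β₂ (dist x y) ^ (-γ))) := by
        rw [lintegral_const_mul _ (by fun_prop)]
        gcongr
        exact lintegral_min_one_le hs hU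
    _ = _ := by
        rw [← ENNReal.ofReal_mul (by positivity), scale_eq_rpow (γ := γ) hd.le,
          Real.rpow_neg hs.le]
        congr 1
        field_simp

/-- With $T=t^{1/\gamma}$, doubling gives $V(x,\Phi^{-1}(T))\le A(T/s)^D\,V(x,\Phi^{-1}(s))$ for
$s\le T$. The contribution of small $s$ is thus a negative moment of order $D$ of the stable law,
bounded uniformly in $t$. -/
theorem SubGaussianBounds.exists_lintegral_le_diag (hV : VolumeGrowth m) (hβ₁ : 2 ≤ β₁)
    (hβ₂ : 2 ≤ β₂) (h : SubGaussianBounds m N p β₁ β₂) (h0 : 0 < γ) :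
    ∃ C : ℝ, 0 < C ∧ ∀ (t : ℝ≥0) (ρ : Measure ℝ≥0), 0 < t → IsStableLaw γ t ρ →
      ∀ x y : M, x ∉ N → y ∉ N → ∫⁻ s, (p s x y : ℝ≥0∞) ∂ρ ≤
        ENNReal.ofReal (C * (1 / vol m x (scaleInv γ β₁ β₂ t))) := by
  obtain ⟨K, hK, hb⟩ := h.exists_le_inv_vol hV hβ₁ hβ₂
  obtain ⟨A, D, hA, hD, hdbl⟩ := hV.doubling
  obtain ⟨C, hC, hmom⟩ := exists_lintegral_rpow_neg_le h0 hD
  refine ⟨K * (1 + A * C), by positivity, fun t ρ ht hρ x y hx hy => ?_⟩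
  have := hρ.isProbabilityMeasure
  have ht' : (0 : ℝ) < t := by exact_mod_cast ht
  set T : ℝ := (t : ℝ) ^ (1 / γ) with hT
  have hT0 : 0 < T := by positivity
  rw [scaleInv_eq h0 ht'.le, ← hT]
  set r := scaleInv 1 β₁ β₂ T with hr
  have hr0 : 0 < r := scaleInv_pos hT0
  have hv := hV.vol_pos x hr0
  have hz : ∀ᵐ s ∂ρ, s ≠ 0 := by rw [ae_iff]; simpa using hρ.measure_zero h0 ht
  have hpt : ∀ s : ℝ≥0, 0 < s → (p s x y : ℝ) ≤
      K * (1 / vol m x r) * (1 + A * (T / s) ^ D) := by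
    intro s hs
    have hs' : (0 : ℝ) < s := by exact_mod_cast hs
    have hsi : 0 < scaleInv 1 β₁ β₂ s := scaleInv_pos hs'
    have hvs := hV.vol_pos x hsi
    refine (hb s x y hs hx hy).trans ?_
    have hnn : 0 ≤ A * (T / s) ^ D := by positivity
    rw [mul_one_div, div_mul_eq_mul_div, div_le_div_iff₀ hvs hv, mul_assoc]
    gcongr
    rcases le_total T s with hTs | hTs
    · calc vol m x r ≤ vol m x (scaleInv 1 β₁ β₂ s) :=
            hV.vol_mono x hsi (scaleInv_mono (by linarith) (by linarith) hT0.le hTs)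
        _ ≤ _ := le_mul_of_one_le_left hvs.le (by linarith)
    · have hratio : r / scaleInv 1 β₁ β₂ s ≤ T / s := by
        rw [div_le_iff₀ hsi]
        have := scaleInv_mul_le (β₁ := β₁) (β₂ := β₂) (K := T / s) (R := s) (by linarith)
          (by linarith) (by rwa [one_le_div hs']) hs'
        rwa [div_mul_cancel₀ _ hs'.ne'] at this
      calc vol m x r ≤ A * (r / scaleInv 1 β₁ β₂ s) ^ D * vol m x (scaleInv 1 β₁ β₂ s) :=
            hdbl x _ _ hsi (scaleInv_mono (by linarith) (by linarith) hs'.le hTs)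
        _ ≤ A * (T / s) ^ D * vol m x (scaleInv 1 β₁ β₂ s) := by gcongr
        _ ≤ _ := by gcongr; linarith
  calc _ ≤ ∫⁻ s : ℝ≥0, ENNReal.ofReal (K * (1 / vol m x r)) *
        (1 + ENNReal.ofReal A * ENNReal.ofReal ((T / s) ^ D)) ∂ρ := by
        refine lintegral_mono_ae ?_
        filter_upwards [hz] with s hs0
        rw [← ENNReal.ofReal_mul hA.le, ← ENNReal.ofReal_one,
          ← ENNReal.ofReal_add zero_le_one (by positivity),
          ← ENNReal.ofReal_mul (by positivity), ← ENNReal.ofReal_coe_nnreal]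
        exact ENNReal.ofReal_le_ofReal (hpt s (pos_iff_ne_zero.2 hs0))
    _ ≤ ENNReal.ofReal (K * (1 / vol m x r)) * (1 + ENNReal.ofReal A * ENNReal.ofReal C) := by
        rw [lintegral_const_mul _ (by fun_prop), lintegral_add_left measurable_const,
          lintegral_const_mul _ (by fun_prop), lintegral_const, measure_univ, mul_one]
        gcongr
        exact hmom t ρ ht hρ
    _ = _ := by
        rw [← ENNReal.ofReal_mul hA.le, ← ENNReal.ofReal_one,
          ← ENNReal.ofReal_add zero_le_one (by positivity),
          ← ENNReal.ofReal_mul (by positivity)]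
        congr 1
        ring

/-- Only times in the window $[R,KR]$ are kept. There the near-diagonal lower bound holds and, by
doubling, its volume is comparable to $V(x,\Phi^{-1}(R))$. -/
theorem SubGaussianBounds.exists_le_lintegral (hV : VolumeGrowth m) (hβ₁ : 2 ≤ β₁)
    (hβ₂ : 2 ≤ β₂) (h : SubGaussianBounds m N p β₁ β₂) (h0 : 0 < γ) (h1 : γ < 1) :
    ∃ c : ℝ, 0 < c ∧ ∀ (t R : ℝ) (ρ : Measure ℝ≥0), 0 ≤ t → 0 < R →
      (∀ l : ℝ, 0 < l → ∫⁻ s : ℝ≥0, ENNReal.ofReal (1 - Real.exp (-(l * s))) ∂ρ ≤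
        ENNReal.ofReal (t * l ^ γ)) →
      (∀ l : ℝ, 0 < l → l ≤ 1 / R → ENNReal.ofReal (t * l ^ γ / 2) ≤
        ∫⁻ s : ℝ≥0, ENNReal.ofReal (1 - Real.exp (-(l * s))) ∂ρ) →
      ∀ x y : M, x ∉ N → y ∉ N → scale 1 β₁ β₂ (dist x y) ≤ R →
      ENNReal.ofReal (c * (t * R ^ (-γ) / vol m x (scaleInv 1 β₁ β₂ R))) ≤
        ∫⁻ s, (p s x y : ℝ≥0∞) ∂ρ := by
  obtain ⟨c, hc, hb⟩ := h.exists_inv_vol_le hV hβ₁ hβ₂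
  obtain ⟨A, D, hA, hD, hdbl⟩ := hV.doubling
  obtain ⟨K, w, hK, hw, hwin⟩ := exists_window h0 h1
  have hK0 : 0 < K := by linarith
  refine ⟨c / (A * K ^ D) * w, by positivity, fun t R ρ ht hR hU hL x y hx hy hdR => ?_⟩
  have hr0 : 0 < scaleInv 1 β₁ β₂ R := scaleInv_pos hR
  have hv := hV.vol_pos x hr0
  set W : Set ℝ≥0 := {s : ℝ≥0 | R ≤ s ∧ s ≤ K * R} with hWdef
  have hWm : MeasurableSet W :=
    (measurableSet_le measurable_const measurable_coe_nnreal_real).inter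
      (measurableSet_le measurable_coe_nnreal_real measurable_const)
  have hpt : ∀ s ∈ W, ENNReal.ofReal (c / (A * K ^ D * vol m x (scaleInv 1 β₁ β₂ R))) ≤
      (p s x y : ℝ≥0∞) := by
    rintro s ⟨hs1, hs2⟩
    have hs0 : (0 : ℝ) < s := hR.trans_le hs1
    have hsi : 0 < scaleInv 1 β₁ β₂ s := scaleInv_pos hs0
    have hvs := hV.vol_pos x hsi
    rw [← ENNReal.ofReal_coe_nnreal]
    refine ENNReal.ofReal_le_ofReal (le_trans ?_
      (hb s x y (by exact_mod_cast hs0) hx hy (hdR.trans hs1)))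
    gcongr
    have hle : scaleInv 1 β₁ β₂ s ≤ K * scaleInv 1 β₁ β₂ R :=
      (scaleInv_mono (by linarith) (by linarith) hs0.le hs2).trans
        (scaleInv_mul_le (by linarith) (by linarith) hK hR)
    calc vol m x (scaleInv 1 β₁ β₂ s) ≤ vol m x (K * scaleInv 1 β₁ β₂ R) :=
          hV.vol_mono x (by positivity) hle
      _ ≤ A * (K * scaleInv 1 β₁ β₂ R / scaleInv 1 β₁ β₂ R) ^ D *
          vol m x (scaleInv 1 β₁ β₂ R) := hdbl x _ _ hr0 (le_mul_of_one_le_left hr0.le hK)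
      _ = _ := by rw [mul_div_cancel_right₀ _ hr0.ne']
  calc _ = ENNReal.ofReal (c / (A * K ^ D * vol m x (scaleInv 1 β₁ β₂ R))) *
        ENNReal.ofReal (w * (t * R ^ (-γ))) := by
        rw [← ENNReal.ofReal_mul (by positivity)]
        congr 1
        field_simp
    _ ≤ ENNReal.ofReal (c / (A * K ^ D * vol m x (scaleInv 1 β₁ β₂ R))) * ρ W := by
        gcongr
        exact hwin t R ρ ht hR hU hL
    _ = ∫⁻ _ in W, ENNReal.ofReal (c / (A * K ^ D * vol m x (scaleInv 1 β₁ β₂ R))) ∂ρ := by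
        rw [setLIntegral_const]
    _ ≤ ∫⁻ s in W, (p s x y : ℝ≥0∞) ∂ρ := by
        refine lintegral_mono_ae ?_
        filter_upwards [self_mem_ae_restrict hWm] with s hs using hpt s hs
    _ ≤ _ := setLIntegral_le_lintegral _ _

theorem scaleInv_one_scale {β₁ β₂ r : ℝ} (hβ₁ : 2 ≤ β₁) (hβ₂ : 2 ≤ β₂) (hr : 0 ≤ r) :
    scaleInv 1 β₁ β₂ (scale 1 β₁ β₂ r) = r :=
  scaleInv_scale zero_lt_one (by linarith) (by linarith) hr

/-- Two-sided bounds for the mixture of the heat kernel by the Lévy measure. -/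
theorem SubGaussianBounds.exists_jump_bounds (hV : VolumeGrowth m) (hβ₁ : 2 ≤ β₁)
    (hβ₂ : 2 ≤ β₂) (h : SubGaussianBounds m N p β₁ β₂) (h0 : 0 < γ) (h1 : γ < 1) :
    ∃ a b : ℝ, 0 < a ∧ 0 < b ∧ ∀ x y : M, x ∉ N → y ∉ N → x ≠ y →
      ENNReal.ofReal (a * stableJump m γ β₁ β₂ x y) ≤
        ∫⁻ s, (p s x y : ℝ≥0∞) ∂stableLevyMeasure γ ∧
      ∫⁻ s, (p s x y : ℝ≥0∞) ∂stableLevyMeasure γ ≤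
        ENNReal.ofReal (b * stableJump m γ β₁ β₂ x y) := by
  obtain ⟨b, hb, hB⟩ := h.exists_lintegral_le_jump hV hβ₁ hβ₂ γ
  obtain ⟨a, ha, hA⟩ := h.exists_le_lintegral hV hβ₁ hβ₂ h0 h1
  have hlap : ∀ l : ℝ, 0 < l → ∫⁻ s : ℝ≥0, ENNReal.ofReal (1 - Real.exp (-(l * s)))
      ∂stableLevyMeasure γ = ENNReal.ofReal (1 * l ^ γ) := fun l hl => by
    rw [lintegral_one_sub_exp_stableLevyMeasure h0 h1 hl.le, one_mul]
  refine ⟨a, b, ha, hb, fun x y hx hy hxy => ⟨?_, ?_⟩⟩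
  · have hd : 0 < dist x y := dist_pos.2 hxy
    have hs := scale_pos (γ := 1) (β₁ := β₁) (β₂ := β₂) hd
    have := hA 1 _ (stableLevyMeasure γ) zero_le_one hs (fun l hl => (hlap l hl).le)
      (fun l hl _ => by
        rw [hlap l hl]
        refine ENNReal.ofReal_le_ofReal (half_le_self (by positivity))) x y hx hy le_rfl
    refine le_of_eq_of_le ?_ this
    rw [scaleInv_one_scale hβ₁ hβ₂ hd.le, stableJump, scale_eq_rpow (γ := γ) hd.le,
      Real.rpow_neg hs.le]
    congr 1
    field_simp
  · exact hB 1 _ (stableLevyMeasure_zero γ) (fun l hl => (hlap l hl).le) x y hx hy hxy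

/-- Two-sided bounds for the mixture of the heat kernel by stable laws. -/
theorem SubGaussianBounds.exists_stableHeat_bounds (hV : VolumeGrowth m) (hβ₁ : 2 ≤ β₁)
    (hβ₂ : 2 ≤ β₂) (h : SubGaussianBounds m N p β₁ β₂) (h0 : 0 < γ) (h1 : γ < 1) :
    ∃ a b : ℝ, 0 < a ∧ 0 < b ∧ ∀ (t : ℝ≥0) (ρ : Measure ℝ≥0), 0 < t → IsStableLaw γ t ρ →
      ∀ x y : M, x ∉ N → y ∉ N →
      ENNReal.ofReal a * stableHeat m γ β₁ β₂ t x y ≤ ∫⁻ s, (p s x y : ℝ≥0∞) ∂ρ ∧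
      ∫⁻ s, (p s x y : ℝ≥0∞) ∂ρ ≤ ENNReal.ofReal b * stableHeat m γ β₁ β₂ t x y := by
  obtain ⟨b₁, hb₁, hB₁⟩ := h.exists_lintegral_le_jump hV hβ₁ hβ₂ γ
  obtain ⟨b₂, hb₂, hB₂⟩ := h.exists_lintegral_le_diag hV hβ₁ hβ₂ h0
  obtain ⟨a, ha, hA⟩ := h.exists_le_lintegral hV hβ₁ hβ₂ h0 h1
  refine ⟨a, b₁ + b₂, ha, by positivity, fun t ρ ht hρ x y hx hy => ?_⟩
  have ht' : (0 : ℝ) < t := by exact_mod_cast ht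
  have hU : ∀ l : ℝ, 0 < l → ∫⁻ s : ℝ≥0, ENNReal.ofReal (1 - Real.exp (-(l * s))) ∂ρ ≤
      ENNReal.ofReal (t * l ^ γ) := fun l hl => hρ.lintegral_one_sub_exp_le hl
  set T : ℝ := (t : ℝ) ^ (1 / γ) with hT
  have hT0 : 0 < T := by positivity
  have hTγ : T ^ γ = t := by
    rw [hT, ← Real.rpow_mul ht'.le, one_div_mul_cancel h0.ne', Real.rpow_one]
  have hsI : scaleInv γ β₁ β₂ t = scaleInv 1 β₁ β₂ T := scaleInv_eq h0 ht'.le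
  -- For $R\ge T=t^{1/\gamma}$ and $l\le1/R$ one has $tl^\gamma\le1$, the range where $1-e^{-x}\ge
  -- x/2$ applies.
  have hL : ∀ R : ℝ, T ≤ R → ∀ l : ℝ, 0 < l → l ≤ 1 / R → ENNReal.ofReal (t * l ^ γ / 2) ≤
      ∫⁻ s : ℝ≥0, ENNReal.ofReal (1 - Real.exp (-(l * s))) ∂ρ := by
    intro R hR l hl hlR
    refine hρ.le_lintegral_one_sub_exp hl ?_
    rw [← hTγ, ← Real.mul_rpow hT0.le hl.le]
    refine Real.rpow_le_one (by positivity) ?_ h0.le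
    calc T * l ≤ R * (1 / R) := by gcongr; exact hT0.le.trans hR
      _ = 1 := mul_one_div_cancel (hT0.trans_le hR).ne'
  have hjump : ∀ hxy : x ≠ y, ENNReal.ofReal t /
      ENNReal.ofReal (vol m x (dist x y) * scale γ β₁ β₂ (dist x y)) =
      ENNReal.ofReal (t / (vol m x (dist x y) * scale γ β₁ β₂ (dist x y))) := fun hxy => by
    have hd : 0 < dist x y := dist_pos.2 hxy
    rw [ENNReal.ofReal_div_of_pos (mul_pos (hV.vol_pos x hd) (scale_pos hd))]
  constructor
  -- The window starts at $R=\max(T,\Phi(d))$. For $R=T$ the factor $tR^{-\gamma}$ is $1$ and the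
  -- first term of the minimum appears; for $R=\Phi(d)$ it is $t/\phi(d)$, giving the second.
  · rcases le_total (scale 1 β₁ β₂ (dist x y)) T with hdT | hdT
    · refine le_trans ?_ (hA t T ρ ht'.le hT0 hU (hL T le_rfl) x y hx hy hdT)
      rw [ENNReal.ofReal_mul ha.le]
      gcongr
      refine (min_le_left _ _).trans_eq ?_
      rw [hsI, Real.rpow_neg hT0.le, hTγ, mul_inv_cancel₀ ht'.ne']
    · have hs : 0 < scale 1 β₁ β₂ (dist x y) := hT0.trans_le hdT
      have hxy : x ≠ y := by
        rintro rfl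
        rw [dist_self] at hs
        unfold scale at hs
        rw [if_pos one_pos, one_mul, Real.zero_rpow (by linarith)] at hs
        exact lt_irrefl _ hs
      have hd : 0 < dist x y := dist_pos.2 hxy
      refine le_trans ?_ (hA t _ ρ ht'.le hs hU (hL _ hdT) x y hx hy le_rfl)
      rw [ENNReal.ofReal_mul ha.le]
      gcongr
      refine (min_le_right _ _).trans_eq ?_
      rw [hjump hxy, scaleInv_one_scale hβ₁ hβ₂ hd.le, scale_eq_rpow (γ := γ) hd.le,
        Real.rpow_neg hs.le]
      congr 1
      field_simp
  · rw [stableHeat, mul_min]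
    refine le_min ?_ ?_
    · refine (hB₂ t ρ ht hρ x y hx hy).trans ?_
      rw [ENNReal.ofReal_mul hb₂.le]
      gcongr; linarith
    · by_cases hxy : x = y
      · subst hxy
        have : ENNReal.ofReal t / ENNReal.ofReal (vol m x (dist x x) *
            scale γ β₁ β₂ (dist x x)) = ∞ := by
          have : vol m x (dist x x) = 0 := by simp [vol]
          rw [this, zero_mul, ENNReal.ofReal_zero, ENNReal.div_zero]
          exact (ENNReal.ofReal_pos.2 ht').ne'
        rw [this, ENNReal.mul_top (ENNReal.ofReal_pos.2 (by positivity)).ne']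
        exact le_top
      · refine (hB₁ t ρ (hρ.measure_zero h0 ht) hU x y hx hy hxy).trans ?_
        rw [ENNReal.ofReal_mul hb₁.le, hjump hxy]
        gcongr; linarith

end Mixture

/-! ### The one-point compactification and right-continuous paths -/

/-- Complements of the sets of a compact exhaustion form a countable neighbourhood base at infinity.
The resulting metrizability allows measurable limits of path evaluations. -/
theorem OnePoint.secondCountableTopology (X : Type*) [TopologicalSpace X]
    [SecondCountableTopology X] [LocallyCompactSpace X] [T2Space X] :
    SecondCountableTopology (OnePoint X) := by
  let K : CompactExhaustion X := default
  let B := TopologicalSpace.countableBasis X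
  let S : Set (Set (OnePoint X)) :=
    (fun b => ((↑) : X → OnePoint X) '' b) '' B ∪
      range fun n => (((↑) : X → OnePoint X) '' K n)ᶜ
  have hS : TopologicalSpace.IsTopologicalBasis S := by
    refine TopologicalSpace.isTopologicalBasis_of_isOpen_of_nhds ?_ ?_
    · rintro u (⟨b, hb, rfl⟩ | ⟨n, rfl⟩)
      · exact OnePoint.isOpenEmbedding_coe.isOpenMap _
          (TopologicalSpace.isOpen_of_mem_countableBasis hb)
      · exact OnePoint.isOpen_compl_image_coe.2 ⟨(K.isCompact n).isClosed, K.isCompact n⟩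
    · intro a u ha hu
      induction a using OnePoint.rec with
      | infty =>
        have hc := ((OnePoint.isOpen_iff_of_mem ha).1 hu).2
        obtain ⟨n, hn⟩ := K.exists_superset_of_isCompact hc
        refine ⟨_, Or.inr ⟨n, rfl⟩, by simp, fun z hz => ?_⟩
        induction z using OnePoint.rec with
        | infty => exact ha
        | coe z =>
          by_contra hzu
          exact hz ⟨z, hn hzu, rfl⟩
      | coe x =>
        have hu' : IsOpen (((↑) : X → OnePoint X) ⁻¹' u) := hu.preimage OnePoint.continuous_coe
        obtain ⟨b, hb, hxb, hbu⟩ :=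
          (TopologicalSpace.isBasis_countableBasis X).exists_subset_of_mem_open ha hu'
        exact ⟨_, Or.inl ⟨b, hb, rfl⟩, ⟨x, hxb, rfl⟩, image_subset_iff.2 hbu⟩
  exact hS.secondCountableTopology
    (((TopologicalSpace.countable_countableBasis X).image _).union (countable_range _))

theorem OnePoint.metrizableSpace (X : Type*) [TopologicalSpace X]
    [SecondCountableTopology X] [LocallyCompactSpace X] [T2Space X] :
    TopologicalSpace.MetrizableSpace (OnePoint X) := by
  have := OnePoint.secondCountableTopology X
  exact TopologicalSpace.metrizableSpace_of_t3_secondCountable _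

/-- Right-continuous paths, with the σ-algebra of the coordinates. -/
abbrev RightContPath (E : Type*) [TopologicalSpace E] : Type _ :=
  {f : ℝ≥0 → E // ∀ t, ContinuousWithinAt f (Ici t) t}

/-- Right continuity lets the time be replaced by grid points decreasing to it from the right; each
approximation uses only countably many coordinates. -/
theorem RightContPath.measurable_eval (E : Type*) [TopologicalSpace E] [MeasurableSpace E]
    [BorelSpace E] [TopologicalSpace.PseudoMetrizableSpace E] :
    Measurable fun z : ℝ≥0 × RightContPath E => z.2.1 z.1 := by
  set a : ℕ → ℝ≥0 → ℝ≥0 := fun n s => (⌊((n : ℝ≥0) + 1) * s⌋₊ + 1) / ((n : ℝ≥0) + 1) with ha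
  have hn0 : ∀ n : ℕ, (0 : ℝ≥0) < (n : ℝ≥0) + 1 := fun n => by positivity
  have hlow : ∀ n s, s ≤ a n s := fun n s => by
    simp only [ha]
    rw [le_div_iff₀ (hn0 n), mul_comm]
    exact (Nat.lt_floor_add_one _).le
  have hupp : ∀ n s, a n s ≤ s + 1 / ((n : ℝ≥0) + 1) := fun n s => by
    simp only [ha]
    rw [add_div]
    gcongr
    rw [div_le_iff₀ (hn0 n), mul_comm]
    exact Nat.floor_le (by positivity)
  have hlim : ∀ s, Tendsto (fun n => a n s) atTop (𝓝[≥] s) := fun s => by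
    refine tendsto_nhdsWithin_iff.2 ⟨?_, Eventually.of_forall fun n => hlow n s⟩
    refine tendsto_of_tendsto_of_tendsto_of_le_of_le tendsto_const_nhds ?_
      (fun n => hlow n s) (fun n => hupp n s)
    have : Tendsto (fun n : ℕ => s + 1 / ((n : ℝ≥0) + 1)) atTop (𝓝 (s + 0)) :=
      tendsto_const_nhds.add tendsto_one_div_add_atTop_nhds_zero_nat
    rwa [add_zero] at this
  refine measurable_of_tendsto_metrizable (f := fun n (z : ℝ≥0 × RightContPath E) =>
    z.2.1 (a n z.1)) (fun n => ?_) ?_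
  · have h1 : Measurable fun z : ℕ × RightContPath E =>
        z.2.1 (((z.1 : ℝ≥0) + 1) / ((n : ℝ≥0) + 1)) :=
      measurable_from_prod_countable_right fun k =>
        (measurable_pi_apply (((k : ℝ≥0) + 1) / ((n : ℝ≥0) + 1))).comp measurable_subtype_coe
    have h2 : Measurable fun z : ℝ≥0 × RightContPath E => (⌊((n : ℝ≥0) + 1) * z.1⌋₊, z.2) :=
      (Nat.measurable_floor.comp (measurable_fst.const_mul _)).prodMk measurable_snd
    exact h1.comp h2
  · refine tendsto_pi_nhds.2 fun z => ?_
    exact (z.2.2 z.1).tendsto.comp (hlim z.1)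

/-! ### Laws of subordinators -/

theorem IsSubordinator.ae_le {Ω : Type*} [MeasurableSpace Ω] {τ : ℝ≥0 → Ω → ℝ≥0}
    {μ : Measure Ω} (h : IsSubordinator τ μ) {s t : ℝ≥0} (hst : s ≤ t) :
    ∀ᵐ ω ∂μ, τ s ω ≤ τ t ω := by
  filter_upwards [h.monotone] with ω hω using hω hst

theorem IsStableSubordinator.isStableLaw {Ω : Type*} [MeasurableSpace Ω] {γ : ℝ}
    {τ : ℝ≥0 → Ω → ℝ≥0} {μ : Measure Ω} [IsProbabilityMeasure μ]
    (h : IsStableSubordinator γ τ μ) {t : ℝ≥0} (ht : 0 < t) :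
    IsStableLaw γ t (μ.map (τ t)) where
  isProbabilityMeasure := Measure.isProbabilityMeasure_map (h.1.measurable t).aemeasurable
  laplace l hl := by
    rw [integral_map (h.1.measurable t).aemeasurable (by fun_prop)]
    exact h.2 t l ht hl

/-- The increment after time $s$ is independent of $\tau_s$ and distributed as $\tau_t$. Increments
are real-valued, and `Real.toNNReal` recovers them without loss because paths increase almost
surely. -/
theorem IsSubordinator.lintegral_map_add {Ω : Type*} [MeasurableSpace Ω] {τ : ℝ≥0 → Ω → ℝ≥0}
    {μ : Measure Ω} [IsProbabilityMeasure μ] (h : IsSubordinator τ μ) (s t : ℝ≥0)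
    {f : ℝ≥0 → ℝ≥0∞} (hf : Measurable f) :
    ∫⁻ r, f r ∂μ.map (τ (s + t)) = ∫⁻ a, ∫⁻ b, f (a + b) ∂μ.map (τ t) ∂μ.map (τ s) := by
  have hm : ∀ t, Measurable fun ω => (τ t ω : ℝ) := fun t => (h.measurable t).coe_nnreal_real
  set V : Ω → ℝ := fun ω => (τ (s + t) ω : ℝ) - τ s ω with hV
  have hVm : Measurable V := (hm _).sub (hm _)
  have hz : ∀ᵐ ω ∂μ, (fun t ω => (τ t ω : ℝ)) 0 ω = 0 := by
    filter_upwards [h.zero] with ω hω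
    simp [hω]
  have hind : IndepFun (fun ω => (τ s ω : ℝ)) V μ :=
    h.indep_increments.indepFun_eval_sub (zero_le (a := s)) le_self_add hz
  have hind' : IndepFun (τ s) V μ := by
    have := hind.comp measurable_real_toNNReal measurable_id
    simpa [Function.comp_def] using this
  have hprod := hind'.map_prod_eq_prod_map_map (h.measurable s).aemeasurable hVm.aemeasurable
  have hVlaw : μ.map V = μ.map (fun ω => (τ t ω : ℝ)) := (h.stationary_increments s t).map_eq
  have hg : Measurable fun z : ℝ≥0 × ℝ => f (z.1 + z.2.toNNReal) :=
    hf.comp (measurable_fst.add (measurable_real_toNNReal.comp measurable_snd))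
  have : IsProbabilityMeasure (μ.map V) := Measure.isProbabilityMeasure_map hVm.aemeasurable
  calc _ = ∫⁻ ω, f (τ (s + t) ω) ∂μ := lintegral_map hf (h.measurable _)
    _ = ∫⁻ ω, f (τ s ω + (V ω).toNNReal) ∂μ := by
      refine lintegral_congr_ae ?_
      filter_upwards [h.ae_le (s := s) (t := s + t) le_self_add] with ω hω
      congr 1
      simp only [hV]
      rw [← NNReal.coe_sub hω, Real.toNNReal_coe, add_tsub_cancel_of_le hω]
    _ = ∫⁻ z, f (z.1 + z.2.toNNReal) ∂((μ.map (τ s)).prod (μ.map V)) := by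
      rw [← hprod, lintegral_map hg ((h.measurable s).prodMk hVm)]
    _ = ∫⁻ a, ∫⁻ b, f (a + b.toNNReal) ∂μ.map V ∂μ.map (τ s) :=
      lintegral_prod _ hg.aemeasurable
    _ = _ := by
      refine lintegral_congr fun a => ?_
      have hfa : Measurable fun b : ℝ≥0 => f (a + b) := hf.comp (measurable_const.add measurable_id)
      have e := lintegral_map (μ := μ) (hfa.comp measurable_real_toNNReal) (hm t)
      simp only [Function.comp_apply] at e
      rw [hVlaw, e, lintegral_map hfa (h.measurable t)]
      simp

/-- For increasing paths $t\mapsto P(\tau_t\le a)$ is nonincreasing, hence measurable, and the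
half-lines form a generating π-system. -/
theorem IsSubordinator.measurable_map {Ω : Type*} [MeasurableSpace Ω] {τ : ℝ≥0 → Ω → ℝ≥0}
    {μ : Measure Ω} [IsProbabilityMeasure μ] (h : IsSubordinator τ μ) :
    Measurable fun t => μ.map (τ t) := by
  have : ∀ t, IsProbabilityMeasure (μ.map (τ t)) := fun t =>
    Measure.isProbabilityMeasure_map (h.measurable t).aemeasurable
  refine .measure_of_isPiSystem_of_isProbabilityMeasure
    (BorelSpace.measurable_eq.trans (borel_eq_generateFrom_Iic ℝ≥0)) isPiSystem_Iic ?_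
  rintro _ ⟨a, rfl⟩
  refine Antitone.measurable fun s t hst => ?_
  rw [Measure.map_apply (h.measurable t) measurableSet_Iic,
    Measure.map_apply (h.measurable s) measurableSet_Iic]
  refine measure_mono_ae ?_
  filter_upwards [h.ae_le hst] with ω hω hωt
  exact hω.trans hωt

/-! ### The subordinated process -/

section Subordination

theorem OnePoint.measurable_eval_path {M : Type*} [MetricSpace M] [LocallyCompactSpace M]
    [TopologicalSpace.SeparableSpace M] :
    Measurable fun z : ℝ≥0 × RightContPath (OnePoint M) => z.2.1 z.1 := by
  have := UniformSpace.secondCountable_of_separable M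
  have := OnePoint.metrizableSpace M
  exact RightContPath.measurable_eval _

variable {M : Type*} [MetricSpace M] [MeasurableSpace M] {Ω : Type*} [MeasurableSpace Ω]
  (H : HuntProcess M Ω)

theorem HuntProcess.measurable_X (t : ℝ≥0) : Measurable (H.X t) :=
  (H.adapted t).mono (H.filt.le t) le_rfl

/-- The path of the process as a right-continuous path. -/
def HuntProcess.path (ω : Ω) : RightContPath (OnePoint M) :=
  ⟨fun t => H.X t ω, H.right_continuous ω⟩

theorem HuntProcess.measurable_path : Measurable H.path :=
  (measurable_pi_lambda _ H.measurable_X).subtype_mk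

variable [LocallyCompactSpace M]

/-- A properly exceptional set of the process is properly exceptional for the subordinated
process. -/
theorem isProperlyExceptional_subordinate {H : HuntProcess M Ω} {m : Measure M} {N : Set M}
    (h : IsProperlyExceptional m H.X H.P N) {γ : ℝ} {τ : ℝ≥0 → Ω → ℝ≥0}
    (hτ : ∀ x : M, IsStableSubordinator γ τ (H.P (x : OnePoint M))) :
    IsProperlyExceptional m (subordinate H.X τ) H.P N := by
  refine ⟨h.1, h.2.1, fun x hx => ?_⟩
  filter_upwards [h.2.2 x hx, H.normal x, (hτ x).1.monotone] with ω hω h0 hmono t ht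
  -- Time $0$ is included because $\tau_t$ may vanish; there $X_0=x\notin N$.
  have hX : ∀ s, H.X s ω ∉ ((↑) : M → OnePoint M) '' N := by
    intro s
    rcases eq_or_lt_of_le (zero_le (a := s)) with rfl | hs
    · rw [h0]
      rintro ⟨y, hy, hyx⟩
      exact hx (OnePoint.coe_injective hyx ▸ hy)
    · exact (hω s hs).1
  refine ⟨hX _, fun z hz => ?_⟩
  have hne : (𝓝[<] t).NeBot := nhdsLT_neBot_of_exists_lt ⟨0, ht⟩
  -- This is the left limit $\tau_{t-}$. If it is attained before $t$, the clock is constant just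
  -- before $t$ and the left limit of $Y$ is the value $X_\sigma$. Otherwise the clock approaches
  -- $\sigma$ strictly from below and the left limit is $X_{\sigma-}$.
  set σ : ℝ≥0 := ⨆ s : Iio t, τ s ω with hσ
  have hbdd : BddAbove (range fun s : Iio t => τ s ω) :=
    ⟨τ t ω, by rintro _ ⟨s, rfl⟩; exact hmono (le_of_lt s.2)⟩
  have : Nonempty (Iio t) := ⟨⟨0, ht⟩⟩
  have hle : ∀ s, s < t → τ s ω ≤ σ := fun s hs => le_ciSup hbdd ⟨s, hs⟩
  by_cases hatt : ∃ s, s < t ∧ τ s ω = σ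
  · obtain ⟨s, hs, hsσ⟩ := hatt
    have hev : ∀ᶠ r in 𝓝[<] t, subordinate H.X τ r ω = H.X σ ω := by
      have : ∀ᶠ r in 𝓝[<] t, s < r := nhdsWithin_le_nhds (lt_mem_nhds hs)
      filter_upwards [this, self_mem_nhdsWithin] with r hr hrt
      have : τ r ω = σ := le_antisymm (hle r hrt) (hsσ ▸ hmono hr.le)
      simp only [subordinate, this]
    have : z = H.X σ ω := tendsto_nhds_unique (hz.congr' hev) tendsto_const_nhds
    rw [this]
    exact hX σ
  · push Not at hatt
    have hlt : ∀ s, s < t → τ s ω < σ := fun s hs => lt_of_le_of_ne (hle s hs) (hatt s hs)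
    have hσ0 : 0 < σ := lt_of_le_of_lt zero_le (hlt 0 ht)
    have htend : Tendsto (fun s => τ s ω) (𝓝[<] t) (𝓝[<] σ) := by
      refine tendsto_nhdsWithin_iff.2 ⟨tendsto_order.2 ⟨fun c hc => ?_, fun c hc => ?_⟩, ?_⟩
      · obtain ⟨s, hs⟩ := exists_lt_of_lt_ciSup hc
        have : ∀ᶠ r in 𝓝[<] t, (s : ℝ≥0) < r := nhdsWithin_le_nhds (lt_mem_nhds s.2)
        filter_upwards [this] with r hr
        exact hs.trans_le (hmono hr.le)
      · filter_upwards [self_mem_nhdsWithin] with r hr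
        exact (hlt r hr).trans hc
      · filter_upwards [self_mem_nhdsWithin] with r hr using hlt r hr
    obtain ⟨z', hz'⟩ := H.left_limits ω σ hσ0
    have : z = z' := tendsto_nhds_unique hz (hz'.comp htend)
    rw [this]
    exact (hω σ hσ0).2 z' hz'

variable [TopologicalSpace.SeparableSpace M]

theorem HuntProcess.measurable_uncurry : Measurable fun z : ℝ≥0 × Ω => H.X z.1 z.2 :=
  OnePoint.measurable_eval_path.comp (measurable_fst.prodMk (H.measurable_path.comp measurable_snd))

theorem HuntProcess.measurable_subordinate {τ : ℝ≥0 → Ω → ℝ≥0} {t : ℝ≥0}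
    (hτ : Measurable (τ t)) : Measurable (subordinate H.X τ t) :=
  H.measurable_uncurry.comp (hτ.prodMk measurable_id)

/-- Fubini for the independent pair formed by the clock value and the whole path, using joint
measurability of evaluation. -/
theorem HuntProcess.lintegral_subordinate {τ : ℝ≥0 → Ω → ℝ≥0} {x : OnePoint M} {t : ℝ≥0}
    (hτ : Measurable (τ t))
    (hindep : IndepFun (fun ω (t : ℝ≥0) => H.X t ω) (fun ω (t : ℝ≥0) => τ t ω) (H.P x))
    {f : OnePoint M → ℝ≥0∞} (hf : Measurable f) :
    ∫⁻ ω, f (subordinate H.X τ t ω) ∂H.P x =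
      ∫⁻ s, ∫⁻ ω, f (H.X s ω) ∂H.P x ∂(H.P x).map (τ t) := by
  have := H.isProbabilityMeasure x
  have hind : IndepFun H.path (τ t) (H.P x) := by
    have h1 : IndepFun (fun ω (t : ℝ≥0) => H.X t ω) (τ t) (H.P x) :=
      hindep.comp measurable_id (measurable_pi_apply t)
    rw [IndepFun_iff_Indep] at h1 ⊢
    convert! h1 using 1
    -- Passing to the subtype of right-continuous paths does not change the generated σ-algebra, so
    -- independence carries over.
    rw [show (fun ω (t : ℝ≥0) => H.X t ω) = Subtype.val ∘ H.path from rfl,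
      ← MeasurableSpace.comap_comp]
    rfl
  have hprod := hind.symm.map_prod_eq_prod_map_map hτ.aemeasurable H.measurable_path.aemeasurable
  have hg : Measurable fun z : ℝ≥0 × RightContPath (OnePoint M) => f (z.2.1 z.1) :=
    hf.comp OnePoint.measurable_eval_path
  have : IsProbabilityMeasure ((H.P x).map H.path) :=
    Measure.isProbabilityMeasure_map H.measurable_path.aemeasurable
  have : IsProbabilityMeasure ((H.P x).map (τ t)) :=
    Measure.isProbabilityMeasure_map hτ.aemeasurable
  calc _ = ∫⁻ z, f (z.2.1 z.1) ∂(H.P x).map (fun ω => (τ t ω, H.path ω)) := by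
        rw [lintegral_map hg (hτ.prodMk H.measurable_path)]; rfl
    _ = ∫⁻ s, ∫⁻ w, f (w.1 s) ∂(H.P x).map H.path ∂(H.P x).map (τ t) := by
        rw [hprod]; exact lintegral_prod _ hg.aemeasurable
    _ = _ := by
        refine lintegral_congr fun s => ?_
        exact lintegral_map (μ := H.P x) (f := fun w : RightContPath (OnePoint M) => f (w.1 s))
          (hg.comp measurable_prodMk_left) H.measurable_path

end Subordination

/-! ### Heat kernels as heat densities -/

open Classical in
/-- The heat kernel, extended by zero to the exceptional set and to time `0`. -/
noncomputable def extendHeat {M : Type*} (N : Set M) (p : ℝ≥0 → M → M → ℝ≥0) (t : ℝ≥0)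
    (x y : M) : ℝ≥0∞ :=
  if 0 < t ∧ x ∉ N ∧ y ∉ N then (p t x y : ℝ≥0∞) else 0

section ExtendHeat

variable {M : Type*} {N : Set M} {p : ℝ≥0 → M → M → ℝ≥0}

theorem extendHeat_of_notMem {t : ℝ≥0} {x y : M} (ht : 0 < t) (hx : x ∉ N) (hy : y ∉ N) :
    extendHeat N p t x y = p t x y := if_pos ⟨ht, hx, hy⟩

theorem extendHeat_of_mem_left {t : ℝ≥0} {x y : M} (hx : x ∈ N) : extendHeat N p t x y = 0 :=
  if_neg fun h => h.2.1 hx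

theorem extendHeat_of_mem_right {t : ℝ≥0} {x y : M} (hy : y ∈ N) : extendHeat N p t x y = 0 :=
  if_neg fun h => h.2.2 hy

theorem extendHeat_lt_top (t : ℝ≥0) (x y : M) : extendHeat N p t x y < ∞ := by
  unfold extendHeat; split_ifs <;> simp

theorem lintegral_extendHeat_eq {ρ : Measure ℝ≥0} (hρ : ρ {0} = 0) {x y : M} (hx : x ∉ N)
    (hy : y ∉ N) : ∫⁻ s, extendHeat N p s x y ∂ρ = ∫⁻ s, (p s x y : ℝ≥0∞) ∂ρ := by
  have : ∀ᵐ s ∂ρ, s ≠ 0 := by rw [ae_iff]; simpa using hρ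
  refine lintegral_congr_ae ?_
  filter_upwards [this] with s hs
  exact extendHeat_of_notMem (pos_iff_ne_zero.2 hs) hx hy

end ExtendHeat

section HeatKernel

variable {M : Type*} [MetricSpace M] [MeasurableSpace M] {Ω : Type*} [MeasurableSpace Ω]
  {m : Measure M} {X : ℝ≥0 → Ω → OnePoint M} {P : OnePoint M → Measure Ω} {N : Set M}
  {p : ℝ≥0 → M → M → ℝ≥0}

theorem measurableEmbedding_coe_onePoint [BorelSpace M] :
    MeasurableEmbedding ((↑) : M → OnePoint M) :=
  OnePoint.isOpenEmbedding_coe.measurableEmbedding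

namespace IsHeatKernel

theorem ae_notMem (hp : IsHeatKernel m X P N p) : ∀ᵐ x ∂m, x ∉ N := by
  rw [ae_iff]; simpa using hp.exceptional.2.1

theorem extendHeat_symm (hp : IsHeatKernel m X P N p) (t : ℝ≥0) (x y : M) :
    extendHeat N p t x y = extendHeat N p t y x := by
  by_cases ht : 0 < t
  · by_cases hx : x ∈ N
    · rw [extendHeat_of_mem_left hx, extendHeat_of_mem_right hx]
    by_cases hy : y ∈ N
    · rw [extendHeat_of_mem_left hy, extendHeat_of_mem_right hy]
    rw [extendHeat_of_notMem ht hx hy, extendHeat_of_notMem ht hy hx, hp.symm t ht x y hx hy]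
  · unfold extendHeat
    rw [if_neg fun h => ht h.1, if_neg fun h => ht h.1]

theorem measurable_extendHeat (hp : IsHeatKernel m X P N p) :
    Measurable fun z : ℝ≥0 × M × M => extendHeat N p z.1 z.2.1 z.2.2 := by
  have hN : MeasurableSet Nᶜ := hp.exceptional.1.compl
  set e : Ioi (0 : ℝ≥0) × (Nᶜ : Set M) × (Nᶜ : Set M) → ℝ≥0 × M × M :=
    Prod.map Subtype.val (Prod.map Subtype.val Subtype.val) with he
  have hemb : MeasurableEmbedding e :=
    (MeasurableEmbedding.subtype_coe measurableSet_Ioi).prodMap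
      ((MeasurableEmbedding.subtype_coe hN).prodMap (MeasurableEmbedding.subtype_coe hN))
  have hext : (fun z : ℝ≥0 × M × M => extendHeat N p z.1 z.2.1 z.2.2) =
      Function.extend e (fun z => (p z.1 z.2.1 z.2.2 : ℝ≥0∞)) fun _ => 0 := by
    ext ⟨t, x, y⟩
    by_cases h : 0 < t ∧ x ∉ N ∧ y ∉ N
    · have : (t, x, y) = e (⟨t, h.1⟩, ⟨x, h.2.1⟩, ⟨y, h.2.2⟩) := rfl
      rw [this, hemb.injective.extend_apply]
      exact extendHeat_of_notMem h.1 h.2.1 h.2.2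
    · rw [Function.extend_apply']
      · exact if_neg h
      · rintro ⟨⟨⟨t', ht'⟩, ⟨x', hx'⟩, ⟨y', hy'⟩⟩, hz⟩
        obtain ⟨rfl, rfl, rfl⟩ : t' = t ∧ x' = x ∧ y' = y := by simpa [e] using hz
        exact h ⟨ht', hx', hy'⟩
  rw [hext]
  exact hemb.measurable_extend hp.measurable.coe_nnreal_ennreal measurable_const

theorem extendHeat_ae_eq (hp : IsHeatKernel m X P N p) {t : ℝ≥0} (ht : 0 < t) {x : M}
    (hx : x ∉ N) : (extendHeat N p t x) =ᵐ[m] fun y => (p t x y : ℝ≥0∞) := by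
  filter_upwards [hp.ae_notMem] with y hy
  exact extendHeat_of_notMem ht hx hy

theorem measure_eq (hp : IsHeatKernel m X P N p) {t : ℝ≥0} (ht : 0 < t) {x : M}
    (hx : x ∉ N) {A : Set M} (hA : MeasurableSet A) :
    P (x : OnePoint M) {ω | X t ω ∈ ((↑) : M → OnePoint M) '' A} =
      ∫⁻ y in A, extendHeat N p t x y ∂m := by
  rw [hp.density t ht x hx A hA]
  exact lintegral_congr_ae (ae_restrict_of_ae (hp.extendHeat_ae_eq ht hx).symm)

theorem extendHeat_chapman_kolmogorov (hp : IsHeatKernel m X P N p) {t s : ℝ≥0} (ht : 0 < t)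
    (hs : 0 < s) (x y : M) :
    extendHeat N p (t + s) x y = ∫⁻ z, extendHeat N p t x z * extendHeat N p s z y ∂m := by
  by_cases hx : x ∈ N
  · simp [extendHeat_of_mem_left hx]
  by_cases hy : y ∈ N
  · simp [extendHeat_of_mem_right hy]
  rw [extendHeat_of_notMem (add_pos ht hs) hx hy, hp.chapman_kolmogorov t s ht hs x y hx hy]
  refine lintegral_congr_ae ?_
  filter_upwards [hp.ae_notMem] with z hz
  rw [extendHeat_of_notMem ht hx hz, extendHeat_of_notMem hs hz hy]

theorem isSubMarkovDensity (hp : IsHeatKernel m X P N p)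
    (hP : ∀ x : M, IsProbabilityMeasure (P (x : OnePoint M))) {t : ℝ≥0} (ht : 0 < t) :
    IsSubMarkovDensity m (extendHeat N p t) where
  measurable := hp.measurable_extendHeat.comp (measurable_const.prodMk measurable_id)
  symm := hp.extendHeat_symm t
  lt_top := extendHeat_lt_top t
  mass_le x := by
    by_cases hx : x ∈ N
    · simp [extendHeat_of_mem_left hx]
    · have := hP x
      have h := hp.measure_eq ht hx MeasurableSet.univ
      rw [Measure.restrict_univ] at h
      rw [← h]
      exact prob_le_one
  sq_lt_top x := by
    -- On the diagonal, Chapman–Kolmogorov and symmetry give $\int p(t,x,z)^2\,m(dz)=p(2t,x,x)$,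
    -- which is finite.
    have h := hp.extendHeat_chapman_kolmogorov ht ht x x
    simp_rw [fun z => hp.extendHeat_symm t z x, ← sq] at h
    rw [← h]
    exact extendHeat_lt_top _ _ _

theorem isHeatDensity (hp : IsHeatKernel m X P N p)
    (hP : ∀ x : M, IsProbabilityMeasure (P (x : OnePoint M))) (hcons : IsConservative m X P) :
    IsHeatDensity m (extendHeat N p) where
  measurable := hp.measurable_extendHeat
  density t ht := hp.isSubMarkovDensity hP ht
  chapman_kolmogorov t s ht hs x y := hp.extendHeat_chapman_kolmogorov ht hs x y
  mass t ht := by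
    filter_upwards [hp.ae_notMem, hcons t ht] with x hx hc
    have h := hp.measure_eq ht hx MeasurableSet.univ
    rw [Measure.restrict_univ] at h
    rw [← h, ← hc]
    congr 1
    ext ω
    simp [OnePoint.ne_infty_iff_exists]

/-- The transition operator is the integral operator of the heat kernel. -/
theorem transitionOp_eq [BorelSpace M] (hp : IsHeatKernel m X P N p) {t : ℝ≥0} (ht : 0 < t)
    (hX : Measurable (X t)) {x : M} (hx : x ∉ N) {u : M → ℝ} (hu : AEStronglyMeasurable u m) :
    transitionOp X P t u x = kernelOp m (extendHeat N p t) u x := by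
  have hc := measurableEmbedding_coe_onePoint (M := M)
  have hk : Measurable (extendHeat N p t x) :=
    hp.measurable_extendHeat.comp (measurable_const.prodMk (measurable_const.prodMk measurable_id))
  set law : Measure (OnePoint M) := (P (x : OnePoint M)).map (X t) with hlaw
  -- The part of the law living on $M$ has density $p(t,x,\cdot)$; the mass at the cemetery is
  -- irrelevant because $u(\Delta)=0$.
  have hcomap : law.comap ((↑) : M → OnePoint M) = m.withDensity (extendHeat N p t x) := by
    ext A hA
    rw [hc.comap_apply, hlaw, Measure.map_apply hX (hc.measurableSet_image.2 hA),
      withDensity_apply _ hA]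
    exact hp.measure_eq ht hx hA
  set g : OnePoint M → ℝ := fun z => z.elim 0 u with hg
  have hgz : ∀ z ∉ range ((↑) : M → OnePoint M), g z = 0 := by
    intro z hz
    induction z using OnePoint.rec with
    | infty => rfl
    | coe z => exact absurd ⟨z, rfl⟩ hz
  have hgi : (range ((↑) : M → OnePoint M)).indicator g = g :=
    indicator_eq_self.2 fun z hz => by
      by_contra h
      exact hz (hgz z h)
  have hmap : (law.comap ((↑) : M → OnePoint M)).map ((↑) : M → OnePoint M) =
      law.restrict (range ((↑) : M → OnePoint M)) := hc.map_comap law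
  have hgm : AEStronglyMeasurable g law := by
    rw [← hgi, aestronglyMeasurable_indicator_iff hc.measurableSet_range, ← hmap,
      hc.aestronglyMeasurable_map_iff, hcomap]
    exact hu.mono_ac (withDensity_absolutelyContinuous _ _)
  have e1 : transitionOp X P t u x = ∫ z, g z ∂law := by
    rw [hlaw, integral_map hX.aemeasurable hgm]; rfl
  rw [e1, ← hgi, integral_indicator hc.measurableSet_range, ← hmap, hc.integral_map, hcomap,
    integral_withDensity_eq_integral_toReal_smul hk
      (Eventually.of_forall fun y => extendHeat_lt_top _ _ _)]
  refine integral_congr_ae (Eventually.of_forall fun y => ?_)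
  simp only [smul_eq_mul, hg, OnePoint.elim_some]
  ring

theorem dirichletEnergy_eq [BorelSpace M] [SigmaFinite m] (hp : IsHeatKernel m X P N p)
    (hX : ∀ t, Measurable (X t)) (hk : IsHeatDensity m (extendHeat N p)) {u : M → ℝ}
    (hu : MemLp u 2 m) :
    dirichletEnergy m X P u = ⨆ (t : ℝ≥0) (_ : 0 < t),
      (t : ℝ≥0∞)⁻¹ * ENNReal.ofReal (hk.semigroup.form (hu.toLp u) t) := by
  unfold dirichletEnergy
  refine iSup_congr fun t => iSup_congr fun ht => ?_
  have ht' : (0 : ℝ) < t := by exact_mod_cast ht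
  rw [ENNReal.ofReal_mul (by positivity), ENNReal.ofReal_inv_of_pos ht',
    ENNReal.ofReal_coe_nnreal, hk.form_toLp ht]
  congr 2
  have hi1 : Integrable (fun x => u x ^ 2) m := hu.integrable_sq
  have hi2 : Integrable (fun x => u x * kernelOp m (extendHeat N p t) u x) m :=
    hu.integrable_mul ((hk.density t ht).memLp_kernelOp hu)
  rw [← integral_sub hi1 hi2]
  refine integral_congr_ae ?_
  filter_upwards [hp.ae_notMem] with x hx
  rw [hp.transitionOp_eq ht (hX t) hx hu.1]
  ring

end IsHeatKernel

end HeatKernel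

/-! ### The heat kernel of the subordinated process -/

/-- The laws of a `γ`-stable subordinator. -/
structure IsStableConvolutionFamily (γ : ℝ) (η : ℝ≥0 → Measure ℝ≥0) : Prop where
  measurable : Measurable η
  isProbabilityMeasure : ∀ t, IsProbabilityMeasure (η t)
  isStableLaw : ∀ t, 0 < t → IsStableLaw γ t (η t)
  lintegral_add : ∀ s t, ∀ f : ℝ≥0 → ℝ≥0∞, Measurable f →
    ∫⁻ r, f r ∂η (s + t) = ∫⁻ a, ∫⁻ b, f (a + b) ∂η t ∂η s

/-- The family is read off from one starting point; uniqueness of stable laws transfers it to all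
the others. -/
theorem exists_stableConvolutionFamily {ι Ω : Type*} [Nonempty ι] [MeasurableSpace Ω] {γ : ℝ}
    (hγ : 0 < γ) {τ : ℝ≥0 → Ω → ℝ≥0} {P : ι → Measure Ω} (hP : ∀ i, IsProbabilityMeasure (P i))
    (hτ : ∀ i, IsStableSubordinator γ τ (P i)) :
    ∃ η : ℝ≥0 → Measure ℝ≥0, IsStableConvolutionFamily γ η ∧
      ∀ i t, 0 < t → (P i).map (τ t) = η t := by
  obtain ⟨i₀⟩ := ‹Nonempty ι›
  have := hP i₀
  refine ⟨fun t => (P i₀).map (τ t), ⟨(hτ i₀).1.measurable_map, fun t =>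
    Measure.isProbabilityMeasure_map ((hτ i₀).1.measurable t).aemeasurable,
    fun t ht => (hτ i₀).isStableLaw ht, fun s t f hf => (hτ i₀).1.lintegral_map_add s t hf⟩,
    fun i t ht => ?_⟩
  have := hP i
  exact ((hτ i).isStableLaw ht).unique hγ ((hτ i₀).isStableLaw ht)

/-- The mixture of the extended heat kernel by `η t`. -/
noncomputable def mixHeat {M : Type*} (N : Set M) (p : ℝ≥0 → M → M → ℝ≥0)
    (η : ℝ≥0 → Measure ℝ≥0) (t : ℝ≥0) (x y : M) : ℝ≥0∞ :=
  ∫⁻ s, extendHeat N p s x y ∂η t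

section

variable {M : Type*} {N : Set M} {p : ℝ≥0 → M → M → ℝ≥0} {η : ℝ≥0 → Measure ℝ≥0}

theorem mixHeat_of_mem_left {t : ℝ≥0} {x y : M} (hx : x ∈ N) : mixHeat N p η t x y = 0 := by
  simp [mixHeat, extendHeat_of_mem_left hx]

theorem mixHeat_of_mem_right {t : ℝ≥0} {x y : M} (hy : y ∈ N) : mixHeat N p η t x y = 0 := by
  simp [mixHeat, extendHeat_of_mem_right hy]

theorem extendHeat_mixHeat (hfin : ∀ (t : ℝ≥0) (x y : M), 0 < t → x ∉ N → y ∉ N →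
      mixHeat N p η t x y < ∞) {t : ℝ≥0} (ht : 0 < t) (x y : M) :
    extendHeat N (fun t x y => (mixHeat N p η t x y).toNNReal) t x y = mixHeat N p η t x y := by
  by_cases hx : x ∈ N
  · rw [extendHeat_of_mem_left hx, mixHeat_of_mem_left hx]
  by_cases hy : y ∈ N
  · rw [extendHeat_of_mem_right hy, mixHeat_of_mem_right hy]
  rw [extendHeat_of_notMem ht hx hy, ENNReal.coe_toNNReal (hfin t x y ht hx hy).ne]

end

section

variable {M : Type*} [MetricSpace M] [MeasurableSpace M] {Ω : Type*} [MeasurableSpace Ω]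
  {m : Measure M} {N : Set M} {p : ℝ≥0 → M → M → ℝ≥0} {γ : ℝ} {η : ℝ≥0 → Measure ℝ≥0}

theorem measurable_mixHeat {X : ℝ≥0 → Ω → OnePoint M} {P : OnePoint M → Measure Ω}
    (hp : IsHeatKernel m X P N p) (hη : IsStableConvolutionFamily γ η) :
    Measurable fun z : ℝ≥0 × M × M => mixHeat N p η z.1 z.2.1 z.2.2 := by
  let κ : Kernel ℝ≥0 ℝ≥0 := ⟨η, hη.measurable⟩
  have hκ : IsMarkovKernel κ := ⟨hη.isProbabilityMeasure⟩
  let κ' : Kernel (ℝ≥0 × M × M) ℝ≥0 := κ.comap Prod.fst measurable_fst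
  have h := Measurable.lintegral_kernel_prod_right' (κ := κ')
    (f := fun w : (ℝ≥0 × M × M) × ℝ≥0 => extendHeat N p w.2 w.1.2.1 w.1.2.2)
    (hp.measurable_extendHeat.comp (measurable_snd.prodMk (measurable_snd.comp measurable_fst)))
  exact h

/-- The convolution identity $\eta_{t+s}=\eta_t*\eta_s$ is combined with Chapman–Kolmogorov for $p$
and Tonelli. -/
theorem mixHeat_chapman_kolmogorov [SFinite m] {X : ℝ≥0 → Ω → OnePoint M}
    {P : OnePoint M → Measure Ω} (hγ : 0 < γ) (hp : IsHeatKernel m X P N p)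
    (hη : IsStableConvolutionFamily γ η) {t s : ℝ≥0} (ht : 0 < t) (hs : 0 < s) (x y : M) :
    mixHeat N p η (t + s) x y = ∫⁻ z, mixHeat N p η t x z * mixHeat N p η s z y ∂m := by
  have := hη.isProbabilityMeasure
  have hm := hp.measurable_extendHeat
  have h1 : ∀ x y, Measurable fun a => extendHeat N p a x y := fun x y =>
    hm.comp (measurable_id.prodMk (measurable_const (a := (x, y))))
  have hm1 : Measurable fun w : ℝ≥0 × M => extendHeat N p w.1 x w.2 :=
    hm.comp (measurable_fst.prodMk (measurable_const.prodMk measurable_snd))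
  have hm2 : Measurable fun w : ℝ≥0 × M => extendHeat N p w.1 w.2 y :=
    hm.comp (measurable_fst.prodMk (measurable_snd.prodMk measurable_const))
  have hpos : ∀ r : ℝ≥0, 0 < r → ∀ᵐ a ∂η r, 0 < a := fun r hr => by
    have : ∀ᵐ a ∂η r, a ≠ 0 := by
      rw [ae_iff]; simpa using (hη.isStableLaw r hr).measure_zero hγ hr
    filter_upwards [this] with a ha using pos_iff_ne_zero.2 ha
  calc mixHeat N p η (t + s) x y
      = ∫⁻ a, ∫⁻ b, extendHeat N p (a + b) x y ∂η s ∂η t := hη.lintegral_add t s _ (h1 x y)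
    _ = ∫⁻ a, ∫⁻ b, ∫⁻ z, extendHeat N p a x z * extendHeat N p b z y ∂m ∂η s ∂η t := by
      refine lintegral_congr_ae ?_
      filter_upwards [hpos t ht] with a ha
      refine lintegral_congr_ae ?_
      filter_upwards [hpos s hs] with b hb
      exact hp.extendHeat_chapman_kolmogorov ha hb x y
    _ = ∫⁻ a, ∫⁻ z, extendHeat N p a x z * mixHeat N p η s z y ∂m ∂η t := by
      refine lintegral_congr fun a => ?_
      rw [lintegral_lintegral_swap]
      · refine lintegral_congr fun z => ?_
        rw [lintegral_const_mul _ (h1 z y), mixHeat]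
      · exact (((hm1.comp (measurable_const.prodMk measurable_snd))).mul hm2).aemeasurable
    _ = ∫⁻ z, ∫⁻ a, extendHeat N p a x z * mixHeat N p η s z y ∂η t ∂m := by
      refine lintegral_lintegral_swap ?_
      refine (hm1.mul ?_).aemeasurable
      exact (measurable_mixHeat hp hη).comp
        (measurable_const.prodMk (measurable_snd.prodMk measurable_const))
    _ = _ := by
      refine lintegral_congr fun z => ?_
      rw [lintegral_mul_const _ (h1 x z)]
      rfl

variable [LocallyCompactSpace M] [TopologicalSpace.SeparableSpace M]
  {H : HuntProcess M Ω} {τ : ℝ≥0 → Ω → ℝ≥0}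

/-- The cemetery is absorbing, so survival at all positive integer times gives survival at every
time, including the random time $\tau_t$. -/
theorem isConservative_subordinate (hcons : IsConservative m H.X H.P)
    (hτ : ∀ x : M, IsStableSubordinator γ τ (H.P (x : OnePoint M))) :
    IsConservative m (subordinate H.X τ) H.P := by
  intro t _
  have hall : ∀ᵐ x : M ∂m, ∀ n : ℕ,
      H.P (x : OnePoint M) {ω | H.X (n + 1) ω ≠ OnePoint.infty} = 1 :=
    ae_all_iff.2 fun n => hcons (n + 1) (by positivity)
  have hset : MeasurableSet {z : OnePoint M | z ≠ OnePoint.infty} :=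
    (measurableSet_singleton _).compl
  filter_upwards [hall] with x hx
  have := H.isProbabilityMeasure x
  have hae : ∀ᵐ ω ∂H.P (x : OnePoint M), ∀ n : ℕ, H.X (n + 1) ω ≠ OnePoint.infty :=
    ae_all_iff.2 fun n => (prob_compl_eq_zero_iff (H.measurable_X _ hset)).2 (hx n)
  have hY : ∀ᵐ ω ∂H.P (x : OnePoint M), subordinate H.X τ t ω ≠ OnePoint.infty := by
    filter_upwards [hae] with ω hω hinf
    obtain ⟨n, hn⟩ := exists_nat_ge (τ t ω)
    exact hω n (H.absorbed ω _ _ (hn.trans (by simp)) hinf)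
  have hm := H.measurable_subordinate ((hτ x).1.measurable t)
  exact (prob_compl_eq_zero_iff (hm hset)).1 hY

variable [BorelSpace M]

theorem isHeatKernel_subordinate [SFinite m] (hγ : 0 < γ) (hp : IsHeatKernel m H.X H.P N p)
    (hη : IsStableConvolutionFamily γ η)
    (hτ : ∀ x : M, IsStableSubordinator γ τ (H.P (x : OnePoint M)))
    (hτη : ∀ (x : M) t, 0 < t → (H.P (x : OnePoint M)).map (τ t) = η t)
    (hindep : ∀ x : M, IndepFun (fun ω (t : ℝ≥0) => H.X t ω) (fun ω (t : ℝ≥0) => τ t ω)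
      (H.P (x : OnePoint M)))
    (hfin : ∀ (t : ℝ≥0) (x y : M), 0 < t → x ∉ N → y ∉ N → mixHeat N p η t x y < ∞) :
    IsHeatKernel m (subordinate H.X τ) H.P N
      (fun t x y => (mixHeat N p η t x y).toNNReal) where
  exceptional := isProperlyExceptional_subordinate hp.exceptional hτ
  measurable := by
    refine ((measurable_mixHeat hp hη).comp (?_ : Measurable
      fun z : Ioi (0 : ℝ≥0) × (Nᶜ : Set M) × (Nᶜ : Set M) =>
        ((z.1 : ℝ≥0), (z.2.1 : M), (z.2.2 : M)))).ennreal_toNNReal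
    fun_prop
  symm t ht x y hx hy := by
    simp only [mixHeat]
    simp_rw [fun s => hp.extendHeat_symm s x y]
  density t ht x hx A hA := by
    have := H.isProbabilityMeasure x
    have := hη.isProbabilityMeasure t
    have hAm : MeasurableSet (((↑) : M → OnePoint M) '' A) :=
      (measurableEmbedding_coe_onePoint (M := M)).measurableSet_image.2 hA
    have h1 := H.lintegral_subordinate ((hτ x).1.measurable t) (hindep x)
      (f := (((↑) : M → OnePoint M) '' A).indicator 1) (measurable_one.indicator hAm)
    have hYm := H.measurable_subordinate ((hτ x).1.measurable t)
    have e1 : ∀ (Y : Ω → OnePoint M), Measurable Y →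
        ∫⁻ ω, (((↑) : M → OnePoint M) '' A).indicator (1 : OnePoint M → ℝ≥0∞) (Y ω)
          ∂H.P (x : OnePoint M) =
        H.P (x : OnePoint M) {ω | Y ω ∈ ((↑) : M → OnePoint M) '' A} := by
      intro Y hY
      exact (lintegral_congr fun _ => rfl).trans (lintegral_indicator_one (hY hAm))
    rw [e1 _ hYm] at h1
    simp_rw [fun s => e1 _ (H.measurable_X s)] at h1
    rw [h1, hτη x t ht]
    have hpos : ∀ᵐ a ∂η t, a ≠ 0 := by
      rw [ae_iff]; simpa using (hη.isStableLaw t ht).measure_zero hγ ht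
    calc _ = ∫⁻ s, ∫⁻ y in A, extendHeat N p s x y ∂m ∂η t := by
          refine lintegral_congr_ae ?_
          filter_upwards [hpos] with s hs
          exact hp.measure_eq (pos_iff_ne_zero.2 hs) hx hA
      _ = ∫⁻ y in A, mixHeat N p η t x y ∂m := by
          refine lintegral_lintegral_swap ?_
          exact (hp.measurable_extendHeat.comp (measurable_fst.prodMk
            (measurable_const.prodMk measurable_snd))).aemeasurable
      _ = _ := by
          refine lintegral_congr_ae (ae_restrict_of_ae ?_)
          filter_upwards [hp.ae_notMem] with y hy
          rw [ENNReal.coe_toNNReal (hfin t x y ht hx hy).ne]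
  chapman_kolmogorov t s ht hs x y hx hy := by
    rw [ENNReal.coe_toNNReal (hfin _ x y (add_pos ht hs) hx hy).ne,
      mixHeat_chapman_kolmogorov hγ hp hη ht hs]
    refine lintegral_congr_ae ?_
    filter_upwards [hp.ae_notMem] with z hz
    rw [ENNReal.coe_toNNReal (hfin t x z ht hx hz).ne,
      ENNReal.coe_toNNReal (hfin s z y hs hz hy).ne]

/-- The Dirichlet energy of the subordinated process is the integral of the approximating forms
for the Lévy measure. -/
theorem dirichletEnergy_subordinate_eq [SigmaFinite m] (h0 : 0 < γ) (h1 : γ < 1)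
    (hk : IsHeatDensity m (extendHeat N p))
    (hcons : IsConservative m H.X H.P) (hη : IsStableConvolutionFamily γ η)
    (hτm : ∀ t, Measurable (τ t))
    (hτ : ∀ x : M, IsStableSubordinator γ τ (H.P (x : OnePoint M)))
    (hq : IsHeatKernel m (subordinate H.X τ) H.P N
      (fun t x y => (mixHeat N p η t x y).toNNReal))
    (hfin : ∀ (t : ℝ≥0) (x y : M), 0 < t → x ∉ N → y ∉ N → mixHeat N p η t x y < ∞)
    {u : M → ℝ} (hu : MemLp u 2 m) :
    dirichletEnergy m (subordinate H.X τ) H.P u =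
      ∫⁻ s, ENNReal.ofReal (hk.semigroup.form (hu.toLp u) s) ∂stableLevyMeasure γ := by
  have hcons' := isConservative_subordinate hcons hτ
  have hk' := hq.isHeatDensity (fun x => H.isProbabilityMeasure x) hcons'
  rw [hq.dirichletEnergy_eq (fun t => H.measurable_subordinate (hτm t)) hk' hu]
  -- The double integral of $(u(x)-u(y))^2q_t$ is computed twice, with $q_t$ as a density and as a
  -- mixture. Hence the approximating form of $Y$ at time $t$ is the $\eta_t$-average of those of
  -- $X$.
  have hform : ∀ t, 0 < t → ENNReal.ofReal (hk'.semigroup.form (hu.toLp u) t) =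
      ∫⁻ s, ENNReal.ofReal (hk.semigroup.form (hu.toLp u) s) ∂η t := by
    intro t ht
    have := hη.isProbabilityMeasure t
    have e1 := hk.lintegral_sq_sub_mul_mix (η t)
      ((hη.isStableLaw t ht).measure_zero h0 ht) hu
    have e2 := (hk'.density t ht).lintegral_sq_sub_mul (hk'.mass t ht) hu
    rw [← hk'.form_toLp ht hu, ENNReal.ofReal_mul (by norm_num), ENNReal.ofReal_ofNat] at e2
    have e3 : ∀ z : M × M, extendHeat N (fun t x y => (mixHeat N p η t x y).toNNReal) t z.1 z.2 =
        ∫⁻ s, extendHeat N p s z.1 z.2 ∂η t := fun z => extendHeat_mixHeat hfin ht _ _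
    simp_rw [e3] at e2
    rw [e2] at e1
    exact (ENNReal.mul_right_inj (by norm_num) (by norm_num)).1 e1
  rw [← iSup_inv_mul_lintegral_eq h0 h1 hη.isStableLaw (fun t _ f hf => hη.lintegral_add t t f hf)
    (hk.semigroup.form_mono _) (hk.semigroup.form_zero _) (fun a b => hk.semigroup.form_subadd _ a b)]
  exact iSup_congr fun t => iSup_congr fun ht => by rw [hform t ht]

end

/-! ### Subordinated forms of a semigroup of contractions -/

theorem ofReal_norm_sub_sq_le {E : Type*} [NormedAddCommGroup E] (u v w : E) :
    ENNReal.ofReal (‖u - v‖ ^ 2) ≤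
      2 * ENNReal.ofReal (‖u - w‖ ^ 2) + 2 * ENNReal.ofReal (‖w - v‖ ^ 2) := by
  rw [← ENNReal.ofReal_ofNat 2, ← ENNReal.ofReal_mul (by norm_num),
    ← ENNReal.ofReal_mul (by norm_num), ← ENNReal.ofReal_add (by positivity) (by positivity)]
  refine ENNReal.ofReal_le_ofReal ?_
  have h := norm_sub_le_norm_sub_add_norm_sub u w v
  nlinarith [sq_nonneg (‖u - w‖ - ‖w - v‖), norm_nonneg (u - v), norm_nonneg (u - w),
    norm_nonneg (w - v)]

namespace SymmContractionSemigroup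

variable {E : Type*} [NormedAddCommGroup E] [InnerProductSpace ℝ E]
  (T : SymmContractionSemigroup E)

/-- The quadratic form of the generator. -/
noncomputable def energy (u : E) : ℝ≥0∞ :=
  ⨆ (t : ℝ≥0) (_ : 0 < t), (t : ℝ≥0∞)⁻¹ * ENNReal.ofReal (T.form u t)

/-- The quadratic form subordinated by a Lévy measure `ν`. -/
noncomputable def levyEnergy (ν : Measure ℝ≥0) (u : E) : ℝ≥0∞ :=
  ∫⁻ s, ENNReal.ofReal (T.form u s) ∂ν

variable {T} {ν : Measure ℝ≥0}

theorem measurable_form (u : E) : Measurable fun s => ENNReal.ofReal (T.form u s) :=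
  (T.form_mono u).measurable.ennreal_ofReal

theorem ofReal_form_le_mul_energy {s : ℝ≥0} (hs : 0 < s) (u : E) :
    ENNReal.ofReal (T.form u s) ≤ s * T.energy u := by
  have h : (s : ℝ≥0∞)⁻¹ * ENNReal.ofReal (T.form u s) ≤ T.energy u :=
    le_iSup₂ (f := fun (t : ℝ≥0) (_ : 0 < t) => (t : ℝ≥0∞)⁻¹ * ENNReal.ofReal (T.form u t)) s hs
  have hs0 : (s : ℝ≥0∞) ≠ 0 := by simpa using hs.ne'
  calc _ = s * ((s : ℝ≥0∞)⁻¹ * ENNReal.ofReal (T.form u s)) := by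
        rw [← mul_assoc, ENNReal.mul_inv_cancel hs0 ENNReal.coe_ne_top, one_mul]
    _ ≤ _ := by gcongr

/-- The approximating form at $s$ is at most both $\|u\|^2$ and $s$ times the energy. This is the
continuous embedding of the original form domain in the subordinated one. -/
theorem levyEnergy_le (hν : ∀ᵐ s ∂ν, s ≠ 0) (u : E) :
    T.levyEnergy ν u ≤ (∫⁻ s, ENNReal.ofReal (min 1 (s / 1 : ℝ)) ∂ν) *
      (T.energy u + ENNReal.ofReal (‖u‖ ^ 2)) := by
  rw [← lintegral_mul_const _ (by fun_prop), levyEnergy]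
  refine lintegral_mono_ae ?_
  filter_upwards [hν] with s hs
  rcases le_total (1 : ℝ) (s / 1) with h | h
  · rw [min_eq_left h, ENNReal.ofReal_one, one_mul]
    exact (ENNReal.ofReal_le_ofReal (T.form_le u s)).trans le_add_self
  · rw [min_eq_right h, div_one, ENNReal.ofReal_coe_nnreal]
    exact (ofReal_form_le_mul_energy (pos_iff_ne_zero.2 hs) u).trans (by gcongr; exact le_self_add)

theorem levyEnergy_sub_le (u v w : E) :
    T.levyEnergy ν (u - v) ≤ 2 * T.levyEnergy ν (u - w) + 2 * T.levyEnergy ν (w - v) := by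
  simp only [levyEnergy]
  rw [← lintegral_const_mul _ (measurable_form _), ← lintegral_const_mul _ (measurable_form _),
    ← lintegral_add_left ((measurable_form _).const_mul 2)]
  refine lintegral_mono fun s => ?_
  have h := T.form_add_le (u - w) (w - v) s
  rw [sub_add_sub_cancel] at h
  refine (ENNReal.ofReal_le_ofReal h).trans ?_
  rw [ENNReal.ofReal_add (by linarith [T.form_nonneg (u - w) s])
    (by linarith [T.form_nonneg (w - v) s]), ENNReal.ofReal_mul (by norm_num),
    ENNReal.ofReal_mul (by norm_num), ENNReal.ofReal_ofNat]

theorem energy_S_lt_top {ε : ℝ≥0} (hε : 0 < ε) (u : E) : T.energy (T.S ε u) < ∞ := by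
  refine lt_of_le_of_lt (iSup₂_le fun t ht => ?_)
    (ENNReal.ofReal_lt_top (r := (2 * ε : ℝ)⁻¹ * ‖u‖ ^ 2))
  have ht' : (0 : ℝ) < t := by exact_mod_cast ht
  rw [← ENNReal.ofReal_coe_nnreal (p := t), ← ENNReal.ofReal_inv_of_pos ht',
    ← ENNReal.ofReal_mul (by positivity)]
  exact ENNReal.ofReal_le_ofReal (T.form_S_le_div hε ht u)

theorem tendsto_norm_sub_S (hT : ∀ u, Tendsto (T.form u) (𝓝[>] 0) (𝓝 0)) (u : E) :
    Tendsto (fun ε => ‖u - T.S ε u‖ ^ 2) (𝓝[>] 0) (𝓝 0) := by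
  refine squeeze_zero (fun _ => by positivity) (T.norm_sub_S_sq_le u) ?_
  simpa using (hT u).const_mul 2

/-- Since $S_\varepsilon$ contracts each approximating form, four times the form of $u$ dominates;
pointwise in $s$ the form of $u-S_\varepsilon u$ is at most its squared norm. -/
theorem tendsto_levyEnergy_sub_S (hT : ∀ u, Tendsto (T.form u) (𝓝[>] 0) (𝓝 0)) {u : E}
    (hu : T.levyEnergy ν u < ∞) :
    Tendsto (fun ε => T.levyEnergy ν (u - T.S ε u)) (𝓝[>] 0) (𝓝 0) := by
  have h := tendsto_lintegral_filter_of_dominated_convergence (μ := ν) (l := 𝓝[>] (0 : ℝ≥0))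
    (F := fun ε s => ENNReal.ofReal (T.form (u - T.S ε u) s)) (f := fun _ => 0)
    (fun s => 4 * ENNReal.ofReal (T.form u s))
    (Eventually.of_forall fun ε => measurable_form _)
    (Eventually.of_forall fun ε => Eventually.of_forall fun s => ?_) ?_
    (Eventually.of_forall fun s => ?_)
  · simpa [levyEnergy] using h
  · rw [← ENNReal.ofReal_ofNat 4, ← ENNReal.ofReal_mul (by norm_num)]
    refine ENNReal.ofReal_le_ofReal ?_
    linarith [T.form_sub_le u (T.S ε u) s, T.form_S_le ε s u]
  · rw [lintegral_const_mul _ (measurable_form _)]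
    exact ENNReal.mul_ne_top (by norm_num) hu.ne
  · rw [← ENNReal.ofReal_zero]
    refine ENNReal.tendsto_ofReal ?_
    exact squeeze_zero (fun _ => T.form_nonneg _ _) (fun _ => T.form_le _ _)
      (tendsto_norm_sub_S hT u)

/-- A core of the form of a strongly continuous semigroup is a core of the subordinated form. -/
theorem exists_levyEnergy_sub_lt (hT : ∀ u, Tendsto (T.form u) (𝓝[>] 0) (𝓝 0))
    (hν : ∀ᵐ s ∂ν, s ≠ 0) (hν' : ∫⁻ s, ENNReal.ofReal (min 1 (s / 1 : ℝ)) ∂ν < ∞) {K : Set E}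
    (hK : ∀ u, T.energy u < ∞ → ∀ δ : ℝ≥0∞, 0 < δ →
      ∃ v ∈ K, T.energy (u - v) + ENNReal.ofReal (‖u - v‖ ^ 2) < δ)
    {u : E} (hu : T.levyEnergy ν u < ∞) {δ : ℝ≥0∞} (hδ : 0 < δ) (hδ' : δ ≠ ∞) :
    ∃ v ∈ K, T.levyEnergy ν (u - v) + ENNReal.ofReal (‖u - v‖ ^ 2) < δ := by
  set C := ∫⁻ s, ENNReal.ofReal (min 1 (s / 1 : ℝ)) ∂ν with hC
  have h1 : Tendsto (fun ε => 2 * (T.levyEnergy ν (u - T.S ε u) +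
      ENNReal.ofReal (‖u - T.S ε u‖ ^ 2))) (𝓝[>] 0) (𝓝 0) := by
    have := ENNReal.Tendsto.const_mul (a := 2) ((tendsto_levyEnergy_sub_S hT hu).add
      (ENNReal.tendsto_ofReal (tendsto_norm_sub_S hT u))) (Or.inr (by norm_num))
    simpa using this
  have hδ2 : 0 < δ / 2 := ENNReal.half_pos hδ.ne'
  -- First $u$ is smoothed to $S_\varepsilon u$, which has finite original energy; then
  -- $S_\varepsilon u$ is approximated from `K`. The tolerance for the second step is divided by
  -- $2(C+1)$, the cost of the embedding together with the factor $2$ in the triangle inequality.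
  obtain ⟨ε, hε1, hε⟩ := ((h1.eventually_lt_const hδ2).and self_mem_nhdsWithin).exists
  have hε0 : 0 < ε := hε
  have hD : 2 * (C + 1) ≠ ∞ := ENNReal.mul_ne_top (by norm_num) (by simp [hν'.ne])
  obtain ⟨v, hv, hlt⟩ := hK _ (energy_S_lt_top hε0 u) (δ / 2 / (2 * (C + 1)))
    (ENNReal.div_pos hδ2.ne' hD)
  refine ⟨v, hv, ?_⟩
  set w := T.S ε u
  have h2 : 2 * (T.levyEnergy ν (w - v) + ENNReal.ofReal (‖w - v‖ ^ 2)) ≤ δ / 2 := by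
    calc _ ≤ 2 * (C * (T.energy (w - v) + ENNReal.ofReal (‖w - v‖ ^ 2)) +
          (T.energy (w - v) + ENNReal.ofReal (‖w - v‖ ^ 2))) := by
          gcongr
          · exact levyEnergy_le hν _
          · exact le_add_self
      _ = 2 * (C + 1) * (T.energy (w - v) + ENNReal.ofReal (‖w - v‖ ^ 2)) := by ring
      _ ≤ 2 * (C + 1) * (δ / 2 / (2 * (C + 1))) := by gcongr
      _ ≤ δ / 2 := ENNReal.mul_div_le
  calc T.levyEnergy ν (u - v) + ENNReal.ofReal (‖u - v‖ ^ 2)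
      ≤ (2 * T.levyEnergy ν (u - w) + 2 * T.levyEnergy ν (w - v)) +
        (2 * ENNReal.ofReal (‖u - w‖ ^ 2) + 2 * ENNReal.ofReal (‖w - v‖ ^ 2)) :=
        add_le_add (levyEnergy_sub_le u v w) (ofReal_norm_sub_sq_le u v w)
    _ = 2 * (T.levyEnergy ν (u - w) + ENNReal.ofReal (‖u - w‖ ^ 2)) +
        2 * (T.levyEnergy ν (w - v) + ENNReal.ofReal (‖w - v‖ ^ 2)) := by ring
    _ < δ / 2 + δ / 2 := ENNReal.add_lt_add_of_lt_of_le
        (ne_top_of_le_ne_top (ENNReal.div_ne_top hδ' (by norm_num)) h2) hε1 h2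
    _ = δ := ENNReal.add_halves δ

end SymmContractionSemigroup

/-! ### Strong continuity and regularity -/

theorem OnePoint.continuous_elim_zero {M : Type*} [TopologicalSpace M] [T2Space M] {u : M → ℝ}
    (hu : Continuous u) (hc : HasCompactSupport u) :
    Continuous fun z : OnePoint M => z.elim 0 u := by
  refine (OnePoint.continuous_iff _).2 ⟨?_, hu⟩
  rw [coclosedCompact_eq_cocompact]
  exact hc.is_zero_at_infty

section

variable {M : Type*} [MetricSpace M] [MeasurableSpace M] {Ω : Type*} [MeasurableSpace Ω]
  {m : Measure M} {N : Set M} {p : ℝ≥0 → M → M → ℝ≥0} {H : HuntProcess M Ω}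

theorem abs_transitionOp_le {u : M → ℝ} {C : ℝ} (hC : ∀ x, |u x| ≤ C) (hC0 : 0 ≤ C) (t : ℝ≥0)
    (x : M) : |transitionOp H.X H.P t u x| ≤ C := by
  have := H.isProbabilityMeasure x
  have h : ∀ᵐ ω ∂H.P (x : OnePoint M), ‖(H.X t ω).elim 0 u‖ ≤ C := by
    refine Eventually.of_forall fun ω => ?_
    induction H.X t ω using OnePoint.rec with
    | infty => simpa using hC0
    | coe y => exact hC y
  simpa [transitionOp] using norm_integral_le_of_norm_le_const h

theorem tendsto_transitionOp {u : M → ℝ} (hu : Continuous u) (hc : HasCompactSupport u) (x : M) :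
    Tendsto (fun t => transitionOp H.X H.P t u x) (𝓝[>] 0) (𝓝 (u x)) := by
  have := H.isProbabilityMeasure x
  have hcont := OnePoint.continuous_elim_zero hu hc
  obtain ⟨C, hC⟩ := hc.exists_bound_of_continuous hu
  have h := tendsto_integral_filter_of_dominated_convergence (μ := H.P (x : OnePoint M))
    (l := 𝓝[>] (0 : ℝ≥0)) (F := fun t ω => (H.X t ω).elim 0 u) (f := fun _ => u x)
    (fun _ => max C 0)
    (Eventually.of_forall fun t =>
      (hcont.measurable.comp (H.measurable_X t)).aestronglyMeasurable)
    (Eventually.of_forall fun t => Eventually.of_forall fun ω => ?_) (integrable_const _) ?_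
  · rw [integral_const, probReal_univ, one_smul] at h
    exact h
  · induction H.X t ω using OnePoint.rec with
    | infty => simp
    | coe y => exact (hC y).trans (le_max_left _ _)
  · filter_upwards [H.normal x] with ω hω
    have h1 : Tendsto (fun t => H.X t ω) (𝓝[>] 0) (𝓝 (x : OnePoint M)) := by
      rw [← hω]
      exact (H.right_continuous ω 0).mono_left (nhdsWithin_mono _ Ioi_subset_Ici_self)
    exact (hcont.tendsto _).comp h1

/-- Regularity is inherited by the subordinated form. -/
theorem isRegularForm_of_energy {X Y : ℝ≥0 → Ω → OnePoint M} {P : OnePoint M → Measure Ω}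
    {T : SymmContractionSemigroup (Lp ℝ 2 m)} {ν : Measure ℝ≥0}
    (hT : ∀ w, Tendsto (T.form w) (𝓝[>] 0) (𝓝 0)) (hν : ∀ᵐ s ∂ν, s ≠ 0)
    (hν' : ∫⁻ s, ENNReal.ofReal (min 1 (s / 1 : ℝ)) ∂ν < ∞)
    (hX : ∀ (u : M → ℝ) (hu : MemLp u 2 m), dirichletEnergy m X P u = T.energy (hu.toLp u))
    (hY : ∀ (u : M → ℝ) (hu : MemLp u 2 m), dirichletEnergy m Y P u = T.levyEnergy ν (hu.toLp u))
    (hreg : IsRegularForm m X P) : IsRegularForm m Y P := by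
  -- The old core lies in the new one, so uniform density is inherited and only density in the new
  -- form norm needs work.
  have hcore : ∀ v, InCore m X P v → InCore m Y P v := by
    rintro v ⟨⟨hv, hve⟩, hvc⟩
    refine ⟨⟨hv, ?_⟩, hvc⟩
    rw [hY v hv]
    rw [hX v hv] at hve
    exact (SymmContractionSemigroup.levyEnergy_le hν _).trans_lt
      (ENNReal.mul_lt_top hν' (ENNReal.add_lt_top.2 ⟨hve, ENNReal.ofReal_lt_top⟩))
  have hnorm : ∀ (u v : M → ℝ) (hu : MemLp u 2 m) (hv : MemLp v 2 m),
      ∫⁻ x, ENNReal.ofReal ((u x - v x) ^ 2) ∂m = ENNReal.ofReal (‖hu.toLp u - hv.toLp v‖ ^ 2) := by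
    intro u v hu hv
    rw [← MemLp.toLp_sub, norm_toLp_sq, ofReal_integral_eq_lintegral_ofReal
      (hu.sub hv).integrable_sq (Eventually.of_forall fun x => sq_nonneg _)]
    rfl
  refine ⟨?_, fun f hf hfc ε hε => ?_⟩
  · rintro u ⟨hu, hue⟩ ε hε
    rw [hY u hu] at hue
    have hK : ∀ w, T.energy w < ∞ → ∀ δ : ℝ≥0∞, 0 < δ →
        ∃ z ∈ {z | ∃ (v : M → ℝ) (hv : MemLp v 2 m), InCore m X P v ∧ z = hv.toLp v},
          T.energy (w - z) + ENNReal.ofReal (‖w - z‖ ^ 2) < δ := by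
      intro w hw δ hδ
      obtain ⟨u, hu, rfl⟩ := exists_memLp_eq_toLp w
      obtain ⟨r, -, hr0, hr⟩ := ENNReal.lt_iff_exists_real_btwn.1 hδ
      obtain ⟨v, hv, hlt⟩ := hreg.1 u ⟨hu, by rwa [hX u hu]⟩ r (ENNReal.ofReal_pos.1 hr0)
      refine ⟨_, ⟨v, hv.1.1, hv, rfl⟩, ?_⟩
      rw [hnorm u v hu hv.1.1] at hlt
      have : dirichletEnergy m X P (fun x => u x - v x) =
          T.energy (hu.toLp u - hv.1.1.toLp v) := hX _ (hu.sub hv.1.1)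
      rw [this] at hlt
      exact hlt.trans hr
    obtain ⟨_, ⟨v, hv, hvX, rfl⟩, hlt⟩ := SymmContractionSemigroup.exists_levyEnergy_sub_lt hT hν
      hν' hK hue (ENNReal.ofReal_pos.2 hε) ENNReal.ofReal_ne_top
    refine ⟨v, hcore v hvX, ?_⟩
    rw [hnorm u v hu hv]
    have : dirichletEnergy m Y P (fun x => u x - v x) =
        T.levyEnergy ν (hu.toLp u - hv.toLp v) := hY _ (hu.sub hv)
    rwa [this]
  · obtain ⟨v, hv, hlt⟩ := hreg.2 f hf hfc ε hε
    exact ⟨v, hcore v hv, hlt⟩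

variable [BorelSpace M] [SigmaFinite m]

/-- Right continuity of paths gives $T_tu\to u$ pointwise; integrability of $u$ and the sup bound on
$T_tu$ allow dominated convergence. -/
theorem IsHeatKernel.tendsto_form_of_continuous (hp : IsHeatKernel m H.X H.P N p)
    (hk : IsHeatDensity m (extendHeat N p)) {u : M → ℝ} (hum : MemLp u 2 m) (hu : Continuous u)
    (hc : HasCompactSupport u) (hi : Integrable u m) :
    Tendsto (hk.semigroup.form (hum.toLp u)) (𝓝[>] 0) (𝓝 0) := by
  obtain ⟨C, hC⟩ := hc.exists_bound_of_continuous hu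
  have h : Tendsto (fun t => ∫ x, u x * transitionOp H.X H.P t u x ∂m) (𝓝[>] 0)
      (𝓝 (∫ x, u x * u x ∂m)) := by
    refine tendsto_integral_filter_of_dominated_convergence (fun x => |u x| * max C 0) ?_
      (Eventually.of_forall fun t => Eventually.of_forall fun x => ?_) (hi.abs.mul_const _)
      (Eventually.of_forall fun x => (tendsto_transitionOp hu hc x).const_mul _)
    · filter_upwards [self_mem_nhdsWithin] with t ht
      refine hum.1.mul ?_
      refine ((hk.density t ht).memLp_kernelOp hum).1.congr ?_
      filter_upwards [hp.ae_notMem] with x hx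
      exact (hp.transitionOp_eq ht (H.measurable_X t) hx hum.1).symm
    · rw [norm_mul]
      exact mul_le_mul_of_nonneg_left (abs_transitionOp_le
        (fun x => (hC x).trans (le_max_left _ _)) (le_max_right _ _) t x) (norm_nonneg _)
  have h2 := h.const_sub (∫ x, u x ^ 2 ∂m)
  rw [show ∫ x, u x ^ 2 ∂m - ∫ x, u x * u x ∂m = 0 by simp_rw [sq]; simp] at h2
  refine h2.congr' ?_
  filter_upwards [self_mem_nhdsWithin] with t ht
  rw [hk.form_toLp ht hum]
  congr 1
  refine integral_congr_ae ?_
  filter_upwards [hp.ae_notMem] with x hx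
  rw [hp.transitionOp_eq ht (H.measurable_X t) hx hum.1]

variable [LocallyCompactSpace M] [TopologicalSpace.SeparableSpace M] [IsFiniteMeasureOnCompacts m]

/-- Approximation in $L^2$ by compactly supported continuous functions, the error being uniform in
$t$ because the form is at most the squared norm. -/
theorem IsHeatKernel.tendsto_form (hp : IsHeatKernel m H.X H.P N p)
    (hk : IsHeatDensity m (extendHeat N p)) (w : Lp ℝ 2 m) :
    Tendsto (hk.semigroup.form w) (𝓝[>] 0) (𝓝 0) := by
  have := UniformSpace.secondCountable_of_separable M
  obtain ⟨u, hu, rfl⟩ := exists_memLp_eq_toLp w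
  refine tendsto_order.2 ⟨fun a ha => Eventually.of_forall fun t =>
    ha.trans_le (hk.semigroup.form_nonneg _ _), fun δ hδ => ?_⟩
  have hη : 0 < √(δ / 4) := Real.sqrt_pos.2 (by positivity)
  obtain ⟨g, hgc, hg, hgcont, hgm⟩ := hu.exists_hasCompactSupport_eLpNorm_sub_le
    (by norm_num) (ε := ENNReal.ofReal √(δ / 4)) (by simpa using hδ)
  have hn : ‖hu.toLp u - hgm.toLp g‖ ^ 2 ≤ δ / 4 := by
    rw [← MemLp.toLp_sub, Lp.norm_toLp]
    calc _ ≤ √(δ / 4) ^ 2 := by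
          gcongr
          exact ENNReal.toReal_le_of_le_ofReal hη.le hg
      _ = δ / 4 := Real.sq_sqrt (by positivity)
  have hev := (hp.tendsto_form_of_continuous hk hgm hgcont hgc
    (hgcont.integrable_of_hasCompactSupport hgc)).eventually_lt_const (u := δ / 4) (by positivity)
  filter_upwards [hev] with t ht
  have h1 := hk.semigroup.form_add_le (hu.toLp u - hgm.toLp g) (hgm.toLp g) t
  rw [sub_add_cancel] at h1
  have h2 := hk.semigroup.form_le (hu.toLp u - hgm.toLp g) t
  linarith

end

/-! ### Jump kernels -/

theorem ae_prod_notMem {α : Type*} [MeasurableSpace α] {m : Measure α} {N : Set α} (hN : ∀ᵐ x ∂m, x ∉ N) :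
    ∀ᵐ z ∂m.prod m, z.1 ∉ N ∧ z.2 ∉ N :=
  (Measure.quasiMeasurePreserving_fst.ae hN).and (Measure.quasiMeasurePreserving_snd.ae hN)

section

variable {M : Type*} [MetricSpace M] [MeasurableSpace M] {m : Measure M}

theorem jumpEnergy_const_mul {J : M → M → ℝ} {c : ℝ} (hc : 0 ≤ c) (u : M → ℝ) :
    jumpEnergy m (fun x y => c * J x y) u = ENNReal.ofReal c * jumpEnergy m J u := by
  unfold jumpEnergy
  rw [← lintegral_const_mul' _ _ ENNReal.ofReal_ne_top]
  refine lintegral_congr fun z => ?_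
  rw [← ENNReal.ofReal_mul hc]
  congr 1
  ring

variable [OpensMeasurableSpace M] [SecondCountableTopology M]

theorem measurableSet_fst_ne_snd : MeasurableSet {z : M × M | z.1 ≠ z.2} :=
  (isClosed_eq continuous_fst continuous_snd).measurableSet.compl

theorem jumpEnergy_mono {J J' : M → M → ℝ} {N : Set M} (hN : ∀ᵐ x ∂m, x ∉ N)
    (h : ∀ x y, x ∉ N → y ∉ N → x ≠ y → J x y ≤ J' x y) (u : M → ℝ) :
    jumpEnergy m J u ≤ jumpEnergy m J' u := by
  refine lintegral_mono_ae ((ae_restrict_iff' measurableSet_fst_ne_snd).2 ?_)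
  filter_upwards [ae_prod_notMem hN] with z hz hne
  exact ENNReal.ofReal_le_ofReal
    (mul_le_mul_of_nonneg_left (h _ _ hz.1 hz.2 hne) (sq_nonneg _))

/-- The kernel may be infinite on the diagonal, but there the squared difference vanishes and
$0\cdot\infty=0$. -/
theorem jumpEnergy_toReal {κ : M → M → ℝ≥0∞} {N : Set M} (hN : ∀ᵐ x ∂m, x ∉ N)
    (hκ : ∀ x y, x ∉ N → y ∉ N → x ≠ y → κ x y < ∞) (u : M → ℝ) :
    jumpEnergy m (fun x y => (κ x y).toReal) u =
      ∫⁻ z : M × M, ENNReal.ofReal ((u z.1 - u z.2) ^ 2) * κ z.1 z.2 ∂m.prod m := by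
  unfold jumpEnergy
  rw [← lintegral_indicator measurableSet_fst_ne_snd]
  refine lintegral_congr_ae ?_
  filter_upwards [ae_prod_notMem hN] with z hz
  by_cases hne : z.1 = z.2
  · rw [indicator_of_notMem (by simpa using hne), hne]
    simp
  · rw [indicator_of_mem (by exact hne), ENNReal.ofReal_mul (sq_nonneg _),
      ENNReal.ofReal_toReal (hκ _ _ hz.1 hz.2 hne).ne]

end

theorem stableHeat_lt_top {M : Type*} [MetricSpace M] [MeasurableSpace M] (m : Measure M)
    (γ β₁ β₂ t : ℝ) (x y : M) : stableHeat m γ β₁ β₂ t x y < ∞ :=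
  (min_le_left _ _).trans_lt ENNReal.ofReal_lt_top

/-- The kernel is $J=\frac12\int p_s\,\nu(ds)$; the factor $\frac12$ compensates the $2$ in
$\iint(u(x)-u(y))^2p_s=2\langle u-T_su,u\rangle$. -/
theorem IsHeatDensity.exists_jumpKernel {M : Type*} [MetricSpace M] [MeasurableSpace M]
    [OpensMeasurableSpace M] [SecondCountableTopology M] {m : Measure M} [SigmaFinite m]
    {N : Set M} {p : ℝ≥0 → M → M → ℝ≥0} (hk : IsHeatDensity m (extendHeat N p))
    (hN : ∀ᵐ x ∂m, x ∉ N) {ν : Measure ℝ≥0} [SFinite ν] (hν : ν {0} = 0) {g : M → M → ℝ}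
    {a b : ℝ} (h : ∀ x y, x ∉ N → y ∉ N → x ≠ y →
      ENNReal.ofReal (a * g x y) ≤ ∫⁻ s, (p s x y : ℝ≥0∞) ∂ν ∧
        ∫⁻ s, (p s x y : ℝ≥0∞) ∂ν ≤ ENNReal.ofReal (b * g x y)) (hb : ∀ x y, 0 ≤ b * g x y) :
    ∃ J : M → M → ℝ, Measurable (Function.uncurry J) ∧ (∀ x y, 0 ≤ J x y) ∧
      (∀ x y, J x y = J y x) ∧
      (∀ (u : M → ℝ) (hu : MemLp u 2 m),
        hk.semigroup.levyEnergy ν (hu.toLp u) = jumpEnergy m J u) ∧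
      ∀ x y, x ∉ N → y ∉ N → x ≠ y → a / 2 * g x y ≤ J x y ∧ J x y ≤ b / 2 * g x y := by
  set κ : M → M → ℝ≥0∞ := fun x y => ∫⁻ s, extendHeat N p s x y ∂ν with hκ
  have hκeq : ∀ x y, x ∉ N → y ∉ N → κ x y = ∫⁻ s, (p s x y : ℝ≥0∞) ∂ν := fun x y hx hy =>
    lintegral_extendHeat_eq hν hx hy
  have hfin : ∀ x y, x ∉ N → y ∉ N → x ≠ y → κ x y < ∞ := fun x y hx hy hxy =>
    (hκeq x y hx hy).trans_lt ((h x y hx hy hxy).2.trans_lt ENNReal.ofReal_lt_top)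
  refine ⟨fun x y => 2⁻¹ * (κ x y).toReal, ?_, fun x y => by positivity, fun x y => ?_,
    fun u hu => ?_, fun x y hx hy hxy => ?_⟩
  · exact (hk.measurable_mix ν).ennreal_toReal.const_mul _
  · have : κ x y = κ y x := by
      refine lintegral_congr_ae ?_
      have : ∀ᵐ s ∂ν, s ≠ 0 := by rw [ae_iff]; simpa using hν
      filter_upwards [this] with s hs
      exact (hk.density s (pos_iff_ne_zero.2 hs)).symm x y
    simp only [this]
  · rw [jumpEnergy_const_mul (by norm_num), jumpEnergy_toReal hN hfin,
      hk.lintegral_sq_sub_mul_mix ν hν hu, ← mul_assoc, ENNReal.ofReal_inv_of_pos (by norm_num),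
      ENNReal.ofReal_ofNat, ENNReal.inv_mul_cancel (by norm_num) (by norm_num), one_mul]
    rfl
  · obtain ⟨h1, h2⟩ := h x y hx hy hxy
    rw [← hκeq x y hx hy] at h1 h2
    have h1' := (ENNReal.ofReal_le_iff_le_toReal (hfin x y hx hy hxy).ne).1 h1
    have h2' := ENNReal.toReal_le_of_le_ofReal (hb x y) h2
    constructor <;> simp only <;> linarith

/-! ### The main theorem for the subordinated process. -/

theorem mainTheorem3 {M : Type*} [MetricSpace M] [LocallyCompactSpace M]
    [TopologicalSpace.SeparableSpace M] [MeasurableSpace M] [BorelSpace M]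
    (m : Measure M) [IsFiniteMeasureOnCompacts m] [m.IsOpenPosMeasure]
    (hV : VolumeGrowth m)
    {Ω : Type*} [MeasurableSpace Ω] (H : HuntProcess M Ω)
    (hdiff : H.IsDiffusion)
    (hsymm : IsSymmetricProcess m H.X H.P)
    (hcons : IsConservative m H.X H.P)
    (hreg : IsRegularForm m H.X H.P)
    (N : Set M) (p : ℝ≥0 → M → M → ℝ≥0) (hp : IsHeatKernel m H.X H.P N p)
    (β₁ β₂ : ℝ) (hβ₁ : 2 ≤ β₁) (hβ₂ : 2 ≤ β₂) (hbounds : SubGaussianBounds m N p β₁ β₂)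
    (γ : ℝ) (hγ₀ : 0 < γ) (hγ₁ : γ < 1)
    (τ : ℝ≥0 → Ω → ℝ≥0)
    (hτ : ∀ x : M, IsStableSubordinator γ τ (H.P (x : OnePoint M)))
    (hindep : ∀ x : M, IndepFun (fun ω (t : ℝ≥0) => H.X t ω) (fun ω (t : ℝ≥0) => τ t ω)
      (H.P (x : OnePoint M))) :
    -- the Dirichlet form of the subordinated process is regular
    IsRegularForm m (subordinate H.X τ) H.P ∧
    -- it is a pure jump form whose jump kernel is comparable to `1 / (V(x, d) φ(d))`
    (∃ J : M → M → ℝ, Measurable (Function.uncurry J) ∧ (∀ x y, 0 ≤ J x y) ∧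
      (∀ x y, J x y = J y x) ∧
      (∀ u : M → ℝ, InCore m (subordinate H.X τ) H.P u →
        dirichletEnergy m (subordinate H.X τ) H.P u = jumpEnergy m J u) ∧
      ∃ a b : ℝ, 0 < a ∧ 0 < b ∧ ∀ x y : M, x ∉ N → y ∉ N → x ≠ y →
        a * stableJump m γ β₁ β₂ x y ≤ J x y ∧ J x y ≤ b * stableJump m γ β₁ β₂ x y) ∧
    -- the form is comparable to the stable-like form
    (∃ a b : ℝ, 0 < a ∧ 0 < b ∧ ∀ u : M → ℝ, InCore m (subordinate H.X τ) H.P u →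
      ENNReal.ofReal a * jumpEnergy m (stableJump m γ β₁ β₂) u ≤
          dirichletEnergy m (subordinate H.X τ) H.P u ∧
        dirichletEnergy m (subordinate H.X τ) H.P u ≤
          ENNReal.ofReal b * jumpEnergy m (stableJump m γ β₁ β₂) u) ∧
    -- the subordinated process has a heat kernel with two-sided stable-like bounds
    (∃ q : ℝ≥0 → M → M → ℝ≥0, IsHeatKernel m (subordinate H.X τ) H.P N q ∧
      ∃ a b : ℝ, 0 < a ∧ 0 < b ∧ ∀ (t : ℝ≥0) (x y : M), 0 < t → x ∉ N → y ∉ N →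
        ENNReal.ofReal a * stableHeat m γ β₁ β₂ t x y ≤ (q t x y : ℝ≥0∞) ∧
          (q t x y : ℝ≥0∞) ≤ ENNReal.ofReal b * stableHeat m γ β₁ β₂ t x y) := by
  have := UniformSpace.secondCountable_of_separable M
  -- The subordinator is described only under $P_x$ with $x\in M$, so an empty $M$ gives no law for
  -- $\tau_t$; in that case every energy vanishes and the pointwise claims are vacuous.
  rcases isEmpty_or_nonempty M with hM | hM
  · have hE : dirichletEnergy m (subordinate H.X τ) H.P = dirichletEnergy m H.X H.P := by
      funext u
      unfold dirichletEnergy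
      simp [Measure.eq_zero_of_isEmpty m]
    have hz : ∀ u, dirichletEnergy m (subordinate H.X τ) H.P u = 0 := fun u => by
      simp [dirichletEnergy, Measure.eq_zero_of_isEmpty m]
    have hj : ∀ J u, jumpEnergy m J u = 0 := fun J u => by
      simp [jumpEnergy, Measure.eq_zero_of_isEmpty m]
    refine ⟨?_, ⟨0, measurable_const, fun _ _ => le_rfl, fun _ _ => rfl,
      fun u _ => by rw [hz, hj], 1, 1, one_pos, one_pos, fun x => isEmptyElim x⟩,
      ⟨1, 1, one_pos, one_pos, fun u _ => by simp [hz, hj]⟩,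
      0, ⟨isProperlyExceptional_subordinate hp.exceptional hτ, measurable_const,
        fun _ _ x => isEmptyElim x, fun _ _ x => isEmptyElim x, fun _ _ _ _ x => isEmptyElim x⟩,
      1, 1, one_pos, one_pos, fun _ x => isEmptyElim x⟩
    simpa only [IsRegularForm, InCore, InFormDomain, hE] using hreg
  obtain ⟨η, hη, hτη⟩ := exists_stableConvolutionFamily (P := fun x : M => H.P (x : OnePoint M))
    hγ₀ (fun x => H.isProbabilityMeasure x) hτ
  obtain ⟨a, b, ha, hb, hheat⟩ := hbounds.exists_stableHeat_bounds hV hβ₁ hβ₂ hγ₀ hγ₁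
  obtain ⟨a', b', ha', hb', hjump⟩ := hbounds.exists_jump_bounds hV hβ₁ hβ₂ hγ₀ hγ₁
  have hmix : ∀ (t : ℝ≥0) (x y : M), 0 < t → x ∉ N → y ∉ N →
      mixHeat N p η t x y = ∫⁻ s, (p s x y : ℝ≥0∞) ∂η t := fun t x y ht hx hy =>
    lintegral_extendHeat_eq ((hη.isStableLaw t ht).measure_zero hγ₀ ht) hx hy
  -- Finiteness of the mixture, diagonal included, comes from the on-diagonal bound; it is needed
  -- for a real-valued kernel.
  have hfin : ∀ (t : ℝ≥0) (x y : M), 0 < t → x ∉ N → y ∉ N → mixHeat N p η t x y < ∞ := by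
    intro t x y ht hx hy
    rw [hmix t x y ht hx hy]
    exact (hheat t (η t) ht (hη.isStableLaw t ht) x y hx hy).2.trans_lt
      (ENNReal.mul_lt_top ENNReal.ofReal_lt_top (stableHeat_lt_top _ _ _ _ _ _ _))
  have hk := hp.isHeatDensity (fun x => H.isProbabilityMeasure x) hcons
  have hq := isHeatKernel_subordinate hγ₀ hp hη hτ hτη hindep hfin
  obtain ⟨x₀⟩ := hM
  have hY : ∀ (u : M → ℝ) (hu : MemLp u 2 m), dirichletEnergy m (subordinate H.X τ) H.P u =
      hk.semigroup.levyEnergy (stableLevyMeasure γ) (hu.toLp u) := fun u hu =>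
    dirichletEnergy_subordinate_eq hγ₀ hγ₁ hk hcons hη (hτ x₀).1.measurable hτ hq hfin hu
  have hjump_nonneg : ∀ x y, 0 ≤ stableJump m γ β₁ β₂ x y := fun x y => by
    unfold stableJump vol scale
    split_ifs <;> positivity
  obtain ⟨J, hJm, hJ0, hJs, hJE, hJb⟩ := hk.exists_jumpKernel hp.ae_notMem
    (stableLevyMeasure_zero γ) hjump fun x y => mul_nonneg hb'.le (hjump_nonneg x y)
  have hEJ : ∀ u : M → ℝ, InCore m (subordinate H.X τ) H.P u →
      dirichletEnergy m (subordinate H.X τ) H.P u = jumpEnergy m J u := fun u hu =>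
    (hY u hu.1.1).trans (hJE u hu.1.1)
  refine ⟨?_, ⟨J, hJm, hJ0, hJs, hEJ, a' / 2, b' / 2, by positivity, by positivity, hJb⟩,
    ⟨a' / 2, b' / 2, by positivity, by positivity, fun u hu => ?_⟩,
    ⟨_, hq, a, b, ha, hb, fun t x y ht hx hy => ?_⟩⟩
  · have hν : ∀ᵐ s ∂stableLevyMeasure γ, s ≠ 0 := by
      rw [ae_iff]; simpa using stableLevyMeasure_zero γ
    have hν' : ∫⁻ s, ENNReal.ofReal (min 1 (s / 1 : ℝ)) ∂stableLevyMeasure γ < ∞ :=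
      (lintegral_min_one_le (γ := γ) (t := 1) one_pos fun l hl => by
        rw [lintegral_one_sub_exp_stableLevyMeasure hγ₀ hγ₁ hl.le, one_mul]).trans_lt
        ENNReal.ofReal_lt_top
    exact isRegularForm_of_energy (hp.tendsto_form hk) hν hν'
      (fun u hu => hp.dirichletEnergy_eq H.measurable_X hk hu) hY hreg
  · rw [hEJ u hu, ← jumpEnergy_const_mul (by positivity), ← jumpEnergy_const_mul (by positivity)]
    exact ⟨jumpEnergy_mono hp.ae_notMem (fun x y hx hy hxy => (hJb x y hx hy hxy).1) u,
      jumpEnergy_mono hp.ae_notMem (fun x y hx hy hxy => (hJb x y hx hy hxy).2) u⟩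
  · rw [ENNReal.coe_toNNReal (hfin t x y ht hx hy).ne, hmix t x y ht hx hy]
    exact hheat t (η t) ht (hη.isStableLaw t ht) x y hx hy
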